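/- **Setting.** Let $\mathfrak g$ be a complex Kac–Moody Lie algebra of a generalized Cartan matrix, with Cartan subalgebra $\mathfrak h$, simple roots and coroots, Chevalley generators $e_i,f_i$; let $N^+$ be the subalgebra generated by the $e_i$, $\mathfrak g'=[\mathfrak g,\mathfrak g]$, $\mathfrak h'=\mathfrak h\cap\mathfrak g'$, and $\mathfrak h=\mathfrak h'\oplus\mathfrak h''$. Let $A=\mathbb C[t_1^{\pm1},\dots,t_n^{\pm1}]$, and let $\mathfrak g_A=\mathfrak g'\otimes A\oplus\mathfrak h''\supseteq\mathfrak g$ and $\mathfrak h_A=\mathfrak h'\otimes A\oplus\mathfrak h''\supseteq\mathfrak h$, with bracket $[X\otimes p,Y\otimes q]=[X,Y]\otimes pq$ (elements of $\mathfrak h''$ being regarded as $h\otimes 1$). For $\Psi\in\mathfrak h_A^*$ let $M(\Psi)=U(\mathfrak g_A)/J_\Psi$, where $J_\Psi$ is the left ideal generated by $N^+\otimes A$ and all $h-\Psi(h)$, $h\in\mathfrak h_A$, and let $V(\Psi)$ be the quotient of $M(\Psi)$ by the sum of its proper submodules (its irreducible quotient). The character of $V(\Psi)$ is the formal sum $\operatorname{ch}V(\Psi)=\sum_{\mu\in\mathfrak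 h^*}\dim V(\Psi)_\mu\,e^\mu$ over the $\mathfrak h$-weight spaces. A function $f:\mathbb Z^n\to\mathbb C$ is *exp-polynomial* (with exponents in $B\subseteq(\mathbb C^*)^n$) if it is a finite sum $f(m)=\sum_{\lambda}p_\lambda(m)\,\lambda_1^{m_1}\cdots\lambda_n^{m_n}$ with polynomials $p_\lambda$ and $\lambda\in(\mathbb C^*)^n$ (resp. $\lambda\in B$). Let $\psi\in\mathfrak h_A^*$ be such that $m\mapsto\psi(h\otimes t^m)$ is exp-polynomial for every $h\in\mathfrak h'$. Assume that the subalgebra $A_\psi\subseteq A$ generated by all $\psi(h\otimes t^m)t^m$ ($h\in\mathfrak h'$, $m\in\mathbb Z^n$) equals $\mathbb C[t_1^{\pm r_1},\dots,t_n^{\pm r_n}]$ with positive integers $r_i$; put $R=r_1\cdots r_n$ and $\overline\Gamma=\bigoplus_i\mathbb Z/r_i\mathbb Z$. Let $\xi_i$ be a primitive $r_i$-th root of unity, let $\overline\Gamma$ act on $(\mathbb C^*)^n$ by $k\cdot\lambda=(\xi_1^{k_1}\lambda_1,\dots,\xi_n^{k_n}\lambda_n)$, and let $B$ be a set of representatives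 of the orbits. For $k\in\overline\Gamma$ let $\sigma_k$ be the automorphism of $\mathfrak g_A$ with $\sigma_k(X\otimes t^m)=\xi_1^{k_1m_1}\cdots\xi_n^{k_nm_n}X\otimes t^m$ for $X\in\mathfrak g'$ and $\sigma_k=\mathrm{id}$ on $\mathfrak h''$, and for $\Phi\in\mathfrak h_A^*$ put $\xi^k\Phi=\Phi\circ\sigma_k|_{\mathfrak h_A}$. **Proposition.** There is $\Phi\in\mathfrak h_A^*$ such that $m\mapsto\Phi(h\otimes t^m)$ is exp-polynomial with exponents in $B$ for every $h\in\mathfrak h'$, and $$\psi=\sum_{k\in\overline\Gamma}\xi^k\Phi .$$ For every such $\Phi$: 1. $V(\psi)$ and $V(\Phi)$ are sums of their $\mathfrak h$-weight spaces, which are finite-dimensional; each coefficient of the $R$-th power of $\operatorname{ch}V(\Phi)$ is a finite sum; and $$\operatorname{ch}V(\psi)=(\operatorname{ch}V(\Phi))^R .$$ 2. For every $k\in\overline\Gamma$ the automorphism $\sigma_k$ is the identity on $\mathfrak g$, and there is a linear isomorphism $E:V(\xi^k\Phi)\to V(\Phi)$ with $E(xv)=\sigma_k(x)E(v)$ for all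 $x\in\mathfrak g_A$; in particular $V(\xi^k\Phi)\cong V(\Phi)$ as $\mathfrak g$-modules. -/

import Mathlib

open scoped TensorProduct

noncomputable section

namespace LoopKM

/-! ### Kac-Moody algebras -/

/-- Generalized Cartan matrices. -/
structure IsGCM {ι : Type*} (C : Matrix ι ι ℤ) : Prop where
  diag : ∀ i, C i i = 2
  nonpos : ∀ i j, i ≠ j → C i j ≤ 0
  zero_symm : ∀ i j, C i j = 0 → C j i = 0

/-- The data and laws saying that `g` is the Kac-Moody algebra `g(C)`: a realization
`(𝔥, roots, coroots)` of `C` inside `g` together with Chevalley generators, such that `g` is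
generated by `𝔥`, the `e i` and the `f i` and has no nonzero ideal meeting `𝔥` trivially.
This determines `(g, 𝔥, roots, coroots)` up to isomorphism. -/
structure KacMoody {ι : Type*} [Fintype ι] [DecidableEq ι] (C : Matrix ι ι ℤ)
    (g : Type*) [LieRing g] [LieAlgebra ℂ g] where
  /-- the Cartan subalgebra -/
  cartan : Submodule ℂ g
  /-- the simple roots -/
  root : ι → Module.Dual ℂ cartan
  /-- the simple coroots -/
  coroot : ι → cartan
  /-- the positive Chevalley generators -/
  e : ι → g
  /-- the negative Chevalley generators -/
  f : ι → g
  finite_cartan : FiniteDimensional ℂ cartan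
  finrank_cartan :
    Module.finrank ℂ cartan + (C.map (Int.cast : ℤ → ℂ)).rank = 2 * Fintype.card ι
  root_indep : LinearIndependent ℂ root
  coroot_indep : LinearIndependent ℂ coroot
  root_coroot : ∀ i j, root j (coroot i) = (C i j : ℂ)
  lie_cartan : ∀ x y : cartan, ⁅(x : g), (y : g)⁆ = 0
  lie_e_f : ∀ i j, ⁅e i, f j⁆ = if i = j then (coroot i : g) else 0
  lie_cartan_e : ∀ (x : cartan) (i : ι), ⁅(x : g), e i⁆ = root i x • e i
  lie_cartan_f : ∀ (x : cartan) (i : ι), ⁅(x : g), f i⁆ = -(root i x • f i)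
  generate :
    LieSubalgebra.lieSpan ℂ g ((cartan : Set g) ∪ Set.range e ∪ Set.range f) = ⊤
  no_ideal : ∀ I : LieIdeal ℂ g, (∀ x ∈ I, x ∈ cartan → x = 0) → I = ⊥

/-! ### Laurent polynomials and the loop Kac-Moody algebra -/

/-- `A = ℂ[t₁^{±1}, …, tₙ^{±1}]`. -/
abbrev Laurent (n : ℕ) : Type := AddMonoidAlgebra ℂ (Fin n → ℤ)

/-- The monomial `t^m`. -/
def mono {n : ℕ} (m : Fin n → ℤ) : Laurent n := AddMonoidAlgebra.single m 1

/-- The character `m ↦ a₁^{m₁} ⋯ aₙ^{mₙ}` of `ℤⁿ` attached to `a ∈ (ℂ^*)ⁿ`. -/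
def expo {n : ℕ} (a : Fin n → ℂˣ) (m : Fin n → ℤ) : ℂˣ := ∏ i, a i ^ m i

/-- The algebra endomorphism `t^m ↦ a₁^{m₁} ⋯ aₙ^{mₙ} t^m` of `A`. -/
def scale {n : ℕ} (a : Fin n → ℂˣ) : Laurent n →ₐ[ℂ] Laurent n :=
  AddMonoidAlgebra.lift ℂ (Laurent n) (Fin n → ℤ)
    { toFun := fun m => (expo a m.toAdd : ℂ) • mono m.toAdd
      map_one' := by simp [expo, mono, AddMonoidAlgebra.one_def]
      map_mul' := fun x y => by
        simp [expo, mono, zpow_add, Finset.prod_mul_distrib,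
          AddMonoidAlgebra.single_mul_single] }

theorem scale_mono {n : ℕ} (a : Fin n → ℂˣ) (m : Fin n → ℤ) :
    scale a (mono m) = (expo a m : ℂ) • mono m := by
  simp [scale, mono]

theorem scale_comp_inv {n : ℕ} (a b : Fin n → ℂˣ) (h : a * b = 1) :
    (scale a).comp (scale b) = AlgHom.id ℂ (Laurent n) := by
  refine AddMonoidAlgebra.algHom_ext (fun m => ?_) (Subsingleton.elim _ _)
  have h1 : expo b m * expo a m = 1 := by
    unfold expo
    rw [← Finset.prod_mul_distrib]
    refine Finset.prod_eq_one fun i _ => ?_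
    rw [← mul_zpow, mul_comm, show a i * b i = 1 from congrFun h i, one_zpow]
  change scale a (scale b (mono m)) = mono m
  rw [scale_mono, map_smul, scale_mono, smul_smul, ← Units.val_mul, h1]
  simp

section

variable {g : Type*} [LieRing g] [LieAlgebra ℂ g]

/-- The derived algebra `g' = [g, g]`. -/
def derived (g : Type*) [LieRing g] [LieAlgebra ℂ g] : LieIdeal ℂ g := ⁅(⊤ : LieIdeal ℂ g), ⊤⁆

/-- For a subspace `W ⊆ g`, the subspace `W ⊗ A` (written `A ⊗ W`). -/
def loops (n : ℕ) (W : Submodule ℂ g) : Submodule ℂ (Laurent n ⊗[ℂ] g) :=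
  LinearMap.range (LinearMap.lTensor (Laurent n) W.subtype)

/-- For a subspace `W ⊆ g`, the subspace `W ⊗ 1`. -/
def consts (n : ℕ) (W : Submodule ℂ g) : Submodule ℂ (Laurent n ⊗[ℂ] g) :=
  W.map (TensorProduct.mk ℂ (Laurent n) g 1)

theorem tmul_mem_loops {n : ℕ} {W : Submodule ℂ g} (p : Laurent n) {x : g} (hx : x ∈ W) :
    p ⊗ₜ[ℂ] x ∈ loops n W := ⟨p ⊗ₜ ⟨x, hx⟩, by simp⟩

theorem one_tmul_mem_consts {n : ℕ} {W : Submodule ℂ g} {x : g} (hx : x ∈ W) :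
    (1 : Laurent n) ⊗ₜ[ℂ] x ∈ consts n W := ⟨x, hx, rfl⟩

theorem loops_le {n : ℕ} {W : Submodule ℂ g} {P : Submodule ℂ (Laurent n ⊗[ℂ] g)}
    (h : ∀ (p : Laurent n), ∀ x ∈ W, p ⊗ₜ[ℂ] x ∈ P) : loops n W ≤ P := by
  rintro _ ⟨z, rfl⟩
  induction z with
  | zero => simp
  | tmul p x => exact h p x x.2
  | add a b ha hb => rw [map_add]; exact P.add_mem ha hb

theorem loops_mono {n : ℕ} {W W' : Submodule ℂ g} (h : W ≤ W') : loops n W ≤ loops n W' :=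
  loops_le fun p _ hx => tmul_mem_loops p (h hx)

theorem lie_mem_loops {n : ℕ} (x y : Laurent n ⊗[ℂ] g) :
    ⁅x, y⁆ ∈ loops n (derived g).toSubmodule := by
  induction x with
  | zero =>
    rw [show ⁅(0 : Laurent n ⊗[ℂ] g), y⁆ = 0 from zero_lie y]
    exact Submodule.zero_mem _
  | add a b ha hb =>
    rw [show ⁅a + b, y⁆ = ⁅a, y⁆ + ⁅b, y⁆ from LieRing.add_lie a b y]
    exact Submodule.add_mem _ ha hb
  | tmul p u =>
    induction y with
    | zero =>
      rw [show ⁅p ⊗ₜ[ℂ] u, (0 : Laurent n ⊗[ℂ] g)⁆ = 0 from lie_zero (p ⊗ₜ[ℂ] u)]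
      exact Submodule.zero_mem _
    | add a b ha hb =>
      rw [show ⁅p ⊗ₜ[ℂ] u, a + b⁆ = ⁅p ⊗ₜ[ℂ] u, a⁆ + ⁅p ⊗ₜ[ℂ] u, b⁆ from
        LieRing.lie_add (p ⊗ₜ[ℂ] u) a b]
      exact Submodule.add_mem _ ha hb
    | tmul q w =>
      rw [LieAlgebra.ExtendScalars.bracket_tmul]
      exact tmul_mem_loops _ (LieSubmodule.lie_mem_lie (by simp) (by simp))

variable (n : ℕ) (g) in
/-- The loop Kac-Moody algebra `g_A = g' ⊗ A ⊕ 𝔥''`, realized as the subalgebra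
`g' ⊗ A + g ⊗ 1` of `g ⊗ A` with bracket `[X ⊗ p, Y ⊗ q] = [X, Y] ⊗ pq`. (As `g = g' ⊕ 𝔥''` for
any complement `𝔥''` of `𝔥'` in `𝔥`, this is `g' ⊗ A ⊕ 𝔥'' ⊗ 1`.) -/
def loopAlg : LieSubalgebra ℂ (Laurent n ⊗[ℂ] g) where
  toSubmodule := loops n (derived g).toSubmodule ⊔ consts n ⊤
  lie_mem' := fun {x y} _ _ => Submodule.mem_sup_left (lie_mem_loops x y)

variable (g) in
/-- The automorphism `X ⊗ t^m ↦ a₁^{m₁} ⋯ aₙ^{mₙ} X ⊗ t^m` of `g ⊗ A`. -/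
def scaleLie {n : ℕ} (a : Fin n → ℂˣ) : Laurent n ⊗[ℂ] g →ₗ⁅ℂ⁆ Laurent n ⊗[ℂ] g :=
  LieAlgebra.ExtendScalars.map (scale a) (LieHom.id : g →ₗ⁅ℂ⁆ g)

theorem scale_mem_loops {n : ℕ} (a : Fin n → ℂˣ) (W : Submodule ℂ g) {x : Laurent n ⊗[ℂ] g}
    (hx : x ∈ loops n W) :
    scaleLie g a x ∈ loops n W := by
  have : loops n W ≤ (loops n W).comap
      (scaleLie g a :
        Laurent n ⊗[ℂ] g →ₗ[ℂ] Laurent n ⊗[ℂ] g) :=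
    loops_le fun p y hy => by
      change (scale a p) ⊗ₜ[ℂ] y ∈ loops n W
      exact tmul_mem_loops _ hy
  exact this hx

theorem scale_mem_sup {n : ℕ} (a : Fin n → ℂˣ) (W W' : Submodule ℂ g) {x : Laurent n ⊗[ℂ] g}
    (hx : x ∈ loops n W ⊔ consts n W') :
    scaleLie g a x ∈
      loops n W ⊔ consts n W' := by
  obtain ⟨y, hy, _, ⟨z, hz, rfl⟩, rfl⟩ := Submodule.mem_sup.mp hx
  rw [map_add]
  refine Submodule.add_mem_sup (scale_mem_loops a W hy) ?_
  change (scale a 1) ⊗ₜ[ℂ] z ∈ consts n W'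
  rw [map_one]
  exact one_tmul_mem_consts hz

theorem scale_scale {n : ℕ} (a b : Fin n → ℂˣ) (h : a * b = 1) (x : Laurent n ⊗[ℂ] g) :
    scaleLie g a
      (scaleLie g b x) = x := by
  induction x with
  | zero => simp
  | add u v hu hv => rw [map_add, map_add, hu, hv]
  | tmul p y =>
    change (scale a (scale b p)) ⊗ₜ[ℂ] y = _
    exact congrArg (· ⊗ₜ[ℂ] y) (DFunLike.congr_fun (scale_comp_inv a b h) p)

/-- The automorphism `X ⊗ t^m ↦ a₁^{m₁} ⋯ aₙ^{mₙ} X ⊗ t^m` of `g_A`; it is the identity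
on `g = g ⊗ 1`. -/
def twist {n : ℕ} (a : Fin n → ℂˣ) : loopAlg g n ≃ₗ⁅ℂ⁆ loopAlg g n where
  toFun x := ⟨scaleLie g a x,
    scale_mem_sup a _ _ x.2⟩
  map_add' x y := Subtype.ext (by simp)
  map_smul' c x := Subtype.ext (by simp)
  map_lie' {x y} := Subtype.ext (by simp)
  invFun x := ⟨scaleLie g a⁻¹ x,
    scale_mem_sup a⁻¹ _ _ x.2⟩
  left_inv x := Subtype.ext (scale_scale _ _ (by simp) _)
  right_inv x := Subtype.ext (scale_scale _ _ (by simp) _)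

/-- The element `1 ⊗ x` of `g_A`, for `x ∈ g`: the embedding `g ⊆ g_A`. -/
def const (n : ℕ) (x : g) : loopAlg g n :=
  ⟨1 ⊗ₜ x, Submodule.mem_sup_right (one_tmul_mem_consts Submodule.mem_top)⟩

variable {ι : Type*} [Fintype ι] [DecidableEq ι] {C : Matrix ι ι ℤ}

namespace KacMoody

variable (K : KacMoody C g) (n : ℕ)

/-- `𝔥' = 𝔥 ∩ g'`. -/
def cartan' : Submodule ℂ g := K.cartan ⊓ (derived g).toSubmodule

/-- `N⁺`, the subalgebra generated by the `e i`. -/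
def npos : LieSubalgebra ℂ g := LieSubalgebra.lieSpan ℂ g (Set.range K.e)

/-- `𝔥_A = 𝔥' ⊗ A ⊕ 𝔥''`, that is `𝔥' ⊗ A + 𝔥 ⊗ 1`. -/
def loopCartan : Submodule ℂ (Laurent n ⊗[ℂ] g) := loops n K.cartan' ⊔ consts n K.cartan

theorem loopCartan_le : K.loopCartan n ≤ (loopAlg g n).toSubmodule :=
  sup_le_sup (loops_mono inf_le_right) (Submodule.map_mono le_top)

variable {n}

/-- The inclusion `𝔥_A ⊆ g_A`. -/
def inclCartan (x : K.loopCartan n) : loopAlg g n := ⟨x, K.loopCartan_le n x.2⟩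

/-- The element `x ⊗ t^m` of `𝔥_A`, for `x ∈ 𝔥'`. -/
def cartanMono (x : K.cartan') (m : Fin n → ℤ) : K.loopCartan n :=
  ⟨mono m ⊗ₜ (x : g), Submodule.mem_sup_left (tmul_mem_loops _ x.2)⟩

/-- The functional `aΨ` on `𝔥_A`: `(aΨ)(x ⊗ t^m) = a₁^{m₁} ⋯ aₙ^{mₙ} Ψ(x ⊗ t^m)` for `x ∈ 𝔥'`,
and `aΨ = Ψ` on `𝔥 = 𝔥 ⊗ 1`; it is `Ψ` composed with the restriction of `twist a` to `𝔥_A`. -/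
def twistFun (a : Fin n → ℂˣ) (Ψ : Module.Dual ℂ (K.loopCartan n)) :
    Module.Dual ℂ (K.loopCartan n) :=
  Ψ ∘ₗ LinearMap.restrict
    (scaleLie g a :
      Laurent n ⊗[ℂ] g →ₗ[ℂ] Laurent n ⊗[ℂ] g)
    (p := K.loopCartan n) (q := K.loopCartan n) (fun _ hx => scale_mem_sup a _ _ hx)

/-! ### The modules `M(Ψ)` and `V(Ψ)` -/

/-- The left ideal of `U(g_A)` generated by `N⁺ ⊗ A` and the `x - Ψ(x)`, `x ∈ 𝔥_A`. -/
def vermaIdeal (Ψ : Module.Dual ℂ (K.loopCartan n)) :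
    Submodule (UniversalEnvelopingAlgebra ℂ (loopAlg g n))
      (UniversalEnvelopingAlgebra ℂ (loopAlg g n)) :=
  Submodule.span _
    ({u | ∃ x : loopAlg g n, (x : Laurent n ⊗[ℂ] g) ∈ loops n K.npos.toSubmodule ∧
        u = UniversalEnvelopingAlgebra.ι ℂ x} ∪
      {u | ∃ x : K.loopCartan n, u = UniversalEnvelopingAlgebra.ι ℂ (K.inclCartan x) -
        algebraMap ℂ _ (Ψ x)})

/-- The induced module `M(Ψ) = U(g_A) ⊗_{U(N⁺ ⊗ A ⊕ 𝔥_A)} ℂ_Ψ`, as a quotient of `U(g_A)`. -/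
abbrev verma (Ψ : Module.Dual ℂ (K.loopCartan n)) :=
  UniversalEnvelopingAlgebra ℂ (loopAlg g n) ⧸ K.vermaIdeal Ψ

/-- The sum of all proper submodules of `M(Ψ)`, i.e. its unique maximal submodule. -/
def maxSub (Ψ : Module.Dual ℂ (K.loopCartan n)) :
    Submodule (UniversalEnvelopingAlgebra ℂ (loopAlg g n)) (K.verma Ψ) :=
  sSup {N | N ≠ ⊤}

/-- `V(Ψ)`, the irreducible quotient of `M(Ψ)`. -/
abbrev simpleMod (Ψ : Module.Dual ℂ (K.loopCartan n)) := K.verma Ψ ⧸ K.maxSub Ψ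

/-- The action of `g_A` on `V(Ψ)`. -/
def act {Ψ : Module.Dual ℂ (K.loopCartan n)} (x : loopAlg g n) (v : K.simpleMod Ψ) :
    K.simpleMod Ψ :=
  UniversalEnvelopingAlgebra.ι ℂ x • v

/-! ### Characters -/

/-- The weight space `V(Ψ)_μ = {v | x v = μ(x) v for all x ∈ 𝔥}`, `μ ∈ 𝔥^*`. -/
def weightSpace (Ψ : Module.Dual ℂ (K.loopCartan n)) (μ : Module.Dual ℂ K.cartan) :
    Submodule ℂ (K.simpleMod Ψ) where
  carrier := {v | ∀ x : K.cartan, K.act (const n (x : g)) v = μ x • v}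
  zero_mem' := fun x => by simp [act]
  add_mem' := fun {v w} hv hw x => by
    rw [smul_add, ← hv x, ← hw x]; exact smul_add _ _ _
  smul_mem' := fun c v hv x => by
    rw [smul_comm, ← hv x]
    exact smul_comm _ _ _

/-- `V(Ψ)` has a character: it is the sum of its weight spaces, and these are
finite-dimensional. -/
def HasCharacter (Ψ : Module.Dual ℂ (K.loopCartan n)) : Prop :=
  (⨆ μ, K.weightSpace Ψ μ) = ⊤ ∧ ∀ μ, FiniteDimensional ℂ (K.weightSpace Ψ μ)

/-- The character `ch V(Ψ) = ∑_μ dim V(Ψ)_μ e^μ`, as the function `μ ↦ dim V(Ψ)_μ` on `𝔥^*`. -/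
def char (Ψ : Module.Dual ℂ (K.loopCartan n)) (μ : Module.Dual ℂ K.cartan) : ℕ :=
  Module.finrank ℂ (K.weightSpace Ψ μ)

/-! ### Exp-polynomial functionals -/

/-- The algebra `A_ψ`: the image of the homomorphism `U(𝔥' ⊗ A) → A` which extends
`x ⊗ t^m ↦ ψ(x ⊗ t^m) t^m`. -/
def imageAlg (ψ : Module.Dual ℂ (K.loopCartan n)) : Subalgebra ℂ (Laurent n) :=
  Algebra.adjoin ℂ {p | ∃ (x : K.cartan') (m : Fin n → ℤ), p = ψ (K.cartanMono x m) • mono m}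

end KacMoody

end

/-- The subalgebra `ℂ[t₁^{±r₁}, …, tₙ^{±rₙ}]` of `A`. -/
def subLaurent {n : ℕ} (r : Fin n → ℕ) : Subalgebra ℂ (Laurent n) :=
  Algebra.adjoin ℂ {p | ∃ m : Fin n → ℤ, (∀ i, (r i : ℤ) ∣ m i) ∧ p = mono m}

/-- `f` is an exp-polynomial map with exponents in `B ⊆ (ℂ^*)ⁿ`: a finite sum
`f(m) = ∑_{λ ∈ B} p_λ(m) λ₁^{m₁} ⋯ λₙ^{mₙ}` with polynomials `p_λ`. -/
def IsExpPolyOn {n : ℕ} (B : Set (Fin n → ℂˣ)) (f : (Fin n → ℤ) → ℂ) : Prop :=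
  ∃ p : (Fin n → ℂˣ) →₀ MvPolynomial (Fin n) ℂ, (p.support : Set (Fin n → ℂˣ)) ⊆ B ∧
    ∀ m, f m = p.sum fun a q => MvPolynomial.eval (fun i => (m i : ℂ)) q * (expo a m : ℂ)

/-- The tuple `ξ^k = (ξ₁^{k₁}, …, ξₙ^{kₙ})`, where `k ∈ ℤ/r₁ ⊕ ⋯ ⊕ ℤ/rₙ`. -/
def rootTuple {n : ℕ} {r : Fin n → ℕ} (ξ : Fin n → ℂˣ) (k : (i : Fin n) → Fin (r i)) :
    Fin n → ℂˣ :=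
  fun i => ξ i ^ (k i : ℕ)

/-- `B` contains exactly one element of each orbit `{ξ^k · a | k}` of
`ℤ/r₁ ⊕ ⋯ ⊕ ℤ/rₙ` on `(ℂ^*)ⁿ`. -/
def IsTransversal {n : ℕ} (r : Fin n → ℕ) (ξ : Fin n → ℂˣ) (B : Set (Fin n → ℂˣ)) : Prop :=
  ∀ a : Fin n → ℂˣ, ∃! b, b ∈ B ∧ ∃ k : (i : Fin n) → Fin (r i), a = rootTuple ξ k * b

/-- `ψ = ∑_k ξ^k Φ`, where every `Φ_x`, `x ∈ 𝔥'`, is an exp-polynomial map with exponents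
in `B`. -/
def IsDecomposition {ι g : Type*} [Fintype ι] [DecidableEq ι] {C : Matrix ι ι ℤ}
    [LieRing g] [LieAlgebra ℂ g] (K : KacMoody C g) {n : ℕ} (r : Fin n → ℕ) (ξ : Fin n → ℂˣ)
    (B : Set (Fin n → ℂˣ)) (ψ Φ : Module.Dual ℂ (K.loopCartan n)) : Prop :=
  (∀ x : K.cartan', IsExpPolyOn B fun m => Φ (K.cartanMono x m)) ∧
    ψ = ∑ k : (i : Fin n) → Fin (r i), K.twistFun (rootTuple ξ k) Φ

/-- The terms of the `R`-th power of the formal sum `∑_μ χ(μ) e^μ` that contribute to `e^μ`: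
the tuples `(ν₁, …, ν_R)` with sum `μ` and nonzero coefficient `χ(ν₁) ⋯ χ(ν_R)`. -/
def powTerms {W : Type*} [AddCommMonoid W] (χ : W → ℕ) (R : ℕ) (μ : W) : Set (Fin R → W) :=
  {ν | ∑ i, ν i = μ ∧ ∏ i, χ (ν i) ≠ 0}

/-- The coefficient of `e^μ` in the `R`-th power of the formal sum `∑_μ χ(μ) e^μ`; it is
meaningful when `powTerms χ R μ` is finite. -/
def formalPow {W : Type*} [AddCommMonoid W] (χ : W → ℕ) (R : ℕ) (μ : W) : ℕ :=
  ∑ᶠ ν ∈ powTerms χ R μ, ∏ i, χ (ν i)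

end LoopKM

end

open scoped TensorProduct

noncomputable section

attribute [local instance 100] LieRing.ofAssociativeRing

namespace LoopKM

set_option linter.unusedSectionVars false

/-! ### Induced modules -/

/-! Call `killer Ψ` the largest ideal `I` of `A` with `Ψ(𝔥' ⊗ I) = 0`. In an irreducible highest
weight module of weight `Ψ`, `g' ⊗ I` acts by zero: `(g' ⊗ I)V` is a submodule which misses the
highest weight vector (`IsHighestWeight.lie_loopElt_eq_zero`). If `Ψ` is exp-polynomial with
exponents in `B`, then `I` contains a product of maximal ideals of points of `B`, because `t^m ↦
p(m) a^m` is evaluation at `a` after a polynomial in the Euler operators `t_i ∂/∂t_i`. Hence `A/I`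
is finite-dimensional, which makes the weight spaces of `V(Ψ)` finite-dimensional.

If `Ψ₁` and `Ψ₂` have disjoint sets of exponents, their ideals are comaximal. By the Chinese
remainder theorem `g' ⊗ A` then acts independently on the two factors of `V(Ψ₁) ⊗ V(Ψ₂)`, so this
tensor product is irreducible and equals `V(Ψ₁ + Ψ₂)` (`IsHighestWeight.tmul`,
`IsHighestWeight.exists_equiv`); characters multiply (`charSeries_add`).

The exponents of `ξ^k Φ` lie in `ξ^k B`, and these sets are pairwise disjoint since `B` is a
transversal of a free action. Moreover `V(ξ^k Φ)` is `V(Φ)` twisted by `σ_k`, which fixes `g`, so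
all `R` factors have the same character. This gives the `R`-th power (`char_eq_formalPow`).
Characters are handled as power series in the coefficients of the simple roots subtracted from the
highest weight.

For the existence of `Φ`: the condition on `A_ψ` makes `ψ` invariant under all `ξ^k`. Moving each
exponent of `ψ` to its representative in `B` does not change the orbit sum, so after division by `R`
the orbit sum is `ψ` (`exists_decomposition`).

That `M(Ψ)`, and so `V(Ψ)`, is nonzero needs no Poincaré–Birkhoff–Witt theorem: `exists_induced`
constructs the action of `g_A` on `U(N⁻ ⊗ A)` directly. -/

theorem enveloping_submodule_eq_top {k L : Type*} [CommRing k] [LieRing L] [LieAlgebra k L]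
    (S : Submodule k (UniversalEnvelopingAlgebra k L)) (h1 : 1 ∈ S)
    (hS : ∀ (x : L), ∀ u ∈ S, UniversalEnvelopingAlgebra.ι k x * u ∈ S) : S = ⊤ := by
  -- The left stabilizer of `S`. The map `ι` factors through it, so by the universal property it is
  -- the whole algebra; it is then applied to `1 ∈ S`.
  let T : Subalgebra k (UniversalEnvelopingAlgebra k L) :=
    { carrier := {u | ∀ s ∈ S, u * s ∈ S}
      mul_mem' := fun {a b} ha hb s hs => by rw [mul_assoc]; exact ha _ (hb _ hs)
      add_mem' := fun {a b} ha hb s hs => by rw [add_mul]; exact S.add_mem (ha _ hs) (hb _ hs)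
      algebraMap_mem' := fun c s hs => by
        rw [← Algebra.smul_def]; exact S.smul_mem c hs }
  let f : L →ₗ⁅k⁆ T :=
    { toFun := fun x => ⟨UniversalEnvelopingAlgebra.ι k x, hS x⟩
      map_add' := fun x y => Subtype.ext (by simp)
      map_smul' := fun c x => Subtype.ext (by simp)
      map_lie' := fun {x y} => Subtype.ext (by
        simp [LieRing.of_associative_ring_bracket, LieHom.map_lie]) }
  have hf : T.val.comp (UniversalEnvelopingAlgebra.lift k f) = AlgHom.id k _ := by
    refine UniversalEnvelopingAlgebra.hom_ext k ?_
    ext x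
    change T.val (UniversalEnvelopingAlgebra.lift k f (UniversalEnvelopingAlgebra.ι k x)) =
      UniversalEnvelopingAlgebra.ι k x
    rw [UniversalEnvelopingAlgebra.lift_ι_apply]
    rfl
  rw [eq_top_iff]
  intro u _
  have h2 := DFunLike.congr_fun hf u
  have h3 := (UniversalEnvelopingAlgebra.lift k f u).2 1 h1
  rw [mul_one] at h3
  change T.val (UniversalEnvelopingAlgebra.lift k f u) = u at h2
  rw [← h2]
  exact h3

/-- If `L = a ⊕ b` as vector spaces and `χ` is a character of the Lie algebra `b`, then `L` acts
on `U(a)` in such a way that `b` acts on `1` by `χ`. -/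
theorem exists_induced {k L : Type*} [CommRing k] [LieRing L] [LieAlgebra k L]
    (a b : LieSubalgebra k L) (hab : IsCompl a.toSubmodule b.toSubmodule)
    (χ : L →ₗ[k] k) (hχ : ∀ x ∈ b, ∀ y ∈ b, χ ⁅x, y⁆ = 0) :
    ∃ ρ : L →ₗ⁅k⁆ Module.End k (UniversalEnvelopingAlgebra k a),
      ∀ x ∈ b, ρ x 1 = algebraMap k _ (χ x) := by
  set U := UniversalEnvelopingAlgebra k a
  let ιa : a →ₗ⁅k⁆ U := UniversalEnvelopingAlgebra.ι k
  -- `U` as a module over `a`, and the resulting action on `Hom(L, U)`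
  let lm : a →ₗ[k] Module.End k U := (LinearMap.mul k U) ∘ₗ (ιa : a →ₗ[k] U)
  have hlm : ∀ y u, lm y u = ιa y * u := fun y u => rfl
  have hιa : ∀ y y', ιa ⁅y, y'⁆ = ιa y * ιa y' - ιa y' * ιa y := fun y y' => by
    rw [LieHom.map_lie, LieRing.of_associative_ring_bracket]
  let adL : a →ₗ[k] Module.End k L :=
    (LieModule.toEnd k L L : L →ₗ[k] Module.End k L) ∘ₗ a.toSubmodule.subtype
  have hadL : ∀ y x, adL y x = ⁅(y : L), x⁆ := fun y x => rfl
  let θ : a →ₗ⁅k⁆ Module.End k (L →ₗ[k] U) :=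
    { toFun := fun y =>
        { toFun := fun φ => lm y ∘ₗ φ - φ ∘ₗ adL y
          map_add' := fun φ φ' => by ext; simp; abel
          map_smul' := fun c φ => by ext; simp [smul_sub] }
      map_add' := fun y y' => by ext; simp; abel
      map_smul' := fun c y => by ext; simp [smul_sub]
      map_lie' := fun {y y'} => by
        ext φ x
        simp only [LinearMap.coe_mk, AddHom.coe_mk, LinearMap.sub_apply, LinearMap.comp_apply,
          LieRing.of_associative_ring_bracket, Module.End.mul_apply, hlm, hadL, hιa,
          sub_mul, mul_assoc, LieSubalgebra.coe_bracket, lie_lie, map_sub]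
        abel }
  have hθ : ∀ y φ x, θ y φ x = ιa y * φ x - φ ⁅(y : L), x⁆ := fun y φ x => rfl
  let pa : L →ₗ[k] a := Submodule.projectionOnto _ _ hab
  let pb : L →ₗ[k] b := Submodule.projectionOnto _ _ hab.symm
  have hp : ∀ x, (pa x : L) + pb x = x := fun x =>
    by
    have h := Submodule.projection_add_projection_eq_self hab x
    exact h
  have hpa : ∀ x : a, pa x = x := fun x => Submodule.projectionOnto_apply_left hab x
  have hpb : ∀ x : b, pb x = x := fun x => Submodule.projectionOnto_apply_left hab.symm x
  have hpa' : ∀ x ∈ b, pa x = 0 := fun x hx =>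
    Submodule.projectionOnto_apply_right hab ⟨x, hx⟩
  have hpb' : ∀ x ∈ a, pb x = 0 := fun x hx =>
    Submodule.projectionOnto_apply_right hab.symm ⟨x, hx⟩
  -- `φ₁ x` is the value that `x · 1` must have. The rule `x · (y w) = y (x · w) + [x, y] · w` for
  -- `y ∈ a` says that `w ↦ (x ↦ x · w)` is an `a`-equivariant map from `U` to `Hom(L, U)`. Since
  -- `U` is free on `1`, there is exactly one such map with `1 ↦ φ₁`.
  let φ₁ : L →ₗ[k] U := (ιa : a →ₗ[k] U) ∘ₗ pa +
    (Algebra.linearMap k U) ∘ₗ χ ∘ₗ b.toSubmodule.subtype ∘ₗ pb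
  have hφ₁ : ∀ x, φ₁ x = ιa (pa x) + algebraMap k U (χ (pb x)) := fun x => rfl
  let Θ : U →ₐ[k] Module.End k (L →ₗ[k] U) := UniversalEnvelopingAlgebra.lift k θ
  have hΘ : ∀ y, Θ (ιa y) = θ y := UniversalEnvelopingAlgebra.lift_ι_apply k θ
  -- the action `A x` of `x` on `U`
  let A : L →ₗ[k] Module.End k U :=
    { toFun := fun x =>
        { toFun := fun w => Θ w φ₁ x
          map_add' := fun w w' => by simp
          map_smul' := fun c w => by simp }
      map_add' := fun x y => by ext; simp
      map_smul' := fun c x => by ext; simp }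
  have hA : ∀ x w, A x w = Θ w φ₁ x := fun x w => rfl
  have hA1 : ∀ x, A x 1 = φ₁ x := fun x => by rw [hA, map_one]; rfl
  clear_value A φ₁ pa pb
  have A_step : ∀ x (y : a) w, A x (ιa y * w) = ιa y * A x w + A ⁅x, (y : L)⁆ w := by
    intro x y w
    rw [hA, map_mul, hΘ, Module.End.mul_apply, hθ, ← lie_skew, map_neg, sub_neg_eq_add, hA, hA]
  have ind : ∀ {P : U → Prop}, (∀ w w', P w → P w' → P (w + w')) → (∀ (c : k) w, P w → P (c • w)) →
      P 1 → (∀ (y : a) w, P w → P (ιa y * w)) → ∀ w, P w := by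
    intro P hadd hsmul hone hmul w
    let S : Submodule k U :=
      { carrier := {w | P w}
        add_mem' := fun {w w'} => hadd w w'
        zero_mem' := by have := hsmul 0 1 hone; rwa [zero_smul] at this
        smul_mem' := hsmul }
    have : S = ⊤ := enveloping_submodule_eq_top S hone hmul
    have hw : w ∈ S := this ▸ Submodule.mem_top
    exact hw
  have A_one : ∀ x ∈ b, A x 1 = algebraMap k _ (χ x) := by
    intro x hx
    rw [hA1, hφ₁, hpa' x hx, hpb ⟨x, hx⟩, map_zero, zero_add]
  have A_left : ∀ (y : a) w, A y w = ιa y * w := by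
    intro y w
    revert y
    refine ind (P := fun w => ∀ y : a, A y w = ιa y * w) ?_ ?_ ?_ ?_ w
    · intro w w' h h' y
      rw [map_add, h, h', mul_add]
    · intro c w h y
      rw [map_smul, h, mul_smul_comm]
    · intro y
      rw [hA1, hφ₁, hpa, hpb' _ y.2]
      simp
    · intro z w h y
      have := h ⁅y, z⁆
      rw [LieSubalgebra.coe_bracket] at this
      rw [A_step, h, this, hιa, sub_mul, mul_assoc, mul_assoc]
      abel
  -- Brackets with one entry in `a` are respected because of `A_left` and `A_step`, so only pairs in
  -- `b` remain.
  have A_split : ∀ w, (∀ x ∈ b, ∀ z ∈ b, A ⁅x, z⁆ w = A x (A z w) - A z (A x w)) →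
      ∀ x z, A ⁅x, z⁆ w = A x (A z w) - A z (A x w) := by
    intro w h x z
    have h1 : ∀ x (z : a), A ⁅x, (z : L)⁆ w = A x (A z w) - A z (A x w) := fun x z => by
      rw [A_left, A_left, A_step]; abel
    have h2 : ∀ (x : a) z, A ⁅(x : L), z⁆ w = A x (A z w) - A z (A x w) := fun x z => by
      rw [← lie_skew, map_neg, LinearMap.neg_apply, h1]; abel
    rw [← hp x, ← hp z]
    simp only [lie_add, add_lie, map_add, LinearMap.add_apply]
    have h3 := h1 (pb x) (pa z)
    have h4 := h2 (pa x) (pb z)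
    have h5 := h2 (pa x) (pa z)
    have h6 := h _ (pb x).2 _ (pb z).2
    rw [h3, h4, h5, h6]
    abel
  have A_lie : ∀ w x z, A ⁅x, z⁆ w = A x (A z w) - A z (A x w) := by
    refine ind ?_ ?_ ?_ ?_
    · intro w w' h h' x z
      simp only [map_add, h, h']
      abel
    · intro c w h x z
      simp only [map_smul, h, smul_sub]
    -- On the vector `1` the elements of `b` act by scalars, hence commute, and `χ` kills their
    -- bracket.
    · refine A_split 1 fun x hx z hz => ?_
      have hc : ∀ x (c : k), A x (algebraMap k U c) = c • A x 1 := fun x c => by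
        rw [Algebra.algebraMap_eq_smul_one, map_smul]
      rw [A_one _ (b.lie_mem hx hz), hχ x hx z hz, A_one x hx, A_one z hz, hc, hc, A_one x hx,
        A_one z hz, Algebra.smul_def, Algebra.smul_def, Algebra.commutes, map_zero, sub_self]
    · intro y w h x z
      rw [A_step, A_step, A_step, map_add, map_add, A_step, A_step, lie_lie, map_sub,
        LinearMap.sub_apply, h x ⁅z, (y : L)⁆, h z ⁅x, (y : L)⁆, h x z, mul_sub]
      abel
  refine ⟨{ A with map_lie' := fun {x z} => ?_ }, A_one⟩
  ext w
  exact A_lie w x z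

/-! ### The triangular decomposition of a Kac-Moody algebra -/

section

variable {g : Type*} [LieRing g] [LieAlgebra ℂ g]

theorem lie_mem_lieSpan {s : Set g} {x : g}
    (h : ∀ y ∈ s, ⁅x, y⁆ ∈ LieSubalgebra.lieSpan ℂ g s) {y : g}
    (hy : y ∈ LieSubalgebra.lieSpan ℂ g s) : ⁅x, y⁆ ∈ LieSubalgebra.lieSpan ℂ g s := by
  induction hy using LieSubalgebra.lieSpan_induction with
  | mem y hy => exact h y hy
  | zero => rw [lie_zero]; exact zero_mem _
  | add y z _ _ h1 h2 => rw [lie_add]; exact add_mem h1 h2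
  | smul a y _ h1 => rw [lie_smul]; exact LieSubalgebra.smul_mem _ a h1
  | lie y z hy hz h1 h2 =>
    rw [leibniz_lie]
    exact add_mem (LieSubalgebra.lie_mem _ h1 hz) (LieSubalgebra.lie_mem _ hy h2)

/-- Meant for `ad (e i)` on `N⁻` and `ad (f i)` on `N⁺`, with `W = 𝔥`. A generator may be sent into
`W`, but `W` normalizes the span, so by the Leibniz rule proper brackets are sent back into the
span. -/
theorem lie_mem_lieSpan_sup {s : Set g} {x : g} {W : Submodule ℂ g}
    (hW : ∀ w ∈ W, ∀ y ∈ LieSubalgebra.lieSpan ℂ g s, ⁅w, y⁆ ∈ LieSubalgebra.lieSpan ℂ g s)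
    (h : ∀ y ∈ s, ⁅x, y⁆ ∈ (LieSubalgebra.lieSpan ℂ g s).toSubmodule ⊔ W) {y : g}
    (hy : y ∈ LieSubalgebra.lieSpan ℂ g s) :
    ⁅x, y⁆ ∈ (LieSubalgebra.lieSpan ℂ g s).toSubmodule ⊔ W := by
  have key : ∀ z ∈ (LieSubalgebra.lieSpan ℂ g s).toSubmodule ⊔ W,
      ∀ y ∈ LieSubalgebra.lieSpan ℂ g s, ⁅z, y⁆ ∈ LieSubalgebra.lieSpan ℂ g s := by
    intro z hz y hy
    obtain ⟨a, ha, b, hb, rfl⟩ := Submodule.mem_sup.mp hz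
    rw [add_lie]
    exact add_mem (LieSubalgebra.lie_mem _ ha hy) (hW b hb y hy)
  induction hy using LieSubalgebra.lieSpan_induction with
  | mem y hy => exact h y hy
  | zero => rw [lie_zero]; exact zero_mem _
  | add y z _ _ h1 h2 => rw [lie_add]; exact add_mem h1 h2
  | smul a y _ h1 => rw [lie_smul]; exact Submodule.smul_mem _ a h1
  | lie y z hy hz h1 h2 =>
    rw [leibniz_lie]
    refine Submodule.mem_sup_left (add_mem (key _ h1 _ hz) ?_)
    rw [← lie_skew]
    exact neg_mem (key _ h2 _ hy)

/-- A subspace which contains a generating set of a Lie algebra and is stable under the adjoint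
action of this generating set is everything. -/
theorem eq_top_of_lie_mem {s : Set g} (hs : LieSubalgebra.lieSpan ℂ g s = ⊤) (W : Submodule ℂ g)
    (h1 : s ⊆ W) (h2 : ∀ x ∈ s, ∀ w ∈ W, ⁅x, w⁆ ∈ W) : W = ⊤ := by
  have h3 : ∀ x : g, ∀ w ∈ W, ⁅x, w⁆ ∈ W := by
    intro x
    have hx : x ∈ LieSubalgebra.lieSpan ℂ g s := hs ▸ LieSubalgebra.mem_top x
    induction hx using LieSubalgebra.lieSpan_induction with
    | mem y hy => exact h2 y hy
    | zero => intro w _; rw [zero_lie]; exact zero_mem _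
    | add y z _ _ h1 h2 => intro w hw; rw [add_lie]; exact add_mem (h1 w hw) (h2 w hw)
    | smul a y _ h1 => intro w hw; rw [smul_lie]; exact Submodule.smul_mem _ a (h1 w hw)
    | lie y z hy hz h1 h2 =>
      intro w hw
      rw [lie_lie]
      exact sub_mem (h1 _ (h2 w hw)) (h2 _ (h1 w hw))
  rw [eq_top_iff]
  intro x _
  have hx : x ∈ LieSubalgebra.lieSpan ℂ g s := hs ▸ LieSubalgebra.mem_top x
  induction hx using LieSubalgebra.lieSpan_induction with
  | mem y hy => exact h1 hy
  | zero => exact zero_mem _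
  | add y z _ _ h1 h2 => exact add_mem (h1 trivial) (h2 trivial)
  | smul a y _ h1 => exact Submodule.smul_mem _ a (h1 trivial)
  | lie y z hy hz h1 h2 => exact h3 y z (h2 trivial)

/-- The sum of the eigenspaces of `ad d` with eigenvalues in `S`. -/
def adPart (d : g) (S : Set ℂ) : Submodule ℂ g :=
  ⨆ c ∈ S, (LieModule.toEnd ℂ g g d).eigenspace c

theorem mem_adPart {d x : g} {S : Set ℂ} {c : ℂ} (hc : c ∈ S) (h : ⁅d, x⁆ = c • x) :
    x ∈ adPart d S :=
  Submodule.mem_iSup_of_mem c (Submodule.mem_iSup_of_mem hc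
    (Module.End.mem_eigenspace_iff.mpr h))

theorem adPart_mono (d : g) {S T : Set ℂ} (h : S ⊆ T) : adPart d S ≤ adPart d T :=
  biSup_mono fun _ hc => h hc

theorem adPart_disjoint (d : g) {S T : Set ℂ} (h : Disjoint S T) :
    Disjoint (adPart d S) (adPart d T) :=
  (Module.End.eigenspaces_iSupIndep (LieModule.toEnd ℂ g g d)).disjoint_biSup_biSup h

theorem adPart_induction {d : g} {S : Set ℂ} {P : g → Prop}
    (mem : ∀ c ∈ S, ∀ x, ⁅d, x⁆ = c • x → P x) (zero : P 0) (add : ∀ x y, P x → P y → P (x + y))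
    {x : g} (hx : x ∈ adPart d S) : P x := by
  unfold adPart at hx
  rw [iSup_subtype'] at hx
  refine Submodule.iSup_induction (fun c : S => (LieModule.toEnd ℂ g g d).eigenspace c.1)
    (motive := P) hx ?_ zero add
  intro c x hx
  exact mem c c.2 x (Module.End.mem_eigenspace_iff.mp hx)

theorem lie_mem_adPart {d x y : g} {S : Set ℂ} (hS : ∀ a ∈ S, ∀ b ∈ S, a + b ∈ S)
    (hx : x ∈ adPart d S) (hy : y ∈ adPart d S) : ⁅x, y⁆ ∈ adPart d S := by
  refine adPart_induction (P := fun x => ⁅x, y⁆ ∈ adPart d S) ?_ ?_ ?_ hx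
  · intro a ha x hx
    refine adPart_induction (P := fun y => ⁅x, y⁆ ∈ adPart d S) ?_ ?_ ?_ hy
    · intro b hb y hy
      refine mem_adPart (hS a ha b hb) ?_
      rw [leibniz_lie, hx, hy, smul_lie, lie_smul, add_smul]
    · rw [lie_zero]; exact zero_mem _
    · intro y z h h'; rw [lie_add]; exact add_mem h h'
  · rw [zero_lie]; exact zero_mem _
  · intro x z h h'; rw [add_lie]; exact add_mem h h'

theorem lieSpan_le_adPart {d : g} {S : Set ℂ} (hS : ∀ a ∈ S, ∀ b ∈ S, a + b ∈ S) {s : Set g}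
    (h : s ⊆ adPart d S) : (LieSubalgebra.lieSpan ℂ g s).toSubmodule ≤ adPart d S := by
  intro x hx
  induction hx using LieSubalgebra.lieSpan_induction with
  | mem y hy => exact h hy
  | zero => exact zero_mem _
  | add y z _ _ h1 h2 => exact add_mem h1 h2
  | smul a y _ h1 => exact Submodule.smul_mem _ a h1
  | lie y z hy hz h1 h2 => exact lie_mem_adPart hS h1 h2

end

namespace KacMoody

variable {ι g : Type*} [Fintype ι] [DecidableEq ι] {C : Matrix ι ι ℤ} [LieRing g] [LieAlgebra ℂ g]
  (K : KacMoody C g)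

/-- The simple roots are linearly independent, so some functional on `𝔥^*` is `1` on each of them;
by biduality it is an element of `𝔥`. The adjoint action of `d` replaces the height grading
throughout. -/
theorem exists_grading : ∃ d : K.cartan, ∀ i, K.root i d = 1 := by
  have := K.finite_cartan
  let b := Module.Basis.span K.root_indep
  obtain ⟨l, hl⟩ := LinearMap.exists_extend (b.constr ℂ (fun _ : ι => (1 : ℂ)))
  refine ⟨(Module.evalEquiv ℂ K.cartan).symm l, fun i => ?_⟩
  rw [Module.apply_evalEquiv_symm_apply]
  have h1 := congrArg (fun φ => φ (b i)) hl
  simp only [LinearMap.comp_apply, Module.Basis.constr_basis] at h1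
  have h2 : (Submodule.span ℂ (Set.range K.root)).subtype (b i) = K.root i :=
    congrArg Subtype.val (Module.Basis.span_apply K.root_indep i)
  rwa [h2] at h1

/-- `N⁻`, the subalgebra generated by the `f i`. -/
def nneg : LieSubalgebra ℂ g := LieSubalgebra.lieSpan ℂ g (Set.range K.f)

theorem e_mem_npos (i : ι) : K.e i ∈ K.npos := LieSubalgebra.subset_lieSpan ⟨i, rfl⟩

theorem f_mem_nneg (i : ι) : K.f i ∈ K.nneg := LieSubalgebra.subset_lieSpan ⟨i, rfl⟩

theorem lie_mem_derived (x y : g) : ⁅x, y⁆ ∈ derived g :=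
  LieSubmodule.lie_mem_lie (by simp) (by simp)

theorem e_mem_derived (i : ι) : K.e i ∈ derived g := by
  obtain ⟨d, hd⟩ := K.exists_grading
  have := K.lie_cartan_e d i
  rw [hd, one_smul] at this
  rw [← this]
  exact lie_mem_derived _ _

theorem f_mem_derived (i : ι) : K.f i ∈ derived g := by
  obtain ⟨d, hd⟩ := K.exists_grading
  have := K.lie_cartan_f d i
  rw [hd, one_smul] at this
  rw [← neg_neg (K.f i), ← this]
  exact neg_mem (lie_mem_derived _ _)

theorem coroot_mem_derived (i : ι) : (K.coroot i : g) ∈ derived g := by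
  have := K.lie_e_f i i
  rw [if_pos rfl] at this
  rw [← this]
  exact lie_mem_derived _ _

theorem npos_le_derived : K.npos.toSubmodule ≤ (derived g).toSubmodule := by
  intro x hx
  exact (LieSubalgebra.lieSpan_le (K := (derived g).toLieSubalgebra ℂ g)).mpr (by rintro _ ⟨i, rfl⟩; exact K.e_mem_derived i) hx

theorem nneg_le_derived : K.nneg.toSubmodule ≤ (derived g).toSubmodule := by
  intro x hx
  exact (LieSubalgebra.lieSpan_le (K := (derived g).toLieSubalgebra ℂ g)).mpr (by rintro _ ⟨i, rfl⟩; exact K.f_mem_derived i) hx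

theorem lie_cartan_npos {x y : g} (hx : x ∈ K.cartan) (hy : y ∈ K.npos) : ⁅x, y⁆ ∈ K.npos := by
  refine lie_mem_lieSpan ?_ hy
  rintro _ ⟨i, rfl⟩
  rw [K.lie_cartan_e ⟨x, hx⟩ i]
  exact LieSubalgebra.smul_mem _ _ (K.e_mem_npos i)

theorem lie_cartan_nneg {x y : g} (hx : x ∈ K.cartan) (hy : y ∈ K.nneg) : ⁅x, y⁆ ∈ K.nneg := by
  refine lie_mem_lieSpan ?_ hy
  rintro _ ⟨i, rfl⟩
  rw [K.lie_cartan_f ⟨x, hx⟩ i]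
  exact neg_mem (LieSubalgebra.smul_mem _ _ (K.f_mem_nneg i))

/-- The sum contains the generators of `g` and is stable under bracketing with each of them; the
only mixed brackets `[e i, f j]` fall into `𝔥`. -/
theorem triangular : K.nneg.toSubmodule ⊔ (K.cartan ⊔ K.npos.toSubmodule) = ⊤ := by
  have hn : K.nneg.toSubmodule ⊔ K.cartan ≤ K.nneg.toSubmodule ⊔ (K.cartan ⊔ K.npos.toSubmodule) :=
    sup_le_sup le_rfl le_sup_left
  have hp : K.npos.toSubmodule ⊔ K.cartan ≤ K.nneg.toSubmodule ⊔ (K.cartan ⊔ K.npos.toSubmodule) :=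
    sup_le (le_sup_right.trans le_sup_right) (le_sup_left.trans le_sup_right)
  have hf := fun i => hn (Submodule.mem_sup_left (K.f_mem_nneg i))
  have he := fun i => hp (Submodule.mem_sup_left (K.e_mem_npos i))
  have hh := fun x (hx : x ∈ K.cartan) => hn (Submodule.mem_sup_right hx)
  refine eq_top_of_lie_mem K.generate _ ?_ ?_
  · rintro x ((hx | ⟨i, rfl⟩) | ⟨i, rfl⟩)
    exacts [hh x hx, he i, hf i]
  · intro x hx w hw
    obtain ⟨a, ha, w', hw', rfl⟩ := Submodule.mem_sup.mp hw
    obtain ⟨b, hb, c, hc, rfl⟩ := Submodule.mem_sup.mp hw'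
    rw [lie_add, lie_add]
    obtain ((hx | ⟨i, rfl⟩) | ⟨i, rfl⟩) := hx
    · refine add_mem (hn (Submodule.mem_sup_left (K.lie_cartan_nneg hx ha)))
        (add_mem ?_ (hp (Submodule.mem_sup_left (K.lie_cartan_npos hx hc))))
      rw [K.lie_cartan ⟨x, hx⟩ ⟨b, hb⟩]
      exact zero_mem _
    · refine add_mem (hn ?_) (add_mem ?_
        (hp (Submodule.mem_sup_left (LieSubalgebra.lie_mem _ (K.e_mem_npos i) hc))))
      · refine lie_mem_lieSpan_sup (fun w hw y hy => K.lie_cartan_nneg hw hy) ?_ ha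
        rintro _ ⟨j, rfl⟩
        rw [K.lie_e_f]
        split_ifs
        exacts [Submodule.mem_sup_right (K.coroot i).2, zero_mem _]
      · rw [← lie_skew, K.lie_cartan_e ⟨b, hb⟩]
        exact neg_mem (Submodule.smul_mem _ _ (he i))
    · refine add_mem (hn (Submodule.mem_sup_left (LieSubalgebra.lie_mem _ (K.f_mem_nneg i) ha)))
        (add_mem ?_ (hp ?_))
      · rw [← lie_skew, K.lie_cartan_f ⟨b, hb⟩]
        exact neg_mem (neg_mem (Submodule.smul_mem _ _ (hf i)))
      · refine lie_mem_lieSpan_sup (fun w hw y hy => K.lie_cartan_npos hw hy) ?_ hc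
        rintro _ ⟨j, rfl⟩
        rw [← lie_skew, K.lie_e_f]
        split_ifs
        exacts [neg_mem (Submodule.mem_sup_right (K.coroot j).2), neg_mem (zero_mem _)]

/-- The eigenvalues of `ad d` have negative real part on `N⁻`, vanish on `𝔥` and have positive real
part on `N⁺`, and eigenspaces are independent. The sign conditions are closed under addition, so
they need checking on generators only. -/
theorem isCompl_nneg : IsCompl K.nneg.toSubmodule (K.cartan ⊔ K.npos.toSubmodule) ∧
    Disjoint K.cartan K.npos.toSubmodule := by
  obtain ⟨d, hd⟩ := K.exists_grading
  have hp : K.npos.toSubmodule ≤ adPart (d : g) {c | 0 < c.re} := by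
    refine lieSpan_le_adPart (fun a ha b hb => ?_) ?_
    · simp only [Set.mem_ofPred_eq, Complex.add_re] at *
      exact add_pos ha hb
    · rintro _ ⟨i, rfl⟩
      refine mem_adPart (c := 1) (by simp) ?_
      rw [K.lie_cartan_e, hd]
  have hn : K.nneg.toSubmodule ≤ adPart (d : g) {c | c.re < 0} := by
    refine lieSpan_le_adPart (fun a ha b hb => ?_) ?_
    · simp only [Set.mem_ofPred_eq, Complex.add_re] at *
      exact add_neg ha hb
    · rintro _ ⟨i, rfl⟩
      refine mem_adPart (c := -1) (by simp) ?_
      rw [K.lie_cartan_f, hd]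
      simp
  have hh : K.cartan ≤ adPart (d : g) {0} := fun x hx =>
    mem_adPart (Set.mem_singleton 0) (by rw [K.lie_cartan d ⟨x, hx⟩, zero_smul])
  refine ⟨⟨?_, codisjoint_iff.mpr K.triangular⟩, ?_⟩
  · refine (adPart_disjoint (d : g) (S := {c | c.re < 0}) (T := {c | 0 ≤ c.re}) ?_).mono hn
      (sup_le (hh.trans (adPart_mono _ ?_)) (hp.trans (adPart_mono _ ?_)))
    · rw [Set.disjoint_left]
      intro c h h'
      simp only [Set.mem_ofPred_eq] at h h'
      linarith
    · intro c hc; simp only [Set.mem_singleton_iff] at hc; simp [hc]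
    · intro c hc
      simp only [Set.mem_ofPred_eq] at hc ⊢
      exact hc.le
  · refine (adPart_disjoint (d : g) ?_).mono hh hp
    simp

theorem isCompl_cartan :
    IsCompl K.cartan (K.nneg.toSubmodule ⊔ K.npos.toSubmodule) := by
  obtain ⟨h1, h2⟩ := K.isCompl_nneg
  refine ⟨Submodule.disjoint_def.mpr fun x hx hx' => ?_, codisjoint_iff.mpr ?_⟩
  · obtain ⟨a, ha, b, hb, rfl⟩ := Submodule.mem_sup.mp hx'
    have ha0 : a = 0 := Submodule.disjoint_def.mp h1.disjoint a ha (by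
      rw [show a = (a + b) - b by abel]
      exact sub_mem (Submodule.mem_sup_left hx) (Submodule.mem_sup_right hb))
    rw [ha0, zero_add] at hx ⊢
    exact Submodule.disjoint_def.mp h2 b hx hb
  · rw [← sup_assoc, sup_comm K.cartan, sup_assoc, K.triangular]

/-- The projection of `g = N⁻ ⊕ 𝔥 ⊕ N⁺` to `𝔥`. -/
def projCartan : g →ₗ[ℂ] g := Submodule.projection _ _ K.isCompl_cartan

/-- The projection of `g = N⁻ ⊕ 𝔥 ⊕ N⁺` to `N⁻`. -/
def projNeg : g →ₗ[ℂ] g := Submodule.projection _ _ K.isCompl_nneg.1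

theorem projCartan_mem (x : g) : K.projCartan x ∈ K.cartan :=
  Submodule.projection_apply_mem _ x

theorem projCartan_cartan {x : g} (hx : x ∈ K.cartan) : K.projCartan x = x :=
  Submodule.projection_apply_of_mem_left _ hx

theorem projCartan_npos {x : g} (hx : x ∈ K.npos) : K.projCartan x = 0 :=
  (Submodule.projection_apply_eq_zero_iff _).mpr (Submodule.mem_sup_right hx)

theorem projCartan_nneg {x : g} (hx : x ∈ K.nneg) : K.projCartan x = 0 :=
  (Submodule.projection_apply_eq_zero_iff _).mpr (Submodule.mem_sup_left hx)

theorem projNeg_mem (x : g) : K.projNeg x ∈ K.nneg :=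
  Submodule.projection_apply_mem _ x

theorem projNeg_nneg {x : g} (hx : x ∈ K.nneg) : K.projNeg x = x :=
  Submodule.projection_apply_of_mem_left _ hx

theorem projNeg_eq_zero {x : g} (hx : x ∈ K.cartan ⊔ K.npos.toSubmodule) : K.projNeg x = 0 :=
  (Submodule.projection_apply_eq_zero_iff _).mpr hx

theorem exists_triangular (x : g) :
    ∃ a ∈ K.nneg, ∃ h ∈ K.cartan, ∃ b ∈ K.npos, x = a + (h + b) := by
  have hx : x ∈ K.nneg.toSubmodule ⊔ (K.cartan ⊔ K.npos.toSubmodule) :=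
    K.triangular ▸ Submodule.mem_top
  obtain ⟨a, ha, w, hw, rfl⟩ := Submodule.mem_sup.mp hx
  obtain ⟨h, hh, b, hb, rfl⟩ := Submodule.mem_sup.mp hw
  exact ⟨a, ha, h, hh, b, hb, rfl⟩

theorem exists_triangular_derived {x : g} (hx : x ∈ derived g) :
    ∃ a ∈ K.nneg, ∃ h ∈ K.cartan', ∃ b ∈ K.npos, x = a + (h + b) := by
  obtain ⟨a, ha, h, hh, b, hb, rfl⟩ := K.exists_triangular x
  refine ⟨a, ha, h, ⟨hh, ?_⟩, b, hb, rfl⟩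
  rw [show h = a + (h + b) - a - b by abel]
  exact sub_mem (sub_mem hx (K.nneg_le_derived ha)) (K.npos_le_derived hb)

theorem projCartan_derived {x : g} (hx : x ∈ derived g) : K.projCartan x ∈ K.cartan' := by
  obtain ⟨a, ha, h, hh, b, hb, rfl⟩ := K.exists_triangular_derived hx
  rw [map_add, map_add, K.projCartan_nneg ha, K.projCartan_npos hb, K.projCartan_cartan hh.1]
  simpa using hh

end KacMoody

/-! ### Subspaces `W ⊗ A` and generators of `g_A` -/

section

variable {g : Type*} [LieRing g] [LieAlgebra ℂ g] {n : ℕ}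

theorem lie_mem_loops_of_lie_mem {W₁ W₂ W₃ : Submodule ℂ g}
    (h : ∀ x ∈ W₁, ∀ y ∈ W₂, ⁅x, y⁆ ∈ W₃) {x y : Laurent n ⊗[ℂ] g} (hx : x ∈ loops n W₁)
    (hy : y ∈ loops n W₂) : ⁅x, y⁆ ∈ loops n W₃ := by
  have h1 : ∀ (p : Laurent n), ∀ z ∈ W₁, ∀ y ∈ loops n W₂, ⁅p ⊗ₜ[ℂ] z, y⁆ ∈ loops n W₃ := by
    intro p z hz y hy
    have : loops n W₂ ≤ (loops n W₃).comap
        (LieModule.toEnd ℂ (Laurent n ⊗[ℂ] g) (Laurent n ⊗[ℂ] g) (p ⊗ₜ[ℂ] z)) :=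
      loops_le fun q w hw => by
        rw [Submodule.mem_comap, LieModule.toEnd_apply_apply,
          LieAlgebra.ExtendScalars.bracket_tmul]
        exact tmul_mem_loops _ (h z hz w hw)
    exact this hy
  have : loops n W₁ ≤ (loops n W₃).comap
      (-LieModule.toEnd ℂ (Laurent n ⊗[ℂ] g) (Laurent n ⊗[ℂ] g) y : Module.End ℂ _) :=
    loops_le fun q w hw => by
      rw [Submodule.mem_comap, LinearMap.neg_apply, LieModule.toEnd_apply_apply, lie_skew]
      exact h1 q w hw y hy
  have h2 := this hx
  rwa [Submodule.mem_comap, LinearMap.neg_apply, LieModule.toEnd_apply_apply, lie_skew] at h2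

theorem lTensor_eq_self {W : Submodule ℂ g} {T : g →ₗ[ℂ] g} (h : ∀ x ∈ W, T x = x)
    {x : Laurent n ⊗[ℂ] g} (hx : x ∈ loops n W) : LinearMap.lTensor (Laurent n) T x = x := by
  have : loops n W ≤ LinearMap.eqLocus (LinearMap.lTensor (Laurent n) T) LinearMap.id :=
    loops_le fun p y hy => by simp [LinearMap.mem_eqLocus, h y hy]
  exact this hx

theorem lTensor_eq_zero {W : Submodule ℂ g} {T : g →ₗ[ℂ] g} (h : ∀ x ∈ W, T x = 0)
    {x : Laurent n ⊗[ℂ] g} (hx : x ∈ loops n W) : LinearMap.lTensor (Laurent n) T x = 0 := by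
  have : loops n W ≤ LinearMap.ker (LinearMap.lTensor (Laurent n) T) :=
    loops_le fun p y hy => by simp [h y hy]
  exact this hx

theorem lTensor_mem_loops {W W' : Submodule ℂ g} {T : g →ₗ[ℂ] g} (h : ∀ x ∈ W, T x ∈ W')
    {x : Laurent n ⊗[ℂ] g} (hx : x ∈ loops n W) :
    LinearMap.lTensor (Laurent n) T x ∈ loops n W' := by
  have : loops n W ≤ (loops n W').comap (LinearMap.lTensor (Laurent n) T) :=
    loops_le fun p y hy => by
      rw [Submodule.mem_comap, LinearMap.lTensor_tmul]
      exact tmul_mem_loops p (h y hy)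
  exact this hx

theorem mem_loops_top (x : Laurent n ⊗[ℂ] g) : x ∈ loops n (⊤ : Submodule ℂ g) := by
  induction x with
  | zero => exact zero_mem _
  | tmul p y => exact tmul_mem_loops p Submodule.mem_top
  | add x y hx hy => exact add_mem hx hy

variable (n) in
/-- For a subalgebra `S ⊆ g`, the subalgebra `g_A ∩ (S ⊗ A)`. -/
def loopSub (S : LieSubalgebra ℂ g) : LieSubalgebra ℂ (loopAlg g n) where
  toSubmodule := (loops n S.toSubmodule).comap (loopAlg g n).toSubmodule.subtype
  lie_mem' := fun {_ _} hx hy =>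
    lie_mem_loops_of_lie_mem (W₁ := S.toSubmodule) (W₂ := S.toSubmodule)
      (fun _ h _ h' => S.lie_mem h h') hx hy

/-- The element `p ⊗ x` of `g_A`, for `x ∈ g'`. -/
def loopElt (p : Laurent n) (x : derived g) : loopAlg g n :=
  ⟨p ⊗ₜ (x : g), Submodule.mem_sup_left (tmul_mem_loops p x.2)⟩

end

namespace KacMoody

variable {ι g : Type*} [Fintype ι] [DecidableEq ι] {C : Matrix ι ι ℤ} [LieRing g] [LieAlgebra ℂ g]
  (K : KacMoody C g) {n : ℕ}

/-- The element `p ⊗ x` of `𝔥_A`, for `x ∈ 𝔥'`. -/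
def cartanElt (p : Laurent n) (x : K.cartan') : K.loopCartan n :=
  ⟨p ⊗ₜ (x : g), Submodule.mem_sup_left (tmul_mem_loops p x.2)⟩

/-- The element `1 ⊗ x` of `𝔥_A`, for `x ∈ 𝔥`. -/
def cartanConst (n : ℕ) (x : K.cartan) : K.loopCartan n :=
  ⟨1 ⊗ₜ (x : g), Submodule.mem_sup_right (one_tmul_mem_consts x.2)⟩

/-- The element `p ⊗ e i` of `g_A`. -/
def E (i : ι) (p : Laurent n) : loopAlg g n := loopElt p ⟨K.e i, K.e_mem_derived i⟩

/-- The element `p ⊗ f i` of `g_A`. -/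
def F (i : ι) (p : Laurent n) : loopAlg g n := loopElt p ⟨K.f i, K.f_mem_derived i⟩

/-- The coroots as elements of `𝔥'`. -/
def coroot' (i : ι) : K.cartan' := ⟨K.coroot i, (K.coroot i).2, K.coroot_mem_derived i⟩

theorem E_add (i : ι) (p q : Laurent n) : K.E i (p + q) = K.E i p + K.E i q :=
  Subtype.ext (TensorProduct.add_tmul p q (K.e i))

theorem F_add (i : ι) (p q : Laurent n) : K.F i (p + q) = K.F i p + K.F i q :=
  Subtype.ext (TensorProduct.add_tmul p q (K.f i))

theorem F_smul (i : ι) (c : ℂ) (p : Laurent n) : K.F i (c • p) = c • K.F i p :=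
  Subtype.ext (TensorProduct.smul_tmul' c p (K.f i)).symm

theorem inclCartan_add (x y : K.loopCartan n) :
    K.inclCartan (x + y) = K.inclCartan x + K.inclCartan y := rfl

theorem inclCartan_const (x : K.cartan) :
    K.inclCartan (K.cartanConst n x) = const n (x : g) := rfl

theorem lie_E_F (i j : ι) (p q : Laurent n) :
    ⁅K.E i p, K.F j q⁆ =
      if i = j then K.inclCartan (K.cartanElt (p * q) (K.coroot' i)) else 0 := by
  apply Subtype.ext
  change ⁅p ⊗ₜ[ℂ] K.e i, q ⊗ₜ[ℂ] K.f j⁆ = _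
  rw [LieAlgebra.ExtendScalars.bracket_tmul, K.lie_e_f]
  split_ifs
  · rfl
  · simp

theorem loopCartan_induction {P : K.loopCartan n → Prop}
    (elt : ∀ p x, P (K.cartanElt p x)) (const : ∀ x, P (K.cartanConst n x))
    (add : ∀ x y, P x → P y → P (x + y)) (x : K.loopCartan n) : P x := by
  have h0 : P 0 := by
    have := const 0
    rwa [show K.cartanConst n 0 = 0 from Subtype.ext (by simp [cartanConst])] at this
  obtain ⟨x, hx⟩ := x
  obtain ⟨y, hy, _, ⟨z, hz, rfl⟩, rfl⟩ := Submodule.mem_sup.mp hx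
  refine add ⟨y, Submodule.mem_sup_left hy⟩ ⟨1 ⊗ₜ z, _⟩ ?_ (const ⟨z, hz⟩)
  obtain ⟨w, rfl⟩ := hy
  clear hx
  induction w with
  | zero => convert h0; simp
  | tmul p x => exact elt p x
  | add a b ha hb =>
    convert add _ _ ha hb
    exact Subtype.ext (map_add _ _ _)

/-- `𝔥_A` acts on `A ⊗ f i` through multiplication by elements of `A`. Hence bracketing with `𝔥_A`
turns a product of such operators into products of the same length and type. -/
theorem exists_lie_inclCartan_F (x : K.loopCartan n) (i : ι) :
    ∃ s : Laurent n, ∀ q : Laurent n, ⁅K.inclCartan x, K.F i q⁆ = K.F i (s * q) := by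
  induction x using K.loopCartan_induction with
  | elt p x =>
    refine ⟨-K.root i ⟨x, x.2.1⟩ • p, fun q => Subtype.ext ?_⟩
    change ⁅p ⊗ₜ[ℂ] (x : g), q ⊗ₜ[ℂ] K.f i⁆ = ((-K.root i ⟨x, x.2.1⟩ • p) * q) ⊗ₜ[ℂ] K.f i
    rw [LieAlgebra.ExtendScalars.bracket_tmul, K.lie_cartan_f ⟨x, x.2.1⟩, smul_mul_assoc,
      TensorProduct.smul_tmul, neg_smul]
  | const x =>
    refine ⟨-K.root i x • 1, fun q => Subtype.ext ?_⟩
    change ⁅(1 : Laurent n) ⊗ₜ[ℂ] (x : g), q ⊗ₜ[ℂ] K.f i⁆ = ((-K.root i x • 1) * q) ⊗ₜ[ℂ] K.f i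
    rw [LieAlgebra.ExtendScalars.bracket_tmul, K.lie_cartan_f x, smul_mul_assoc,
      TensorProduct.smul_tmul, neg_smul]
  | add x y hx hy =>
    obtain ⟨s, hs⟩ := hx
    obtain ⟨t, ht⟩ := hy
    refine ⟨s + t, fun q => ?_⟩
    rw [inclCartan_add, add_lie, hs, ht, add_mul, F_add]

theorem exists_lie_inclCartan_E (x : K.loopCartan n) (i : ι) :
    ∃ s : Laurent n, ∀ q : Laurent n, ⁅K.inclCartan x, K.E i q⁆ = K.E i (s * q) := by
  induction x using K.loopCartan_induction with
  | elt p x =>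
    refine ⟨K.root i ⟨x, x.2.1⟩ • p, fun q => Subtype.ext ?_⟩
    change ⁅p ⊗ₜ[ℂ] (x : g), q ⊗ₜ[ℂ] K.e i⁆ = ((K.root i ⟨x, x.2.1⟩ • p) * q) ⊗ₜ[ℂ] K.e i
    rw [LieAlgebra.ExtendScalars.bracket_tmul, K.lie_cartan_e ⟨x, x.2.1⟩, smul_mul_assoc,
      TensorProduct.smul_tmul]
  | const x =>
    refine ⟨K.root i x • 1, fun q => Subtype.ext ?_⟩
    change ⁅(1 : Laurent n) ⊗ₜ[ℂ] (x : g), q ⊗ₜ[ℂ] K.e i⁆ = ((K.root i x • 1) * q) ⊗ₜ[ℂ] K.e i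
    rw [LieAlgebra.ExtendScalars.bracket_tmul, K.lie_cartan_e x, smul_mul_assoc,
      TensorProduct.smul_tmul]
  | add x y hx hy =>
    obtain ⟨s, hs⟩ := hx
    obtain ⟨t, ht⟩ := hy
    refine ⟨s + t, fun q => ?_⟩
    rw [inclCartan_add, add_lie, hs, ht, add_mul, E_add]

theorem lie_const_F (x : K.cartan) (i : ι) (p : Laurent n) :
    ⁅const n (x : g), K.F i p⁆ = -(K.root i x • K.F i p) := by
  apply Subtype.ext
  change ⁅(1 : Laurent n) ⊗ₜ[ℂ] (x : g), p ⊗ₜ[ℂ] K.f i⁆ = -(K.root i x • (p ⊗ₜ[ℂ] K.f i))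
  rw [LieAlgebra.ExtendScalars.bracket_tmul, K.lie_cartan_f x, one_mul, TensorProduct.tmul_neg,
    TensorProduct.tmul_smul]

/-- In a bracket the whole Laurent polynomial can be put on one entry: `p ⊗ [y, z] = [p ⊗ y, 1 ⊗
z]`. -/
theorem tmul_mem_of_mem_lieSpan {s : Set g} {T : LieSubalgebra ℂ (Laurent n ⊗[ℂ] g)}
    (h : ∀ x ∈ s, ∀ p : Laurent n, p ⊗ₜ[ℂ] x ∈ T) {x : g} (hx : x ∈ LieSubalgebra.lieSpan ℂ g s)
    (p : Laurent n) : p ⊗ₜ[ℂ] x ∈ T := by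
  induction hx using LieSubalgebra.lieSpan_induction generalizing p with
  | mem y hy => exact h y hy p
  | zero => rw [TensorProduct.tmul_zero]; exact zero_mem _
  | add y z _ _ h1 h2 => rw [TensorProduct.tmul_add]; exact add_mem (h1 p) (h2 p)
  | smul a y _ h1 => rw [TensorProduct.tmul_smul]; exact LieSubalgebra.smul_mem _ a (h1 p)
  | lie y z hy hz h1 h2 =>
    have := T.lie_mem (h1 p) (h2 1)
    rwa [LieAlgebra.ExtendScalars.bracket_tmul, mul_one] at this

/-- `g_A` is generated by the `p ⊗ e i`, the `p ⊗ f i` and `𝔥_A`. -/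
theorem loopAlg_generated (S : LieSubalgebra ℂ (loopAlg g n)) (hE : ∀ i p, K.E i p ∈ S)
    (hF : ∀ i p, K.F i p ∈ S) (hH : ∀ x, K.inclCartan x ∈ S) : S = ⊤ := by
  set T := S.map (loopAlg g n).incl with hT
  have hS : ∀ x : loopAlg g n, (x : Laurent n ⊗[ℂ] g) ∈ T ↔ x ∈ S := by
    intro x
    rw [hT, LieSubalgebra.mem_map]
    constructor
    · rintro ⟨y, hy, h⟩
      rwa [← Subtype.ext (show (y : Laurent n ⊗[ℂ] g) = x from h)]
    · exact fun h => ⟨x, h, rfl⟩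
  have hp : ∀ x ∈ K.npos, ∀ p : Laurent n, p ⊗ₜ[ℂ] x ∈ T := fun x hx p =>
    tmul_mem_of_mem_lieSpan (by rintro _ ⟨i, rfl⟩ p; exact (hS _).mpr (hE i p)) hx p
  have hn : ∀ x ∈ K.nneg, ∀ p : Laurent n, p ⊗ₜ[ℂ] x ∈ T := fun x hx p =>
    tmul_mem_of_mem_lieSpan (by rintro _ ⟨i, rfl⟩ p; exact (hS _).mpr (hF i p)) hx p
  rw [eq_top_iff]
  intro x _
  rw [← hS]
  refine (sup_le (loops_le fun p y hy => ?_) ?_ :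
    loops n (derived g).toSubmodule ⊔ consts n ⊤ ≤ T.toSubmodule) x.2
  · obtain ⟨a, ha, h, hh, b, hb, rfl⟩ := K.exists_triangular_derived hy
    rw [TensorProduct.tmul_add, TensorProduct.tmul_add]
    exact add_mem (hn a ha p) (add_mem ((hS _).mpr (hH (K.cartanElt p ⟨h, hh⟩))) (hp b hb p))
  · rintro _ ⟨y, -, rfl⟩
    obtain ⟨a, ha, h, hh, b, hb, rfl⟩ := K.exists_triangular y
    rw [map_add, map_add]
    exact add_mem (hn a ha 1) (add_mem ((hS _).mpr (hH (K.cartanConst n ⟨h, hh⟩))) (hp b hb 1))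

section

variable {V : Type*} [AddCommGroup V] [Module ℂ V] [LieRingModule (loopAlg g n) V]
  [LieModule ℂ (loopAlg g n) V]

/-- A subspace of a `g_A`-module which is stable under generators of `g_A` is a submodule. -/
theorem exists_lieSubmodule (W : Submodule ℂ V) (hE : ∀ i p, ∀ w ∈ W, ⁅K.E (n := n) i p, w⁆ ∈ W)
    (hF : ∀ i p, ∀ w ∈ W, ⁅K.F (n := n) i p, w⁆ ∈ W)
    (hH : ∀ x : K.loopCartan n, ∀ w ∈ W, ⁅K.inclCartan x, w⁆ ∈ W) :
    ∃ N : LieSubmodule ℂ (loopAlg g n) V, N.toSubmodule = W := by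
  let S : LieSubalgebra ℂ (loopAlg g n) :=
    { carrier := {x | ∀ w ∈ W, ⁅x, w⁆ ∈ W}
      add_mem' := fun {x y} hx hy w hw => by rw [add_lie]; exact add_mem (hx w hw) (hy w hw)
      zero_mem' := fun w _ => by rw [zero_lie]; exact zero_mem _
      smul_mem' := fun c x hx w hw => by rw [smul_lie]; exact W.smul_mem c (hx w hw)
      lie_mem' := fun {x y} hx hy w hw => by
        rw [lie_lie]; exact sub_mem (hx _ (hy w hw)) (hy _ (hx w hw)) }
  have hS : S = ⊤ := K.loopAlg_generated S hE hF hH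
  exact ⟨{ W with lie_mem := fun {x w} hw => (hS ▸ LieSubalgebra.mem_top x : x ∈ S) w hw }, rfl⟩

end

/-! ### The module `M(Ψ)` is nonzero -/

variable (n) in
-- The projection is `projNeg` tensored with `A`. It preserves `g_A` because its image `N⁻ ⊗ A` lies
-- in `g' ⊗ A`.
theorem isCompl_loopSub (b : LieSubalgebra ℂ g)
    (hb : b.toSubmodule = K.cartan ⊔ K.npos.toSubmodule) :
    IsCompl (loopSub n K.nneg).toSubmodule (loopSub n b).toSubmodule := by
  have h1 : ∀ {x : Laurent n ⊗[ℂ] g}, x ∈ loops n K.nneg.toSubmodule →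
      LinearMap.lTensor (Laurent n) K.projNeg x = x :=
    fun hx => lTensor_eq_self (fun y hy => K.projNeg_nneg hy) hx
  have h2 : ∀ {x : Laurent n ⊗[ℂ] g}, x ∈ loops n b.toSubmodule →
      LinearMap.lTensor (Laurent n) K.projNeg x = 0 :=
    fun hx => lTensor_eq_zero (fun y hy => K.projNeg_eq_zero (hb ▸ hy)) hx
  refine ⟨Submodule.disjoint_def.mpr fun x hx hx' => Subtype.ext ?_, codisjoint_iff.mpr ?_⟩
  · exact (h1 hx).symm.trans (h2 hx')
  · rw [eq_top_iff]
    intro x _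
    have hy : LinearMap.lTensor (Laurent n) K.projNeg x ∈ loops n K.nneg.toSubmodule :=
      lTensor_mem_loops (fun y _ => K.projNeg_mem y) (mem_loops_top (x : Laurent n ⊗[ℂ] g))
    have hz : (x : Laurent n ⊗[ℂ] g) - LinearMap.lTensor (Laurent n) K.projNeg x ∈
        loops n b.toSubmodule := by
      have := lTensor_mem_loops (T := LinearMap.id - K.projNeg) (W := ⊤) (W' := b.toSubmodule)
        (fun y _ => ?_) (mem_loops_top (x : Laurent n ⊗[ℂ] g))
      · rwa [LinearMap.lTensor_sub, LinearMap.sub_apply, LinearMap.lTensor_id] at this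
      · obtain ⟨a, ha, h, hh, c, hc, rfl⟩ := K.exists_triangular y
        have hhc : h + c ∈ K.cartan ⊔ K.npos.toSubmodule := Submodule.add_mem_sup hh hc
        rw [LinearMap.sub_apply, LinearMap.id_apply, map_add, K.projNeg_nneg ha,
          K.projNeg_eq_zero hhc, hb]
        simpa using hhc
    have hyL : LinearMap.lTensor (Laurent n) K.projNeg x ∈ loopAlg g n :=
      Submodule.mem_sup_left (loops_mono K.nneg_le_derived hy)
    refine Submodule.mem_sup.mpr ⟨⟨_, hyL⟩, hy, x - ⟨_, hyL⟩, hz, ?_⟩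
    abel

/-- Composing `Ψ` with the projection to `𝔥_A` gives a character of the loop Borel subalgebra, since
brackets of `𝔥 + N⁺` land in `N⁺`. In the induced action on `U(N⁻ ⊗ A)` the ideal kills the vector
`1`, whereas `1` acts as the identity. -/
theorem one_notMem_vermaIdeal (Ψ : Module.Dual ℂ (K.loopCartan n)) :
    (1 : UniversalEnvelopingAlgebra ℂ (loopAlg g n)) ∉ K.vermaIdeal Ψ := by
  have hlie : ∀ x ∈ K.cartan ⊔ K.npos.toSubmodule, ∀ y ∈ K.cartan ⊔ K.npos.toSubmodule,
      ⁅x, y⁆ ∈ K.npos.toSubmodule := by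
    intro x hx y hy
    obtain ⟨a, ha, b, hb, rfl⟩ := Submodule.mem_sup.mp hx
    obtain ⟨c, hc, d, hd, rfl⟩ := Submodule.mem_sup.mp hy
    rw [add_lie, lie_add, lie_add, K.lie_cartan ⟨a, ha⟩ ⟨c, hc⟩, zero_add]
    refine add_mem (K.lie_cartan_npos ha hd) (add_mem ?_ (K.npos.lie_mem hb hd))
    rw [← lie_skew]
    exact neg_mem (K.lie_cartan_npos hc hb)
  let b : LieSubalgebra ℂ g :=
    { toSubmodule := K.cartan ⊔ K.npos.toSubmodule
      lie_mem' := fun {x y} hx hy => Submodule.mem_sup_right (hlie x hx y hy) }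
  let π : loopAlg g n →ₗ[ℂ] Laurent n ⊗[ℂ] g :=
    LinearMap.lTensor (Laurent n) K.projCartan ∘ₗ (loopAlg g n).toSubmodule.subtype
  have hπ : ∀ x, π x ∈ K.loopCartan n := by
    intro x
    obtain ⟨y, hy, _, ⟨z, hz, rfl⟩, h⟩ := Submodule.mem_sup.mp x.2
    change LinearMap.lTensor (Laurent n) K.projCartan x ∈ _
    rw [← h, map_add]
    refine Submodule.add_mem_sup (lTensor_mem_loops (fun w hw => K.projCartan_derived hw) hy) ?_
    exact one_tmul_mem_consts (K.projCartan_mem z)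
  let χ : loopAlg g n →ₗ[ℂ] ℂ := Ψ ∘ₗ π.codRestrict _ hπ
  have hχ0 : ∀ x : loopAlg g n, (x : Laurent n ⊗[ℂ] g) ∈ loops n K.npos.toSubmodule → χ x = 0 := by
    intro x hx
    have : π.codRestrict _ hπ x = 0 :=
      Subtype.ext (lTensor_eq_zero (fun y hy => K.projCartan_npos hy) hx)
    change Ψ _ = 0
    rw [this, map_zero]
  have hχΨ : ∀ x : K.loopCartan n, χ (K.inclCartan x) = Ψ x := by
    intro x
    refine congrArg Ψ (Subtype.ext ?_)
    have hx : (x : Laurent n ⊗[ℂ] g) ∈ loops n K.cartan :=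
      (sup_le (loops_mono inf_le_left) (by
        rintro _ ⟨y, hy, rfl⟩; exact tmul_mem_loops 1 hy) :
        K.loopCartan n ≤ loops n K.cartan) x.2
    exact lTensor_eq_self (fun y hy => K.projCartan_cartan hy) hx
  obtain ⟨ρ, hρ⟩ := exists_induced (loopSub n K.nneg) (loopSub n b)
    (K.isCompl_loopSub n b rfl) χ
    (fun x hx y hy => hχ0 _ (lie_mem_loops_of_lie_mem hlie hx hy))
  let R := UniversalEnvelopingAlgebra.lift ℂ ρ
  let J : Submodule (UniversalEnvelopingAlgebra ℂ (loopAlg g n))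
      (UniversalEnvelopingAlgebra ℂ (loopAlg g n)) :=
    { carrier := {u | R u 1 = 0}
      add_mem' := fun {u v} hu hv => by
        simp only [Set.mem_ofPred_eq] at *
        rw [map_add, LinearMap.add_apply, hu, hv, add_zero]
      zero_mem' := by simp
      smul_mem' := fun c u hu => by
        simp only [Set.mem_ofPred_eq] at *
        rw [smul_eq_mul, map_mul, Module.End.mul_apply, hu, map_zero] }
  have hJ : K.vermaIdeal Ψ ≤ J := by
    refine Submodule.span_le.mpr ?_
    rintro u (⟨x, hx, rfl⟩ | ⟨x, rfl⟩)
    · change R _ 1 = 0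
      rw [UniversalEnvelopingAlgebra.lift_ι_apply, hρ x (loops_mono le_sup_right hx), hχ0 x hx,
        map_zero]
    · change R _ 1 = 0
      have hx : K.inclCartan x ∈ loopSub n b :=
        (sup_le (loops_mono (inf_le_left.trans le_sup_left)) (by
          rintro _ ⟨y, hy, rfl⟩; exact tmul_mem_loops 1 (Submodule.mem_sup_left hy)) :
          K.loopCartan n ≤ loops n b.toSubmodule) x.2
      rw [map_sub, LinearMap.sub_apply, UniversalEnvelopingAlgebra.lift_ι_apply, hρ _ hx, hχΨ,
        AlgHom.commutes, Module.algebraMap_end_apply, Algebra.algebraMap_eq_smul_one, sub_self]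
  intro h
  have h1 : R 1 1 = 0 := hJ h
  rw [map_one R, Module.End.one_apply] at h1
  -- The augmentation of `U(N⁻ ⊗ A)` shows that `1 ≠ 0` there.
  have h2 := congrArg (UniversalEnvelopingAlgebra.lift ℂ
    (0 : loopSub n K.nneg →ₗ⁅ℂ⁆ ℂ)) h1
  rw [map_one, map_zero] at h2
  exact one_ne_zero h2

end KacMoody

/-! ### Highest weight modules -/

namespace KacMoody

variable {ι g : Type*} [Fintype ι] [DecidableEq ι] {C : Matrix ι ι ℤ} [LieRing g] [LieAlgebra ℂ g]
  (K : KacMoody C g) {n : ℕ} {V : Type*} [AddCommGroup V] [Module ℂ V]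
  [LieRingModule (loopAlg g n) V] [LieModule ℂ (loopAlg g n) V]

/-- `v` is a highest weight vector of weight `Ψ` which generates the `g_A`-module `V`. -/
structure IsHighestWeight (Ψ : Module.Dual ℂ (K.loopCartan n)) (v : V) : Prop where
  lie_E : ∀ i p, ⁅K.E (n := n) i p, v⁆ = 0
  lie_H : ∀ x, ⁅K.inclCartan x, v⁆ = Ψ x • v
  gen : ∀ N : LieSubmodule ℂ (loopAlg g n) V, v ∈ N → N = ⊤

/-- The product of the operators `p ⊗ f i`, for `(i, p)` in a list, applied to a vector. -/
def word (l : List (ι × Laurent n)) (s : V) : V := l.foldr (fun a w => ⁅K.F a.1 a.2, w⁆) s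

theorem word_cons (a : ι × Laurent n) (l : List (ι × Laurent n)) (s : V) :
    K.word (a :: l) s = ⁅K.F a.1 a.2, K.word l s⁆ := rfl

/-- The smallest subspace which contains `S` and is stable under all `p ⊗ f i`. -/
def words (n : ℕ) {V : Type*} [AddCommGroup V] [Module ℂ V] [LieRingModule (loopAlg g n) V]
    (S : Submodule ℂ V) : Submodule ℂ V :=
  Submodule.span ℂ {w | ∃ l : List (ι × Laurent n), ∃ s ∈ S, w = K.word l s}

theorem word_mem_words (l : List (ι × Laurent n)) {S : Submodule ℂ V} {s : V} (hs : s ∈ S) :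
    K.word l s ∈ K.words n S := Submodule.subset_span ⟨l, s, hs, rfl⟩

theorem le_words (S : Submodule ℂ V) : S ≤ K.words n S := fun _ hs => K.word_mem_words [] hs

theorem lie_mem_of_span {s : Set V} {W : Submodule ℂ V} {x : loopAlg g n}
    (h : ∀ w ∈ s, ⁅x, w⁆ ∈ W) {w : V} (hw : w ∈ Submodule.span ℂ s) : ⁅x, w⁆ ∈ W := by
  have : Submodule.span ℂ s ≤ W.comap (LieModule.toEnd ℂ (loopAlg g n) V x) :=
    Submodule.span_le.mpr h
  exact this hw

theorem lie_F_mem_words (i : ι) (p : Laurent n) {S : Submodule ℂ V} {w : V}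
    (hw : w ∈ K.words n S) : ⁅K.F i p, w⁆ ∈ K.words n S := by
  refine lie_mem_of_span ?_ hw
  rintro _ ⟨l, s, hs, rfl⟩
  exact K.word_mem_words ((i, p) :: l) hs

/-- The subspace `U(N⁻ ⊗ A) S` is a submodule if `S` is stable under `𝔥_A` and `N⁺ ⊗ A`. -/
theorem exists_lieSubmodule_words (S : Submodule ℂ V)
    (hE : ∀ i p, ∀ s ∈ S, ⁅K.E (n := n) i p, s⁆ ∈ S)
    (hH : ∀ x : K.loopCartan n, ∀ s ∈ S, ⁅K.inclCartan x, s⁆ ∈ S) :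
    ∃ N : LieSubmodule ℂ (loopAlg g n) V, N.toSubmodule = K.words n S := by
  have hH' : ∀ x : K.loopCartan n, ∀ w ∈ K.words n S, ⁅K.inclCartan x, w⁆ ∈ K.words n S := by
    intro x w hw
    refine lie_mem_of_span ?_ hw
    rintro _ ⟨l, s, hs, rfl⟩
    induction l with
    | nil => exact K.le_words S (hH x s hs)
    | cons a l ih =>
      obtain ⟨t, ht⟩ := K.exists_lie_inclCartan_F x a.1
      rw [word_cons, leibniz_lie, ht]
      exact add_mem (K.word_mem_words ((a.1, t * a.2) :: l) hs) (K.lie_F_mem_words _ _ ih)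
  refine K.exists_lieSubmodule _ (fun i p w hw => ?_)
    (fun i p w hw => K.lie_F_mem_words i p hw) hH'
  refine lie_mem_of_span ?_ hw
  rintro _ ⟨l, s, hs, rfl⟩
  induction l with
  | nil => exact K.le_words S (hE i p s hs)
  | cons a l ih =>
    rw [word_cons, leibniz_lie, K.lie_E_F]
    refine add_mem ?_ (K.lie_F_mem_words _ _ ih)
    split_ifs
    · exact hH' _ _ (K.word_mem_words l hs)
    · rw [zero_lie]; exact zero_mem _

/-- The sum of the images of the operators `p ⊗ f i`. -/
def lowerPart (n : ℕ) (V : Type*) [AddCommGroup V] [Module ℂ V] [LieRingModule (loopAlg g n) V] :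
    Submodule ℂ V :=
  Submodule.span ℂ {w | ∃ (i : ι) (p : Laurent n) (u : V), w = ⁅K.F i p, u⁆}

theorem lie_F_mem_lowerPart (i : ι) (p : Laurent n) (u : V) : ⁅K.F i p, u⁆ ∈ K.lowerPart n V :=
  Submodule.subset_span ⟨i, p, u, rfl⟩

theorem words_le (S : Submodule ℂ V) : K.words n S ≤ S ⊔ K.lowerPart n V := by
  refine Submodule.span_le.mpr ?_
  rintro _ ⟨l, s, hs, rfl⟩
  cases l with
  | nil => exact Submodule.mem_sup_left hs
  | cons a l => exact Submodule.mem_sup_right (K.lie_F_mem_lowerPart _ _ _)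

theorem lie_H_mem_lowerPart (x : K.loopCartan n) {w : V} (hw : w ∈ K.lowerPart n V) :
    ⁅K.inclCartan x, w⁆ ∈ K.lowerPart n V := by
  refine lie_mem_of_span ?_ hw
  rintro _ ⟨i, p, u, rfl⟩
  obtain ⟨t, ht⟩ := K.exists_lie_inclCartan_F x i
  rw [leibniz_lie, ht]
  exact add_mem (K.lie_F_mem_lowerPart _ _ _) (K.lie_F_mem_lowerPart _ _ _)

section

variable {K} {Ψ : Module.Dual ℂ (K.loopCartan n)} {v : V} (hv : K.IsHighestWeight Ψ v)

include hv

theorem IsHighestWeight.words_eq_top : K.words n (Submodule.span ℂ {v}) = ⊤ := by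
  obtain ⟨N, hN⟩ := K.exists_lieSubmodule_words (Submodule.span ℂ {v}) (n := n)
    (fun i p s hs => by
      obtain ⟨c, rfl⟩ := Submodule.mem_span_singleton.mp hs
      rw [lie_smul, hv.lie_E, smul_zero]
      exact zero_mem _)
    (fun x s hs => by
      obtain ⟨c, rfl⟩ := Submodule.mem_span_singleton.mp hs
      rw [lie_smul, hv.lie_H]
      exact Submodule.smul_mem _ _ (Submodule.smul_mem _ _ (Submodule.mem_span_singleton_self v)))
  have h : N = ⊤ := hv.gen N (by
    rw [← LieSubmodule.mem_toSubmodule, hN]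
    exact K.le_words _ (Submodule.mem_span_singleton_self v))
  rw [← hN, h]
  rfl

theorem IsHighestWeight.span_word :
    Submodule.span ℂ (Set.range fun l : List (ι × Laurent n) => K.word l v) = ⊤ := by
  rw [eq_top_iff, ← hv.words_eq_top]
  refine Submodule.span_le.mpr ?_
  rintro _ ⟨l, s, hs, rfl⟩
  obtain ⟨c, rfl⟩ := Submodule.mem_span_singleton.mp hs
  have : K.word l (c • v) = c • K.word l v := by
    induction l with
    | nil => rfl
    | cons a l ih => rw [word_cons, word_cons, ih, lie_smul]
  rw [this]
  exact Submodule.smul_mem _ _ (Submodule.subset_span ⟨l, rfl⟩)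

theorem IsHighestWeight.induction {W : Submodule ℂ V}
    (h : ∀ l : List (ι × Laurent n), K.word l v ∈ W) (w : V) : w ∈ W := by
  have h1 : w ∈ Submodule.span ℂ (Set.range fun l : List (ι × Laurent n) => K.word l v) :=
    hv.span_word ▸ Submodule.mem_top
  refine Submodule.span_le.mpr ?_ h1
  rintro _ ⟨l, rfl⟩
  exact h l

theorem IsHighestWeight.exists_eq_smul_add (w : V) :
    ∃ c : ℂ, ∃ u ∈ K.lowerPart n V, w = c • v + u := by
  have hw : w ∈ Submodule.span ℂ {v} ⊔ K.lowerPart n V :=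
    K.words_le _ (hv.words_eq_top ▸ Submodule.mem_top)
  obtain ⟨s, hs, u, hu, rfl⟩ := Submodule.mem_sup.mp hw
  obtain ⟨c, rfl⟩ := Submodule.mem_span_singleton.mp hs
  exact ⟨c, u, hu, rfl⟩

/-- The weight of a product of operators `p ⊗ f i` applied to `v`. -/
theorem IsHighestWeight.lie_const_word (x : K.cartan) (l : List (ι × Laurent n)) :
    ⁅const n (x : g), K.word l v⁆ =
      (Ψ (K.cartanConst n x) - (l.map fun a => K.root a.1 x).sum) • K.word l v := by
  induction l with
  | nil =>
    rw [← K.inclCartan_const]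
    simpa [word] using hv.lie_H (K.cartanConst n x)
  | cons a l ih =>
    rw [word_cons, leibniz_lie, ih, K.lie_const_F, neg_lie, smul_lie, lie_smul, List.map_cons,
      List.sum_cons]
    module

/-- A product of `k ≥ 1` operators `p ⊗ f i` applied to `v` is an eigenvector of `d` with eigenvalue
`Ψ(d) - k ≠ Ψ(d)`. A combination of such vectors is killed by a product of the corresponding linear
factors, none of which vanishes at `Ψ(d)`. -/
theorem IsHighestWeight.exists_polynomial {d : K.cartan} (hd : ∀ i, K.root i d = 1) {w : V}
    (hw : w ∈ K.lowerPart n V) : ∃ q : Polynomial ℂ,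
      Polynomial.aeval (LieModule.toEnd ℂ (loopAlg g n) V (const n (d : g))) q w = 0 ∧
        q.eval (Ψ (K.cartanConst n d)) ≠ 0 := by
  set D := LieModule.toEnd ℂ (loopAlg g n) V (const n (d : g)) with hD
  let W : Submodule ℂ V :=
    { carrier := {w | ∃ q : Polynomial ℂ, Polynomial.aeval D q w = 0 ∧
        q.eval (Ψ (K.cartanConst n d)) ≠ 0}
      zero_mem' := ⟨1, by simp, by simp⟩
      add_mem' := by
        rintro w w' ⟨q, h, hq⟩ ⟨q', h', hq'⟩
        refine ⟨q * q', ?_, ?_⟩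
        · rw [map_add]
          nth_rw 1 [mul_comm q q']
          rw [map_mul, map_mul, Module.End.mul_apply, Module.End.mul_apply, h, h', map_zero,
            map_zero, add_zero]
        · rw [Polynomial.eval_mul]
          exact mul_ne_zero hq hq'
      smul_mem' := by
        rintro c w ⟨q, h, hq⟩
        exact ⟨q, by rw [map_smul, h, smul_zero], hq⟩ }
  have hW : ∀ (i : ι) (p : Laurent n) (l : List (ι × Laurent n)), ⁅K.F i p, K.word l v⁆ ∈ W := by
    intro i p l
    have h := hv.lie_const_word d ((i, p) :: l)
    simp only [hd, List.map_const', List.sum_replicate, List.length_cons, nsmul_eq_mul,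
      mul_one] at h
    refine ⟨Polynomial.X - Polynomial.C (Ψ (K.cartanConst n d) - ((l.length + 1 : ℕ) : ℂ)), ?_, ?_⟩
    · rw [map_sub, Polynomial.aeval_X, Polynomial.aeval_C, LinearMap.sub_apply,
        Module.algebraMap_end_apply, hD, LieModule.toEnd_apply_apply, ← word_cons K (i, p), h,
        sub_self]
    · simp only [Polynomial.eval_sub, Polynomial.eval_X, Polynomial.eval_C, sub_sub_cancel]
      exact Nat.cast_ne_zero.mpr l.length.succ_ne_zero
  have h2 : K.lowerPart n V ≤ W := by
    refine Submodule.span_le.mpr ?_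
    rintro _ ⟨i, p, u, rfl⟩
    exact hv.induction (W := W.comap (LieModule.toEnd ℂ (loopAlg g n) V (K.F i p))) (hW i p) u
  exact h2 hw

theorem IsHighestWeight.aeval_apply {d : K.cartan} (q : Polynomial ℂ) :
    Polynomial.aeval (LieModule.toEnd ℂ (loopAlg g n) V (const n (d : g))) q v =
      q.eval (Ψ (K.cartanConst n d)) • v := by
  by_cases h0 : v = 0
  · simp [h0]
  · refine Module.End.aeval_apply_of_hasEigenvector ⟨?_, h0⟩
    rw [Module.End.mem_eigenspace_iff, LieModule.toEnd_apply_apply, ← K.inclCartan_const, hv.lie_H]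

/-- A polynomial in `d` that does not vanish at `Ψ(d)` acts on `v` by a nonzero scalar, so it cannot
kill `v`. -/
theorem IsHighestWeight.notMem_lowerPart (h0 : v ≠ 0) : v ∉ K.lowerPart n V := by
  intro h
  obtain ⟨d, hd⟩ := K.exists_grading
  obtain ⟨q, h1, h2⟩ := hv.exists_polynomial hd h
  rw [hv.aeval_apply] at h1
  exact (smul_ne_zero h2 h0) h1

/-- For `w = c v + u` in `N`, a polynomial in `d` that kills `u` sends `w` to a multiple of `v`
which is nonzero unless `c = 0`. -/
theorem IsHighestWeight.le_lowerPart {N : LieSubmodule ℂ (loopAlg g n) V} (hN : v ∉ N) :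
    N.toSubmodule ≤ K.lowerPart n V := by
  intro w hw
  obtain ⟨d, hd⟩ := K.exists_grading
  obtain ⟨c, u, hu, rfl⟩ := hv.exists_eq_smul_add w
  obtain ⟨q, h1, h2⟩ := hv.exists_polynomial hd hu
  have h3 : ∀ (q : Polynomial ℂ), ∀ w ∈ N,
      Polynomial.aeval (LieModule.toEnd ℂ (loopAlg g n) V (const n (d : g))) q w ∈ N := by
    intro q
    induction q using Polynomial.induction_on' with
    | add p q hp hq =>
      intro w hw
      rw [map_add]
      exact add_mem (hp w hw) (hq w hw)
    | monomial k a =>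
      intro w hw
      rw [Polynomial.aeval_monomial, Module.End.mul_apply, Module.algebraMap_end_apply]
      refine N.smul_mem a ?_
      induction k with
      | zero => exact hw
      | succ k ih =>
        rw [pow_succ', Module.End.mul_apply]
        exact N.lie_mem ih
  have h4 := h3 q _ hw
  rw [map_add, h1, add_zero, map_smul, hv.aeval_apply, smul_smul] at h4
  by_cases hc : c = 0
  · rwa [hc, zero_smul, zero_add]
  · refine absurd ?_ hN
    have := N.smul_mem (c * q.eval (Ψ (K.cartanConst n d)))⁻¹ h4
    rwa [smul_smul, inv_mul_cancel₀ (mul_ne_zero hc h2), one_smul] at this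

/-- In an irreducible highest weight module the vectors killed by `N⁺ ⊗ A` are the multiples of
the highest weight vector. -/
theorem IsHighestWeight.exists_eq_smul (h0 : v ≠ 0)
    (irr : ∀ N : LieSubmodule ℂ (loopAlg g n) V, N ≠ ⊤ → N = ⊥) {w : V}
    (hw : ∀ i p, ⁅K.E (n := n) i p, w⁆ = 0) : ∃ c : ℂ, w = c • v := by
  -- `S` consists of the vectors of the lower part that are killed by `N⁺ ⊗ A`. The submodule it
  -- generates is `U(N⁻ ⊗ A) S`, which stays in the lower part; it is therefore proper, hence zero.
  let S : Submodule ℂ V :=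
    { carrier := {w | w ∈ K.lowerPart n V ∧ ∀ i p, ⁅K.E (n := n) i p, w⁆ = 0}
      zero_mem' := ⟨zero_mem _, fun i p => lie_zero _⟩
      add_mem' := fun {w w'} h h' => ⟨add_mem h.1 h'.1, fun i p => by
        rw [lie_add, h.2, h'.2, add_zero]⟩
      smul_mem' := fun c w h => ⟨Submodule.smul_mem _ c h.1, fun i p => by
        rw [lie_smul, h.2, smul_zero]⟩ }
  obtain ⟨N, hN⟩ := K.exists_lieSubmodule_words S (n := n)
    (fun i p s hs => by rw [hs.2]; exact zero_mem _)
    (fun x s hs => ⟨K.lie_H_mem_lowerPart x hs.1, fun i p => by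
      obtain ⟨t, ht⟩ := K.exists_lie_inclCartan_E x i
      rw [leibniz_lie, ← lie_skew, ht, hs.2, lie_zero, neg_lie, hs.2, neg_zero, add_zero]⟩)
  have h1 : N = ⊥ := by
    refine irr N fun h => hv.notMem_lowerPart h0 ?_
    have h2 : v ∈ K.words n S := by
      rw [← hN, h]
      exact Submodule.mem_top
    refine (sup_le ?_ le_rfl : S ⊔ K.lowerPart n V ≤ K.lowerPart n V) (K.words_le S h2)
    exact fun s hs => hs.1
  obtain ⟨c, u, hu, rfl⟩ := hv.exists_eq_smul_add w
  have hu0 : u ∈ N := by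
    rw [← LieSubmodule.mem_toSubmodule, hN]
    refine K.le_words S ⟨hu, fun i p => ?_⟩
    have := hw i p
    rwa [lie_add, lie_smul, hv.lie_E, smul_zero, zero_add] at this
  rw [h1, LieSubmodule.mem_bot] at hu0
  exact ⟨c, by rw [hu0, add_zero]⟩

/-- A highest weight module is irreducible if the vectors killed by `N⁺ ⊗ A` are the multiples of
the highest weight vector. -/
theorem IsHighestWeight.irreducible
    (hs : ∀ w : V, (∀ i p, ⁅K.E (n := n) i p, w⁆ = 0) → ∃ c : ℂ, w = c • v)
    (N : LieSubmodule ℂ (loopAlg g n) V) (hN : N ≠ ⊤) : N = ⊥ := by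
  -- The filtration by word length, with strict inequality so that `fil 0 = 0` and `fil 1` is the
  -- line of `v`. The operators `p ⊗ e i` lower it by one, so by induction a vector of `N` in `fil
  -- (k + 1)` is killed by all of them, hence is a multiple of `v`; a nonzero multiple would force
  -- `N = ⊤`.
  let fil : ℕ → Submodule ℂ V := fun k =>
    Submodule.span ℂ {w | ∃ l : List (ι × Laurent n), l.length < k ∧ w = K.word l v}
  have hF : ∀ k i p, ∀ w ∈ fil k, ⁅K.F (n := n) i p, w⁆ ∈ fil (k + 1) := by
    intro k i p w hw
    refine lie_mem_of_span ?_ hw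
    rintro _ ⟨l, hl, rfl⟩
    exact Submodule.subset_span ⟨(i, p) :: l, by simpa using hl, rfl⟩
  have hH : ∀ k (x : K.loopCartan n), ∀ w ∈ fil k, ⁅K.inclCartan x, w⁆ ∈ fil k := by
    intro k x w hw
    refine lie_mem_of_span ?_ hw
    rintro _ ⟨l, hl, rfl⟩
    clear hw
    induction l generalizing k with
    | nil =>
      change ⁅K.inclCartan x, v⁆ ∈ _
      rw [hv.lie_H]
      exact Submodule.smul_mem _ _ (Submodule.subset_span ⟨[], hl, rfl⟩)
    | cons a l ih =>
      obtain ⟨k, rfl⟩ : ∃ k', k = k' + 1 := ⟨k - 1, by simp at hl; omega⟩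
      obtain ⟨t, ht⟩ := K.exists_lie_inclCartan_F x a.1
      rw [word_cons, leibniz_lie, ht]
      exact add_mem (Submodule.subset_span ⟨(a.1, t * a.2) :: l, hl, rfl⟩)
        (hF _ _ _ _ (ih k (by simpa using hl)))
  have hE : ∀ k i p, ∀ w ∈ fil (k + 1), ⁅K.E (n := n) i p, w⁆ ∈ fil k := by
    intro k i p w hw
    refine lie_mem_of_span ?_ hw
    rintro _ ⟨l, hl, rfl⟩
    clear hw
    induction l generalizing k with
    | nil =>
      change ⁅K.E (n := n) i p, v⁆ ∈ _
      rw [hv.lie_E]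
      exact zero_mem _
    | cons a l ih =>
      obtain ⟨k, rfl⟩ : ∃ k', k = k' + 1 := ⟨k - 1, by simp at hl; omega⟩
      rw [word_cons, leibniz_lie, K.lie_E_F]
      refine add_mem ?_ (hF _ _ _ _ (ih k (by simpa using hl)))
      split_ifs
      · exact hH _ _ _ (Submodule.subset_span ⟨l, by simpa using hl, rfl⟩)
      · rw [zero_lie]; exact zero_mem _
  have key : ∀ k, ∀ w ∈ fil k, w ∈ N → w = 0 := by
    intro k
    induction k with
    | zero =>
      intro w hw _
      have : fil 0 ≤ ⊥ := Submodule.span_le.mpr (by rintro _ ⟨l, hl, -⟩; simp at hl)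
      exact this hw
    | succ k ih =>
      intro w hw hwN
      obtain ⟨c, rfl⟩ := hs w fun i p => ih _ (hE k i p w hw) (N.lie_mem hwN)
      by_cases hc : c = 0
      · rw [hc, zero_smul]
      · refine absurd (hv.gen N ?_) hN
        have := N.smul_mem c⁻¹ hwN
        rwa [smul_smul, inv_mul_cancel₀ hc, one_smul] at this
  have hmono : Monotone fil := fun a b hab => Submodule.span_mono (by
    rintro _ ⟨l, hl, rfl⟩; exact ⟨l, hl.trans_le hab, rfl⟩)
  have htop : (⨆ k, fil k) = ⊤ := by
    rw [eq_top_iff]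
    intro w _
    refine hv.induction (fun l => Submodule.mem_iSup_of_mem (l.length + 1) ?_) w
    exact Submodule.subset_span ⟨l, Nat.lt_succ_self _, rfl⟩
  rw [LieSubmodule.eq_bot_iff]
  intro w hw
  have hwt : w ∈ ⨆ k, fil k := htop ▸ Submodule.mem_top
  obtain ⟨k, hk⟩ := (Submodule.mem_iSup_of_directed fil hmono.directed_le).mp hwt
  exact key k w hk hw

end

end KacMoody

/-! ### Annihilation of irreducible modules by `g' ⊗ killer Ψ` -/

section

variable {g : Type*} [LieRing g] [LieAlgebra ℂ g] {n : ℕ}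

theorem loopElt_add (p q : Laurent n) (x : derived g) :
    loopElt (p + q) x = loopElt p x + loopElt q x :=
  Subtype.ext (TensorProduct.add_tmul p q (x : g))

theorem loopElt_add' (p : Laurent n) (x y : derived g) :
    loopElt p (x + y) = loopElt p x + loopElt p y :=
  Subtype.ext (TensorProduct.tmul_add p (x : g) y)

theorem lie_loopElt_loopElt (p q : Laurent n) (x y : derived g) :
    ⁅loopElt p x, loopElt q y⁆ = loopElt (p * q) ⁅x, y⁆ :=
  Subtype.ext (LieAlgebra.ExtendScalars.bracket_tmul ℂ (Laurent n) g g p q (x : g) (y : g))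

theorem lie_const_loopElt (p : Laurent n) (x : g) (y : derived g) :
    ⁅const n x, loopElt p y⁆ = loopElt p ⟨⁅x, (y : g)⁆, lie_mem_right ℂ g _ x y y.2⟩ :=
  Subtype.ext (by
    change ⁅(1 : Laurent n) ⊗ₜ[ℂ] x, p ⊗ₜ[ℂ] (y : g)⁆ = p ⊗ₜ[ℂ] ⁅x, (y : g)⁆
    rw [LieAlgebra.ExtendScalars.bracket_tmul, one_mul])

theorem loopElt_mem_of_mem_lieSpan {s : Set g} {S : LieSubalgebra ℂ (loopAlg g n)}
    (hs : ∀ (x : derived g), (x : g) ∈ s → ∀ p, loopElt p x ∈ S) (hsd : s ⊆ derived g)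
    {x : derived g} (hx : (x : g) ∈ LieSubalgebra.lieSpan ℂ g s) (p : Laurent n) :
    loopElt p x ∈ S := by
  have h := KacMoody.tmul_mem_of_mem_lieSpan (T := S.map (loopAlg g n).incl)
    (fun x hx p => ⟨loopElt p ⟨x, hsd hx⟩, hs _ hx p, rfl⟩) hx p
  obtain ⟨y, hy, h⟩ := h
  rwa [← Subtype.ext (show (y : Laurent n ⊗[ℂ] g) = loopElt p x from h)]

end

namespace KacMoody

variable {ι g : Type*} [Fintype ι] [DecidableEq ι] {C : Matrix ι ι ℤ} [LieRing g] [LieAlgebra ℂ g]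
  (K : KacMoody C g) {n : ℕ}

theorem cartanElt_add (p q : Laurent n) (x : K.cartan') :
    K.cartanElt (p + q) x = K.cartanElt p x + K.cartanElt q x :=
  Subtype.ext (TensorProduct.add_tmul p q (x : g))

theorem inclCartan_cartanElt (p : Laurent n) (x : K.cartan') :
    K.inclCartan (K.cartanElt p x) = loopElt p (⟨(x : g), x.2.2⟩ : derived g) := rfl

/-- The largest ideal `I ⊆ A` with `Ψ(𝔥' ⊗ I) = 0`. -/
def killer (Ψ : Module.Dual ℂ (K.loopCartan n)) : Ideal (Laurent n) where
  carrier := {a | ∀ b x, Ψ (K.cartanElt (b * a) x) = 0}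
  add_mem' := fun {a a'} h h' b x => by rw [mul_add, cartanElt_add, map_add, h, h', add_zero]
  zero_mem' := fun b x => by
    rw [mul_zero, show K.cartanElt (0 : Laurent n) x = 0 from
      Subtype.ext (TensorProduct.zero_tmul _ _), map_zero]
  smul_mem' := fun c a h b x => by
    rw [smul_eq_mul, ← mul_assoc]; exact h _ _

section

variable {V : Type*} [AddCommGroup V] [Module ℂ V]
  [LieRingModule (loopAlg g n) V] [LieModule ℂ (loopAlg g n) V]

variable {K} {Ψ : Module.Dual ℂ (K.loopCartan n)} {v : V}

/-- On `v` itself, the `N⁻`-part of `x` maps into the lower part, the `𝔥'`-part acts by `Ψ(𝔥' ⊗ p) =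
0`, and the `N⁺`-part kills `v`. On longer words, commuting past `q ⊗ f i` costs a term whose
coefficient is still in the ideal. -/
theorem IsHighestWeight.loopElt_mem_lowerPart (hv : K.IsHighestWeight Ψ v) {p : Laurent n}
    (hp : p ∈ K.killer Ψ) (x : derived g) (w : V) : ⁅loopElt p x, w⁆ ∈ K.lowerPart n V := by
  have hvp : ∀ p ∈ K.killer Ψ, ∀ x : derived g, ⁅loopElt p x, v⁆ ∈ K.lowerPart n V := by
    intro p hp ⟨x, hx⟩
    obtain ⟨a, ha, h, hh, b, hb, rfl⟩ := K.exists_triangular_derived hx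
    have e1 : loopElt p (⟨a + (h + b), hx⟩ : derived g) =
        loopElt p ⟨a, K.nneg_le_derived ha⟩ + (K.inclCartan (K.cartanElt p ⟨h, hh⟩) +
          loopElt p ⟨b, K.npos_le_derived hb⟩) := by
      rw [inclCartan_cartanElt, ← loopElt_add', ← loopElt_add']
      rfl
    rw [e1, add_lie, add_lie, hv.lie_H, show Ψ (K.cartanElt p ⟨h, hh⟩) = 0 by
      have := hp 1 ⟨h, hh⟩; rwa [one_mul] at this, zero_smul, zero_add]
    let Sn : LieSubalgebra ℂ (loopAlg g n) :=
      { carrier := {y | ∀ w : V, ⁅y, w⁆ ∈ K.lowerPart n V}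
        add_mem' := fun {y z} hy hz w => by rw [add_lie]; exact add_mem (hy w) (hz w)
        zero_mem' := fun w => by rw [zero_lie]; exact zero_mem _
        smul_mem' := fun c y hy w => by rw [smul_lie]; exact Submodule.smul_mem _ c (hy w)
        lie_mem' := fun {y z} hy hz w => by rw [lie_lie]; exact sub_mem (hy _) (hz _) }
    let Sp : LieSubalgebra ℂ (loopAlg g n) :=
      { carrier := {y | ⁅y, v⁆ = 0}
        add_mem' := fun {y z} hy hz => by
          simp only [Set.mem_ofPred_eq] at *; rw [add_lie, hy, hz, add_zero]
        zero_mem' := by simp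
        smul_mem' := fun c y hy => by
          simp only [Set.mem_ofPred_eq] at *; rw [smul_lie, hy, smul_zero]
        lie_mem' := fun {y z} hy hz => by
          change ⁅⁅y, z⁆, v⁆ = 0
          rw [lie_lie, show ⁅z, v⁆ = 0 from hz, show ⁅y, v⁆ = 0 from hy, lie_zero, lie_zero,
            sub_zero] }
    have h1 : loopElt p (⟨a, K.nneg_le_derived ha⟩ : derived g) ∈ Sn :=
      loopElt_mem_of_mem_lieSpan (s := Set.range K.f) (x := ⟨a, K.nneg_le_derived ha⟩)
        (by rintro ⟨_, h⟩ ⟨i, rfl⟩ p; exact fun w => K.lie_F_mem_lowerPart i p w)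
        (by rintro _ ⟨i, rfl⟩; exact K.f_mem_derived i) ha p
    have h2 : loopElt p (⟨b, K.npos_le_derived hb⟩ : derived g) ∈ Sp :=
      loopElt_mem_of_mem_lieSpan (s := Set.range K.e) (x := ⟨b, K.npos_le_derived hb⟩)
        (by rintro ⟨_, h⟩ ⟨i, rfl⟩ p; exact hv.lie_E i p)
        (by rintro _ ⟨i, rfl⟩; exact K.e_mem_derived i) hb p
    rw [show ⁅loopElt p (⟨b, K.npos_le_derived hb⟩ : derived g), v⁆ = 0 from h2, add_zero]
    exact h1 v
  refine hv.induction (W := (K.lowerPart n V).comap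
    (LieModule.toEnd ℂ (loopAlg g n) V (loopElt p x))) (fun l => ?_) w
  rw [Submodule.mem_comap, LieModule.toEnd_apply_apply]
  induction l generalizing p x with
  | nil => exact hvp p hp x
  | cons a l ih =>
    rw [word_cons, leibniz_lie]
    refine add_mem ?_ (K.lie_F_mem_lowerPart _ _ _)
    rw [F, lie_loopElt_loopElt]
    exact ih (Ideal.mul_mem_right _ _ hp) _

/-- In an irreducible highest weight module of weight `Ψ`, the elements `p ⊗ x` with `x ∈ g'` and
`Ψ(𝔥' ⊗ Ap) = 0` act by zero. -/
theorem IsHighestWeight.lie_loopElt_eq_zero (hv : K.IsHighestWeight Ψ v) (h0 : v ≠ 0)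
    (irr : ∀ N : LieSubmodule ℂ (loopAlg g n) V, N ≠ ⊤ → N = ⊥) {p : Laurent n}
    (hp : p ∈ K.killer Ψ) (x : derived g) (w : V) : ⁅loopElt p x, w⁆ = 0 := by
  -- The space `(g' ⊗ I) V` with `I = killer Ψ`. It is a submodule because `I` is an ideal of `A`
  -- and `g'` an ideal of `g`, and it is proper because it lies in the lower part.
  let W : Submodule ℂ V := Submodule.span ℂ
    {u | ∃ p ∈ K.killer Ψ, ∃ (x : derived g) (w : V), u = ⁅loopElt p x, w⁆}
  have hmem : ∀ p ∈ K.killer Ψ, ∀ (x : derived g) (w : V), ⁅loopElt p x, w⁆ ∈ W :=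
    fun p hp x w => Submodule.subset_span ⟨p, hp, x, w, rfl⟩
  have hloop : ∀ (q : Laurent n) (y : derived g), ∀ w ∈ W, ⁅loopElt q y, w⁆ ∈ W := by
    intro q y w hw
    refine lie_mem_of_span ?_ hw
    rintro _ ⟨p, hp, x, u, rfl⟩
    rw [leibniz_lie, lie_loopElt_loopElt]
    exact add_mem (hmem _ (Ideal.mul_mem_left _ _ hp) _ _) (hmem _ hp _ _)
  obtain ⟨N, hN⟩ := K.exists_lieSubmodule (n := n) W (fun i q => hloop q _) (fun i q => hloop q _)
    (by
      intro h
      induction h using K.loopCartan_induction with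
      | elt q y => exact hloop q ⟨(y : g), y.2.2⟩
      | const y =>
        intro w hw
        refine lie_mem_of_span ?_ hw
        rintro _ ⟨p, hp, x, u, rfl⟩
        rw [leibniz_lie, inclCartan_const, lie_const_loopElt]
        exact add_mem (hmem _ hp _ _) (hmem _ hp _ _)
      | add y z hy hz =>
        intro w hw
        rw [inclCartan_add, add_lie]
        exact add_mem (hy w hw) (hz w hw))
  have hW : W ≤ K.lowerPart n V := by
    refine Submodule.span_le.mpr ?_
    rintro _ ⟨p, hp, x, u, rfl⟩
    exact hv.loopElt_mem_lowerPart hp x u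
  have h1 : N = ⊥ := by
    refine irr N fun h => hv.notMem_lowerPart h0 (hW ?_)
    rw [← hN, h]
    exact Submodule.mem_top
  have h2 := hmem p hp x w
  rwa [← hN, h1, LieSubmodule.bot_toSubmodule, Submodule.mem_bot] at h2

end

/-! ### Tensor products -/

section

variable {K} {Ψ₁ Ψ₂ : Module.Dual ℂ (K.loopCartan n)} {V₁ V₂ : Type*}
  [AddCommGroup V₁] [Module ℂ V₁] [LieRingModule (loopAlg g n) V₁] [LieModule ℂ (loopAlg g n) V₁]
  [AddCommGroup V₂] [Module ℂ V₂] [LieRingModule (loopAlg g n) V₂] [LieModule ℂ (loopAlg g n) V₂]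
  {v₁ : V₁} {v₂ : V₂}

/-- In coordinates with respect to a basis of `V₂`, the hypothesis says that every coefficient in
`V₁` is killed by all `T j`, hence is a multiple of `v₁`. -/
theorem exists_tmul_of_rTensor {J : Type*} (T : J → Module.End ℂ V₁)
    (hT : ∀ w, (∀ j, T j w = 0) → ∃ c : ℂ, w = c • v₁) {t : V₁ ⊗[ℂ] V₂}
    (ht : ∀ j, LinearMap.rTensor V₂ (T j) t = 0) : ∃ w, t = v₁ ⊗ₜ w := by
  classical
  let b := Module.Basis.ofVectorSpace ℂ V₂
  let e := TensorProduct.equivFinsuppOfBasisRight (M := V₁) b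
  have he : ∀ j t, e (LinearMap.rTensor V₂ (T j) t) = (e t).mapRange (T j) (map_zero _) := by
    intro j t
    induction t with
    | zero => simp
    | add s t hs ht =>
      rw [map_add, map_add, hs, ht, map_add]
      ext; simp
    | tmul x y =>
      ext k
      simp [e, TensorProduct.equivFinsuppOfBasisRight_apply_tmul]
  have h1 : ∀ k, ∃ c : ℂ, e t k = c • v₁ := by
    intro k
    refine hT _ fun j => ?_
    have := he j t
    rw [ht j, map_zero] at this
    exact (DFunLike.congr_fun this k).symm
  choose c hc using h1
  have h2 : t = e.symm (e t) := (e.symm_apply_apply t).symm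
  rw [h2]
  refine ⟨(e t).sum fun k _ => c k • b k, ?_⟩
  rw [TensorProduct.equivFinsuppOfBasisRight_symm_apply, Finsupp.sum, Finsupp.sum,
    TensorProduct.tmul_sum]
  refine Finset.sum_congr rfl fun k _ => ?_
  rw [hc, TensorProduct.smul_tmul]

theorem eq_zero_of_tmul_eq_zero (h : v₁ ≠ 0) {w : V₂} (hw : v₁ ⊗ₜ[ℂ] w = 0) : w = 0 := by
  obtain ⟨f, hf⟩ : ∃ f : Module.Dual ℂ V₁, f v₁ ≠ 0 := by
    by_contra! hf
    exact h ((Module.forall_dual_apply_eq_zero_iff ℂ v₁).mp hf)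
  have := congrArg (TensorProduct.lid ℂ V₂ ∘ LinearMap.rTensor V₂ f) hw
  simp only [Function.comp_apply, LinearMap.rTensor_tmul, TensorProduct.lid_tmul, map_zero] at this
  exact (smul_eq_zero.mp this).resolve_left hf

/-- If `Ψ₁` and `Ψ₂` are supported on comaximal ideals, then the tensor product of irreducible
highest weight modules of weights `Ψ₁` and `Ψ₂` is an irreducible highest weight module. -/
theorem IsHighestWeight.tmul (hv₁ : K.IsHighestWeight Ψ₁ v₁) (hv₂ : K.IsHighestWeight Ψ₂ v₂)
    (h1 : v₁ ≠ 0) (h2 : v₂ ≠ 0)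
    (irr₁ : ∀ N : LieSubmodule ℂ (loopAlg g n) V₁, N ≠ ⊤ → N = ⊥)
    (irr₂ : ∀ N : LieSubmodule ℂ (loopAlg g n) V₂, N ≠ ⊤ → N = ⊥)
    (hI : IsCoprime (K.killer Ψ₁) (K.killer Ψ₂)) :
    K.IsHighestWeight (Ψ₁ + Ψ₂) (v₁ ⊗ₜ[ℂ] v₂) ∧ v₁ ⊗ₜ[ℂ] v₂ ≠ 0 ∧
      ∀ N : LieSubmodule ℂ (loopAlg g n) (V₁ ⊗[ℂ] V₂), N ≠ ⊤ → N = ⊥ := by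
  -- As `a₁ + a₂ = 1`, the factor `a₂` switches off the action on `V₂` and leaves that on `V₁`
  -- unchanged; `a₁` does the opposite. So the operators `X ⊗ 1` and `1 ⊗ X` on the tensor product
  -- both come from `g_A`.
  obtain ⟨a₁, ha₁, a₂, ha₂, ha⟩ := Ideal.isCoprime_iff_exists.mp hI
  have hz₁ : ∀ p (x : derived g) (w : V₁), ⁅loopElt (a₁ * p) x, w⁆ = 0 := fun p x w =>
    hv₁.lie_loopElt_eq_zero h1 irr₁ (Ideal.mul_mem_right _ _ ha₁) x w
  have hz₂ : ∀ p (x : derived g) (w : V₂), ⁅loopElt (a₂ * p) x, w⁆ = 0 := fun p x w =>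
    hv₂.lie_loopElt_eq_zero h2 irr₂ (Ideal.mul_mem_right _ _ ha₂) x w
  have hsplit : ∀ p (x : derived g), loopElt p x = loopElt (a₁ * p) x + loopElt (a₂ * p) x :=
    fun p x => by rw [← loopElt_add, ← add_mul, ha, one_mul]
  have hi₁ : ∀ p (x : derived g) (w : V₁), ⁅loopElt (a₂ * p) x, w⁆ = ⁅loopElt p x, w⁆ :=
    fun p x w => by rw [hsplit p, add_lie, hz₁, zero_add]
  have hi₂ : ∀ p (x : derived g) (w : V₂), ⁅loopElt (a₁ * p) x, w⁆ = ⁅loopElt p x, w⁆ :=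
    fun p x w => by rw [hsplit p, add_lie, hz₂, add_zero]
  have hl : ∀ p (x : derived g) (w₁ : V₁) (w₂ : V₂),
      ⁅loopElt (a₂ * p) x, w₁ ⊗ₜ[ℂ] w₂⁆ = ⁅loopElt p x, w₁⁆ ⊗ₜ w₂ := fun p x w₁ w₂ => by
    rw [TensorProduct.LieModule.lie_tmul_right, hz₂, hi₁, TensorProduct.tmul_zero, add_zero]
  have hr : ∀ p (x : derived g) (w₁ : V₁) (w₂ : V₂),
      ⁅loopElt (a₁ * p) x, w₁ ⊗ₜ[ℂ] w₂⁆ = w₁ ⊗ₜ ⁅loopElt p x, w₂⁆ := fun p x w₁ w₂ => by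
    rw [TensorProduct.LieModule.lie_tmul_right, hz₁, hi₂, TensorProduct.zero_tmul, zero_add]
  have hne : v₁ ⊗ₜ[ℂ] v₂ ≠ 0 := fun h => h2 (eq_zero_of_tmul_eq_zero h1 h)
  have hhw : K.IsHighestWeight (Ψ₁ + Ψ₂) (v₁ ⊗ₜ[ℂ] v₂) := by
    refine ⟨fun i p => ?_, fun x => ?_, fun N hN => ?_⟩
    · rw [TensorProduct.LieModule.lie_tmul_right, hv₁.lie_E, hv₂.lie_E, TensorProduct.zero_tmul,
        TensorProduct.tmul_zero, add_zero]
    · rw [TensorProduct.LieModule.lie_tmul_right, hv₁.lie_H, hv₂.lie_H, TensorProduct.tmul_smul,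
        ← TensorProduct.smul_tmul', ← add_smul, LinearMap.add_apply]
    · have s1 : ∀ w₁ : V₁, w₁ ⊗ₜ v₂ ∈ N := by
        intro w₁
        refine hv₁.induction (W := N.toSubmodule.comap ((TensorProduct.mk ℂ V₁ V₂).flip v₂))
          (fun l => ?_) w₁
        induction l with
        | nil => exact hN
        | cons a l ih =>
          have := N.lie_mem (x := loopElt (a₂ * a.2) ⟨K.f a.1, K.f_mem_derived a.1⟩) ih
          rw [LinearMap.flip_apply, TensorProduct.mk_apply, hl] at this
          exact this
      have s2 : ∀ (w₁ : V₁) (w₂ : V₂), w₁ ⊗ₜ w₂ ∈ N := by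
        intro w₁ w₂
        refine hv₂.induction (W := N.toSubmodule.comap (TensorProduct.mk ℂ V₁ V₂ w₁))
          (fun l => ?_) w₂
        induction l with
        | nil => exact s1 w₁
        | cons a l ih =>
          have := N.lie_mem (x := loopElt (a₁ * a.2) ⟨K.f a.1, K.f_mem_derived a.1⟩) ih
          rw [TensorProduct.mk_apply, hr] at this
          exact this
      rw [← LieSubmodule.toSubmodule_eq_top, eq_top_iff, ← TensorProduct.span_tmul_eq_top]
      refine Submodule.span_le.mpr ?_
      rintro _ ⟨w₁, w₂, rfl⟩
      exact s2 w₁ w₂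
  refine ⟨hhw, hne, hhw.irreducible fun t ht => ?_⟩
  have e1 : ∀ p (x : derived g) (t : V₁ ⊗[ℂ] V₂), LinearMap.rTensor V₂
      (LieModule.toEnd ℂ (loopAlg g n) V₁ (loopElt p x)) t = ⁅loopElt (a₂ * p) x, t⁆ := by
    intro p x t
    induction t with
    | zero => simp
    | add s t hs ht => rw [map_add, hs, ht, lie_add]
    | tmul w₁ w₂ => rw [hl]; rfl
  -- A vector killed by `N⁺ ⊗ A` is killed by its action on the first factor alone, hence has the
  -- form `v₁ ⊗ w`. The action on the second factor then forces `w` to be a multiple of `v₂`.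
  obtain ⟨w, rfl⟩ := exists_tmul_of_rTensor (v₁ := v₁)
    (fun j : ι × Laurent n => LieModule.toEnd ℂ (loopAlg g n) V₁ (K.E j.1 j.2))
    (fun w hw => hv₁.exists_eq_smul h1 irr₁ fun i p => hw (i, p))
    (t := t) (fun j => by rw [E, e1]; exact ht j.1 _)
  obtain ⟨c, rfl⟩ := hv₂.exists_eq_smul h2 irr₂ (w := w) fun i p => by
    have h3 := ht i (a₁ * p)
    rw [E, hr] at h3
    exact eq_zero_of_tmul_eq_zero h1 h3
  exact ⟨c, TensorProduct.tmul_smul _ _ _⟩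

end

end KacMoody

/-! ### `M(Ψ)` and `V(Ψ)` as highest weight modules -/

section

variable (L M : Type*) [LieRing L] [LieAlgebra ℂ L] [AddCommGroup M] [Module ℂ M]
  [Module (UniversalEnvelopingAlgebra ℂ L) M] [IsScalarTower ℂ (UniversalEnvelopingAlgebra ℂ L) M]

/-- A module over the enveloping algebra as a module over the Lie algebra. -/
abbrev envLieRingModule : LieRingModule L M where
  bracket x m := UniversalEnvelopingAlgebra.ι ℂ x • m
  add_lie x y m := by
    rw [map_add, add_smul]
  lie_add x m m' := smul_add _ _ _
  leibniz_lie x y m := by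
    change UniversalEnvelopingAlgebra.ι ℂ x • UniversalEnvelopingAlgebra.ι ℂ y • m =
      UniversalEnvelopingAlgebra.ι ℂ ⁅x, y⁆ • m +
        UniversalEnvelopingAlgebra.ι ℂ y • UniversalEnvelopingAlgebra.ι ℂ x • m
    rw [LieHom.map_lie, LieRing.of_associative_ring_bracket, sub_smul, mul_smul, mul_smul,
      sub_add_cancel]

theorem envLieModule : letI := envLieRingModule L M; LieModule ℂ L M :=
  letI := envLieRingModule L M
  { smul_lie := fun c x m => by
      change UniversalEnvelopingAlgebra.ι ℂ (c • x) • m = c • (UniversalEnvelopingAlgebra.ι ℂ x • m)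
      rw [map_smul, smul_assoc]
    lie_smul := fun c x m => by
      change UniversalEnvelopingAlgebra.ι ℂ x • (c • m) = c • (UniversalEnvelopingAlgebra.ι ℂ x • m)
      rw [← algebraMap_smul (UniversalEnvelopingAlgebra ℂ L) c m, ← mul_smul,
        ← Algebra.commutes, mul_smul, algebraMap_smul] }

variable {L M} in
theorem env_smul_mem {W : Submodule ℂ M}
    (h : ∀ (x : L), ∀ w ∈ W, UniversalEnvelopingAlgebra.ι ℂ x • w ∈ W)
    (u : UniversalEnvelopingAlgebra ℂ L) {w : M} (hw : w ∈ W) : u • w ∈ W := by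
  let S : Submodule ℂ (UniversalEnvelopingAlgebra ℂ L) :=
    { carrier := {u | ∀ w ∈ W, u • w ∈ W}
      add_mem' := fun {u u'} hu hu' w hw => by rw [add_smul]; exact add_mem (hu w hw) (hu' w hw)
      zero_mem' := fun w _ => by rw [zero_smul]; exact zero_mem _
      smul_mem' := fun c u hu w hw => by rw [smul_assoc]; exact W.smul_mem c (hu w hw) }
  have : S = ⊤ := enveloping_submodule_eq_top S (fun w hw => by rwa [one_smul])
    (fun x u hu w hw => by rw [mul_smul]; exact h x _ (hu w hw))
  exact (this ▸ Submodule.mem_top : u ∈ S) w hw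

end

namespace KacMoody

variable {ι g : Type*} [Fintype ι] [DecidableEq ι] {C : Matrix ι ι ℤ} [LieRing g] [LieAlgebra ℂ g]
  (K : KacMoody C g) {n : ℕ} (Ψ : Module.Dual ℂ (K.loopCartan n))

instance : LieRingModule (loopAlg g n) (K.verma Ψ) := envLieRingModule _ _

instance : LieModule ℂ (loopAlg g n) (K.verma Ψ) := envLieModule _ _

instance : LieRingModule (loopAlg g n) (K.simpleMod Ψ) := envLieRingModule _ _

instance : LieModule ℂ (loopAlg g n) (K.simpleMod Ψ) := envLieModule _ _

/-- The generator of `M(Ψ)`. -/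
def vermaGen : K.verma Ψ := (K.vermaIdeal Ψ).mkQ 1

/-- The generator of `V(Ψ)`. -/
def simpleGen : K.simpleMod Ψ := (K.maxSub Ψ).mkQ (K.vermaGen Ψ)

theorem act_eq_lie (x : loopAlg g n) (v : K.simpleMod Ψ) : K.act x v = ⁅x, v⁆ := rfl

theorem verma_lie_mk (x : loopAlg g n) :
    ⁅x, K.vermaGen Ψ⁆ = (K.vermaIdeal Ψ).mkQ (UniversalEnvelopingAlgebra.ι ℂ x) := by
  change UniversalEnvelopingAlgebra.ι ℂ x • (K.vermaIdeal Ψ).mkQ 1 = _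
  rw [← map_smul, smul_eq_mul, mul_one]

theorem vermaGen_ne_zero : K.vermaGen Ψ ≠ 0 := by
  intro h
  rw [vermaGen, Submodule.mkQ_apply, Submodule.Quotient.mk_eq_zero] at h
  exact K.one_notMem_vermaIdeal Ψ h

theorem verma_isHighestWeight : K.IsHighestWeight Ψ (K.vermaGen Ψ) := by
  refine ⟨fun i p => ?_, fun x => ?_, fun N hN => ?_⟩
  · rw [verma_lie_mk, Submodule.mkQ_apply, Submodule.Quotient.mk_eq_zero]
    exact Submodule.subset_span (Or.inl ⟨_, tmul_mem_loops p (K.e_mem_npos i), rfl⟩)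
  · rw [verma_lie_mk, vermaGen, ← algebraMap_smul (UniversalEnvelopingAlgebra ℂ (loopAlg g n)) (Ψ x),
      ← map_smul, ← sub_eq_zero, ← map_sub, smul_eq_mul, mul_one, Submodule.mkQ_apply,
      Submodule.Quotient.mk_eq_zero]
    exact Submodule.subset_span (Or.inr ⟨x, rfl⟩)
  · rw [← LieSubmodule.toSubmodule_eq_top, eq_top_iff]
    intro w _
    obtain ⟨u, rfl⟩ := Submodule.mkQ_surjective _ w
    have := env_smul_mem (W := N.toSubmodule) (fun x w hw => N.lie_mem (x := x) hw) u hN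
    rwa [vermaGen, ← map_smul, smul_eq_mul, mul_one] at this

/-- Every proper submodule misses the generator and so lies in the fixed subspace `lowerPart`.
Therefore the sum of all of them also lies there and is again proper. -/
theorem maxSub_le {w : K.verma Ψ} (hw : w ∈ K.maxSub Ψ) : w ∈ K.lowerPart n (K.verma Ψ) := by
  rw [maxSub, sSup_eq_iSup'] at hw
  refine Submodule.iSup_induction _ (motive := fun w => w ∈ K.lowerPart n (K.verma Ψ)) hw ?_
    (zero_mem _) (fun _ _ => add_mem)
  rintro ⟨N, hN⟩ w hw
  let N' : LieSubmodule ℂ (loopAlg g n) (K.verma Ψ) :=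
    { N.restrictScalars ℂ with lie_mem := fun {x w} hw => N.smul_mem _ hw }
  refine (K.verma_isHighestWeight Ψ).le_lowerPart (N := N') (fun h => hN ?_) hw
  have h1 := (K.verma_isHighestWeight Ψ).gen N' h
  rw [eq_top_iff]
  intro u _
  exact (h1 ▸ LieSubmodule.mem_top u : u ∈ N')

theorem vermaGen_notMem_maxSub : K.vermaGen Ψ ∉ K.maxSub Ψ := fun h =>
  (K.verma_isHighestWeight Ψ).notMem_lowerPart (K.vermaGen_ne_zero Ψ) (K.maxSub_le Ψ h)

theorem simpleGen_ne_zero : K.simpleGen Ψ ≠ 0 := by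
  intro h
  rw [simpleGen, Submodule.mkQ_apply, Submodule.Quotient.mk_eq_zero] at h
  exact K.vermaGen_notMem_maxSub Ψ h

theorem lie_mkQ (x : loopAlg g n) (w : K.verma Ψ) :
    ⁅x, (K.maxSub Ψ).mkQ w⁆ = (K.maxSub Ψ).mkQ ⁅x, w⁆ := (map_smul _ _ _).symm

theorem simple_isHighestWeight : K.IsHighestWeight Ψ (K.simpleGen Ψ) := by
  refine ⟨fun i p => ?_, fun x => ?_, fun N hN => ?_⟩
  · rw [simpleGen, lie_mkQ, (K.verma_isHighestWeight Ψ).lie_E, map_zero]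
  · rw [simpleGen, lie_mkQ, (K.verma_isHighestWeight Ψ).lie_H]
    rfl
  · rw [← LieSubmodule.toSubmodule_eq_top, eq_top_iff]
    intro w _
    obtain ⟨w, rfl⟩ := Submodule.mkQ_surjective _ w
    obtain ⟨u, rfl⟩ := Submodule.mkQ_surjective _ w
    have := env_smul_mem (W := N.toSubmodule) (fun x w hw => N.lie_mem (x := x) hw) u hN
    rwa [simpleGen, vermaGen, ← map_smul, ← map_smul, smul_eq_mul, mul_one] at this

theorem simple_irreducible (N : LieSubmodule ℂ (loopAlg g n) (K.simpleMod Ψ)) (hN : N ≠ ⊤) :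
    N = ⊥ := by
  let N' : Submodule (UniversalEnvelopingAlgebra ℂ (loopAlg g n)) (K.simpleMod Ψ) :=
    { N with
      smul_mem' := fun u w hw =>
        env_smul_mem (W := N.toSubmodule) (fun x w hw => N.lie_mem (x := x) hw) u hw }
  have h1 : N'.comap (K.maxSub Ψ).mkQ ≤ K.maxSub Ψ := by
    refine le_sSup fun h => hN ?_
    refine (K.simple_isHighestWeight Ψ).gen N ?_
    have : K.vermaGen Ψ ∈ N'.comap (K.maxSub Ψ).mkQ := h ▸ Submodule.mem_top
    exact this
  rw [LieSubmodule.eq_bot_iff]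
  intro w hw
  obtain ⟨w, rfl⟩ := Submodule.mkQ_surjective _ w
  rw [Submodule.mkQ_apply, Submodule.Quotient.mk_eq_zero]
  exact h1 hw

variable {K Ψ} in
/-- Every irreducible highest weight module of weight `Ψ` is isomorphic to `V(Ψ)`. -/
theorem IsHighestWeight.exists_equiv {V : Type*} [AddCommGroup V] [Module ℂ V]
    [LieRingModule (loopAlg g n) V] [LieModule ℂ (loopAlg g n) V] {v : V}
    (hv : K.IsHighestWeight Ψ v) (h0 : v ≠ 0)
    (irr : ∀ N : LieSubmodule ℂ (loopAlg g n) V, N ≠ ⊤ → N = ⊥) :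
    ∃ E : K.simpleMod Ψ ≃ₗ[ℂ] V, ∀ x w, E (K.act x w) = ⁅x, E w⁆ := by
  let U := UniversalEnvelopingAlgebra ℂ (loopAlg g n)
  let R : U →ₐ[ℂ] Module.End ℂ V :=
    UniversalEnvelopingAlgebra.lift ℂ (LieModule.toEnd ℂ (loopAlg g n) V)
  have hR : ∀ x, R (UniversalEnvelopingAlgebra.ι ℂ x) = LieModule.toEnd ℂ (loopAlg g n) V x :=
    UniversalEnvelopingAlgebra.lift_ι_apply ℂ _
  let : Module U V := Module.compHom V R.toRingHom
  have hsm : ∀ (u : U) (w : V), u • w = R u w := fun _ _ => rfl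
  have : IsScalarTower ℂ U V := ⟨fun c u w => by rw [hsm, map_smul]; rfl⟩
  have hlie : ∀ (x : loopAlg g n) (w : V), UniversalEnvelopingAlgebra.ι ℂ x • w = ⁅x, w⁆ :=
    fun x w => by rw [hsm, hR]; rfl
  let f₀ : U →ₗ[U] V := LinearMap.toSpanSingleton U V v
  have hf₀ : K.vermaIdeal Ψ ≤ LinearMap.ker f₀ := by
    refine Submodule.span_le.mpr ?_
    rintro u (⟨x, hx, rfl⟩ | ⟨x, rfl⟩)
    · change UniversalEnvelopingAlgebra.ι ℂ x • v = 0
      let S : LieSubalgebra ℂ (loopAlg g n) :=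
        { carrier := {y | ⁅y, v⁆ = 0}
          add_mem' := fun {y z} hy hz => by
            simp only [Set.mem_ofPred_eq] at *; rw [add_lie, hy, hz, add_zero]
          zero_mem' := by simp
          smul_mem' := fun c y hy => by
            simp only [Set.mem_ofPred_eq] at *; rw [smul_lie, hy, smul_zero]
          lie_mem' := fun {y z} hy hz => by
            change ⁅⁅y, z⁆, v⁆ = 0
            rw [lie_lie, show ⁅z, v⁆ = 0 from hz, show ⁅y, v⁆ = 0 from hy, lie_zero, lie_zero,
              sub_zero] }
      have h1 : loops n K.npos.toSubmodule ≤ (S.map (loopAlg g n).incl).toSubmodule :=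
        loops_le fun p y hy => ⟨loopElt p ⟨y, K.npos_le_derived hy⟩,
          loopElt_mem_of_mem_lieSpan (s := Set.range K.e)
            (x := ⟨y, K.npos_le_derived hy⟩) (by rintro ⟨_, h⟩ ⟨i, rfl⟩ p; exact hv.lie_E i p)
            (by rintro _ ⟨i, rfl⟩; exact K.e_mem_derived i) hy p, rfl⟩
      obtain ⟨y, hy, h⟩ := h1 hx
      rw [hlie, ← Subtype.ext (show (y : Laurent n ⊗[ℂ] g) = x from h)]
      exact hy
    · change (UniversalEnvelopingAlgebra.ι ℂ (K.inclCartan x) - algebraMap ℂ U (Ψ x)) • v = 0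
      rw [sub_smul, hlie, hv.lie_H, algebraMap_smul, sub_self]
  let f₁ : K.verma Ψ →ₗ[U] V := (K.vermaIdeal Ψ).liftQ f₀ hf₀
  have hf₁v : f₁ (K.vermaGen Ψ) = v := one_smul U v
  have hker₁ : LinearMap.ker f₁ ≤ K.maxSub Ψ := by
    refine le_sSup fun h => h0 ?_
    have : K.vermaGen Ψ ∈ LinearMap.ker f₁ := h ▸ Submodule.mem_top
    rwa [LinearMap.mem_ker, hf₁v] at this
  have hle : K.maxSub Ψ ≤ LinearMap.ker f₁ := by
    let N : LieSubmodule ℂ (loopAlg g n) V :=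
      { ((K.maxSub Ψ).map f₁).restrictScalars ℂ with
        lie_mem := fun {x w} hw => by
          change ⁅x, w⁆ ∈ (K.maxSub Ψ).map f₁
          rw [← hlie]
          exact Submodule.smul_mem _ _ hw }
    have hN : N = ⊥ := by
      -- If the image were everything, `v` would be the image of some `m` in the maximal submodule.
      -- Then the generator differs from `m` by an element of the kernel, which is proper, so the
      -- generator itself would lie in the maximal submodule.
      refine irr N fun h => K.vermaGen_notMem_maxSub Ψ ?_
      have hvN : v ∈ N := h ▸ LieSubmodule.mem_top v
      obtain ⟨m, hm, hmv⟩ := hvN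
      rw [← sub_sub_cancel m (K.vermaGen Ψ)]
      refine sub_mem hm (hker₁ ?_)
      rw [LinearMap.mem_ker, map_sub, hf₁v]
      exact sub_eq_zero.mpr hmv
    intro m hm
    have : f₁ m ∈ N := ⟨m, hm, rfl⟩
    rwa [hN, LieSubmodule.mem_bot] at this
  let f : K.simpleMod Ψ →ₗ[U] V := (K.maxSub Ψ).liftQ f₁ hle
  have hf : ∀ x w, f (K.act x w) = ⁅x, f w⁆ := fun x w => by
    rw [act, map_smul, hlie]
  have hfv : f (K.simpleGen Ψ) = v := hf₁v
  have hker : ∀ w, f w = 0 → w = 0 := by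
    let N : LieSubmodule ℂ (loopAlg g n) (K.simpleMod Ψ) :=
      { (LinearMap.ker f).restrictScalars ℂ with
        lie_mem := fun {x w} hw => (LinearMap.ker f).smul_mem _ hw }
    have hN : N = ⊥ := by
      refine K.simple_irreducible Ψ N fun h => h0 ?_
      have : K.simpleGen Ψ ∈ N := h ▸ LieSubmodule.mem_top _
      rw [← hfv]
      exact this
    intro w hw
    have : w ∈ N := hw
    rwa [hN, LieSubmodule.mem_bot] at this
  have hsurj : ∀ w, ∃ u, f u = w := by
    let N : LieSubmodule ℂ (loopAlg g n) V :=
      { (LinearMap.range f).restrictScalars ℂ with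
        lie_mem := fun {x w} hw => by
          change ⁅x, w⁆ ∈ LinearMap.range f
          rw [← hlie]
          exact Submodule.smul_mem _ _ hw }
    have hN : N = ⊤ := hv.gen N ⟨_, hfv⟩
    intro w
    exact (hN ▸ LieSubmodule.mem_top w : w ∈ N)
  refine ⟨LinearEquiv.ofBijective (f.restrictScalars ℂ) ⟨?_, hsurj⟩, hf⟩
  exact (injective_iff_map_eq_zero _).mpr hker

/-! ### Twisting by automorphisms -/

/-- The `g_A`-module `V` with the action composed with `twist a`. -/
def Twisted (_ : Fin n → ℂˣ) (V : Type*) := V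

section

variable (a : Fin n → ℂˣ) (V : Type*) [AddCommGroup V] [Module ℂ V]
  [LieRingModule (loopAlg g n) V] [LieModule ℂ (loopAlg g n) V]

instance : AddCommGroup (Twisted a V) := inferInstanceAs (AddCommGroup V)

instance : Module ℂ (Twisted a V) := inferInstanceAs (Module ℂ V)

instance : LieRingModule (loopAlg g n) (Twisted a V) :=
  LieRingModule.compLieHom V (twist (g := g) a : loopAlg g n →ₗ⁅ℂ⁆ loopAlg g n)

instance : LieModule ℂ (loopAlg g n) (Twisted a V) :=
  LieModule.compLieHom V (twist (g := g) a : loopAlg g n →ₗ⁅ℂ⁆ loopAlg g n)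

/-- The identity map `V → Twisted a V`. -/
def toTwisted : V ≃ₗ[ℂ] Twisted a V := LinearEquiv.refl ℂ V

variable {V}

theorem lie_toTwisted (x : loopAlg g n) (w : V) :
    ⁅x, toTwisted a V w⁆ = toTwisted a V ⁅twist a x, w⁆ := rfl

theorem exists_untwist (N : LieSubmodule ℂ (loopAlg g n) (Twisted a V)) :
    ∃ N' : LieSubmodule ℂ (loopAlg g n) V, ∀ w, w ∈ N' ↔ toTwisted a V w ∈ N :=
  ⟨{ N.toSubmodule.comap (toTwisted a V : V →ₗ[ℂ] Twisted a V) with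
    lie_mem := fun {x w} hw => by
      change toTwisted a V ⁅x, w⁆ ∈ N
      have h : ⁅(twist a).symm x, toTwisted a V w⁆ ∈ N := N.lie_mem hw
      rwa [lie_toTwisted, LieEquiv.apply_symm_apply] at h }, fun _ => Iff.rfl⟩

theorem untwist_eq_top {N : LieSubmodule ℂ (loopAlg g n) (Twisted a V)}
    {N' : LieSubmodule ℂ (loopAlg g n) V} (hN : ∀ w, w ∈ N' ↔ toTwisted a V w ∈ N)
    (h : N' = ⊤) : N = ⊤ := by
  rw [eq_top_iff]
  intro w _
  obtain ⟨w, rfl⟩ := (toTwisted a V).surjective w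
  rw [← hN, h]
  exact LieSubmodule.mem_top w

variable {Ψ} {K}

theorem IsHighestWeight.twisted {v : V} (hv : K.IsHighestWeight Ψ v) :
    K.IsHighestWeight (K.twistFun a Ψ) (toTwisted a V v) := by
  refine ⟨fun i p => ?_, fun x => ?_, fun N hN => ?_⟩
  · rw [lie_toTwisted, show twist a (K.E i p) = K.E i (scale a p) from rfl, hv.lie_E, map_zero]
  · have h := hv.lie_H (LinearMap.restrict
      (scaleLie g a : Laurent n ⊗[ℂ] g →ₗ[ℂ] Laurent n ⊗[ℂ] g)
      (p := K.loopCartan n) (q := K.loopCartan n) (fun _ hx => scale_mem_sup a _ _ hx) x)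
    rw [lie_toTwisted, ← map_smul]
    exact congrArg (toTwisted a V) h
  · obtain ⟨N', h⟩ := exists_untwist a N
    exact untwist_eq_top a h (hv.gen N' ((h v).mpr hN))

theorem twisted_irreducible (irr : ∀ N : LieSubmodule ℂ (loopAlg g n) V, N ≠ ⊤ → N = ⊥)
    (N : LieSubmodule ℂ (loopAlg g n) (Twisted a V)) (hN : N ≠ ⊤) : N = ⊥ := by
  obtain ⟨N', h⟩ := exists_untwist a N
  have h1 := irr N' fun h' => hN (untwist_eq_top a h h')
  rw [LieSubmodule.eq_bot_iff] at h1 ⊢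
  intro w hw
  obtain ⟨w, rfl⟩ := (toTwisted a V).surjective w
  rw [h1 w ((h w).mpr hw), map_zero]

end

theorem twist_const (a : Fin n → ℂˣ) (x : g) : twist a (const n x) = const n x :=
  Subtype.ext (by
    change scale a 1 ⊗ₜ[ℂ] x = 1 ⊗ₜ[ℂ] x
    rw [map_one])

/-- `V(aΨ)` is `V(Ψ)` twisted by `twist a`. -/
theorem exists_twist_equiv (a : Fin n → ℂˣ) :
    ∃ E : K.simpleMod (K.twistFun a Ψ) ≃ₗ[ℂ] K.simpleMod Ψ,
      ∀ x w, E (K.act x w) = K.act (twist a x) (E w) := by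
  obtain ⟨E, hE⟩ := ((K.simple_isHighestWeight Ψ).twisted a).exists_equiv
    (fun h => K.simpleGen_ne_zero Ψ ((toTwisted a _).map_eq_zero_iff.mp h))
    (twisted_irreducible a (K.simple_irreducible Ψ))
  refine ⟨E.trans (toTwisted a _).symm, fun x w => ?_⟩
  rw [LinearEquiv.trans_apply, LinearEquiv.trans_apply, LinearEquiv.symm_apply_eq, hE,
    act_eq_lie, ← lie_toTwisted, LinearEquiv.apply_symm_apply]

end KacMoody

/-! ### Exp-polynomial functionals -/

section

variable {n : ℕ}

theorem single_eq_smul_mono (m : Fin n → ℤ) (c : ℂ) :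
    (AddMonoidAlgebra.single m c : Laurent n) = c • mono m := by
  rw [mono, AddMonoidAlgebra.smul_single, smul_eq_mul, mul_one]

theorem mono_mul_mono (m m' : Fin n → ℤ) : mono m * mono m' = mono (m + m') := by
  rw [mono, mono, AddMonoidAlgebra.single_mul_single, mul_one, mono]

theorem laurent_hom_ext {M : Type*} [AddCommGroup M] [Module ℂ M] {f f' : Laurent n →ₗ[ℂ] M}
    (h : ∀ m, f (mono m) = f' (mono m)) (x : Laurent n) : f x = f' x := by
  induction x using AddMonoidAlgebra.induction_linear with
  | zero => rw [map_zero, map_zero]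
  | add x y hx hy => rw [map_add, map_add, hx, hy]
  | single m c => rw [single_eq_smul_mono, map_smul, map_smul, h]

/-- The linear functional on `A` with `t^m ↦ f m`. -/
def functional (f : (Fin n → ℤ) → ℂ) : Laurent n →ₗ[ℂ] ℂ :=
  Finsupp.linearCombination ℂ f ∘ₗ (AddMonoidAlgebra.coeffLinearEquiv ℂ).toLinearMap

theorem functional_mono (f : (Fin n → ℤ) → ℂ) (m : Fin n → ℤ) : functional f (mono m) = f m := by
  simp [functional, mono]

/-- The evaluation `A → ℂ` at a point of `(ℂ^*)ⁿ`. -/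
def evalPoint (a : Fin n → ℂˣ) : Laurent n →ₐ[ℂ] ℂ :=
  AddMonoidAlgebra.lift ℂ ℂ (Fin n → ℤ)
    { toFun := fun m => (expo a m.toAdd : ℂ)
      map_one' := by simp [expo]
      map_mul' := fun x y => by simp [expo, zpow_add, Finset.prod_mul_distrib] }

theorem evalPoint_mono (a : Fin n → ℂˣ) (m : Fin n → ℤ) : evalPoint a (mono m) = expo a m := by
  simp [evalPoint, mono]

/-- The maximal ideal of a point of `(ℂ^*)ⁿ`. -/
def pointIdeal (a : Fin n → ℂˣ) : Ideal (Laurent n) := RingHom.ker (evalPoint a)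

instance pointIdeal_isMaximal (a : Fin n → ℂˣ) : (pointIdeal a).IsMaximal :=
  RingHom.ker_isMaximal_of_surjective (evalPoint a)
    (fun c => ⟨algebraMap ℂ _ c, (evalPoint a).commutes c⟩)

theorem expo_single (a : Fin n → ℂˣ) (i : Fin n) : expo a (Pi.single i 1) = a i := by
  rw [expo, Finset.prod_eq_single i]
  · simp
  · intro j _ hj; simp [hj]
  · simp

theorem pointIdeal_injective {a b : Fin n → ℂˣ} (h : pointIdeal a = pointIdeal b) : a = b := by
  funext i
  have h1 : mono (Pi.single i 1) - algebraMap ℂ (Laurent n) (a i : ℂ) ∈ pointIdeal a := by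
    rw [pointIdeal, RingHom.mem_ker, map_sub, evalPoint_mono, expo_single, AlgHom.commutes]
    exact sub_self _
  rw [h, pointIdeal, RingHom.mem_ker, map_sub, evalPoint_mono, expo_single, AlgHom.commutes,
    sub_eq_zero] at h1
  exact Units.ext h1.symm

/-- The derivation `t_i ∂/∂t_i`. -/
def eulerOp (i : Fin n) : Laurent n →ₗ[ℂ] Laurent n :=
  (Finsupp.linearCombination ℂ fun m : Fin n → ℤ => (m i : ℂ) • mono m) ∘ₗ
    (AddMonoidAlgebra.coeffLinearEquiv ℂ).toLinearMap

theorem eulerOp_mono (i : Fin n) (m : Fin n → ℤ) : eulerOp i (mono m) = (m i : ℂ) • mono m := by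
  simp [eulerOp, mono]

theorem eulerOp_mul (i : Fin n) (x y : Laurent n) :
    eulerOp i (x * y) = eulerOp i x * y + x * eulerOp i y := by
  have h : ∀ m y, eulerOp i (mono m * y) = eulerOp i (mono m) * y + mono m * eulerOp i y := by
    intro m
    refine laurent_hom_ext (f := eulerOp i ∘ₗ LinearMap.mulLeft ℂ (mono m))
      (f' := LinearMap.mulLeft ℂ (eulerOp i (mono m)) +
        LinearMap.mulLeft ℂ (mono m) ∘ₗ eulerOp i) fun m' => ?_
    simp only [LinearMap.comp_apply, LinearMap.mulLeft_apply, LinearMap.add_apply, eulerOp_mono,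
      mono_mul_mono, smul_mul_assoc, mul_smul_comm, ← add_smul, Pi.add_apply, Int.cast_add]
  refine laurent_hom_ext (f := eulerOp i ∘ₗ LinearMap.mulRight ℂ y)
    (f' := LinearMap.mulRight ℂ y ∘ₗ eulerOp i + LinearMap.mulRight ℂ (eulerOp i y))
    (fun m => ?_) x
  simpa using h m y

/-- A derivation lowers the order of vanishing by at most one. -/
theorem eulerOp_mem_pow (i : Fin n) (I : Ideal (Laurent n)) (N : ℕ) {x : Laurent n}
    (hx : x ∈ I ^ (N + 1)) : eulerOp i x ∈ I ^ N := by
  induction N generalizing x with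
  | zero => simp
  | succ N ih =>
    rw [pow_succ] at hx
    induction hx using Submodule.mul_induction_on' with
    | mem_mul_mem x hx y hy =>
      rw [eulerOp_mul]
      refine add_mem ?_ (Ideal.mul_mem_right _ _ hx)
      rw [pow_succ]
      exact Ideal.mul_mem_mul (ih hx) hy
    | add x _ y _ hx hy => rw [map_add]; exact add_mem hx hy

/-- Multiplying `p` by `X i` amounts to composing the functional with `eulerOp i`, which costs one
power of the ideal. The constant case is a multiple of evaluation at `a`, which vanishes on the
ideal itself. -/
theorem exists_functional_pow_eq_zero (a : Fin n → ℂˣ) (p : MvPolynomial (Fin n) ℂ) :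
    ∃ N, ∀ x ∈ pointIdeal a ^ N,
      functional (fun m => MvPolynomial.eval (fun i => (m i : ℂ)) p * (expo a m : ℂ)) x = 0 := by
  induction p using MvPolynomial.induction_on with
  | C c =>
    refine ⟨1, fun x hx => ?_⟩
    rw [pow_one, pointIdeal, RingHom.mem_ker] at hx
    have h := laurent_hom_ext (f := functional (fun m : Fin n → ℤ =>
      MvPolynomial.eval (fun i => (m i : ℂ)) (MvPolynomial.C c) * (expo a m : ℂ)))
      (f' := c • (evalPoint a).toLinearMap) (fun m => by
        rw [functional_mono, MvPolynomial.eval_C, LinearMap.smul_apply, AlgHom.toLinearMap_apply,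
          evalPoint_mono, smul_eq_mul]) x
    rw [h, LinearMap.smul_apply, AlgHom.toLinearMap_apply, hx, smul_zero]
  | add p q hp hq =>
    obtain ⟨N, hN⟩ := hp
    obtain ⟨N', hN'⟩ := hq
    refine ⟨max N N', fun x hx => ?_⟩
    have h := laurent_hom_ext (f := functional (fun m : Fin n → ℤ =>
      MvPolynomial.eval (fun i => (m i : ℂ)) (p + q) * (expo a m : ℂ)))
      (f' := functional (fun m => MvPolynomial.eval (fun i => (m i : ℂ)) p * (expo a m : ℂ)) +
        functional (fun m => MvPolynomial.eval (fun i => (m i : ℂ)) q * (expo a m : ℂ)))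
      (fun m => by
        rw [LinearMap.add_apply, functional_mono, functional_mono, functional_mono, map_add,
          add_mul]) x
    rw [h, LinearMap.add_apply, hN x (Ideal.pow_le_pow_right (le_max_left _ _) hx),
      hN' x (Ideal.pow_le_pow_right (le_max_right _ _) hx), add_zero]
  | mul_X p i hp =>
    obtain ⟨N, hN⟩ := hp
    refine ⟨N + 1, fun x hx => ?_⟩
    have h := laurent_hom_ext (f := functional (fun m : Fin n → ℤ =>
      MvPolynomial.eval (fun i => (m i : ℂ)) (p * MvPolynomial.X i) * (expo a m : ℂ)))
      (f' := functional (fun m => MvPolynomial.eval (fun i => (m i : ℂ)) p * (expo a m : ℂ)) ∘ₗ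
        eulerOp i)
      (fun m => by
        rw [LinearMap.comp_apply, eulerOp_mono, map_smul, functional_mono, functional_mono,
          map_mul, MvPolynomial.eval_X, smul_eq_mul]
        ring) x
    rw [h, LinearMap.comp_apply]
    exact hN _ (eulerOp_mem_pow i _ N hx)

/-- The ideal `J` contains a product of maximal ideals of points of `B`. -/
def SupportedOn (B : Set (Fin n → ℂˣ)) (J : Ideal (Laurent n)) : Prop :=
  ∃ s : Multiset (Fin n → ℂˣ), (∀ a ∈ s, a ∈ B) ∧ (s.map pointIdeal).prod ≤ J

theorem SupportedOn.top (B : Set (Fin n → ℂˣ)) : SupportedOn B ⊤ := ⟨0, by simp, le_top⟩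

theorem SupportedOn.mono {B : Set (Fin n → ℂˣ)} {J J' : Ideal (Laurent n)} (h : SupportedOn B J)
    (hJ : J ≤ J') : SupportedOn B J' := by
  obtain ⟨s, hs, h⟩ := h
  exact ⟨s, hs, h.trans hJ⟩

theorem SupportedOn.inf {B : Set (Fin n → ℂˣ)} {J J' : Ideal (Laurent n)} (h : SupportedOn B J)
    (h' : SupportedOn B J') : SupportedOn B (J ⊓ J') := by
  obtain ⟨s, hs, h⟩ := h
  obtain ⟨s', hs', h'⟩ := h'
  refine ⟨s + s', fun a ha => (Multiset.mem_add.mp ha).elim (hs a) (hs' a), ?_⟩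
  rw [Multiset.map_add, Multiset.prod_add]
  exact Ideal.mul_le_inf.trans (inf_le_inf h h')

theorem SupportedOn.finset_inf {B : Set (Fin n → ℂˣ)} {κ : Type*} (s : Finset κ)
    (J : κ → Ideal (Laurent n)) (h : ∀ k ∈ s, SupportedOn B (J k)) : SupportedOn B (s.inf J) := by
  classical
  induction s using Finset.induction_on with
  | empty => exact SupportedOn.top B
  | insert k s _ ih =>
    rw [Finset.inf_insert]
    exact (h k (Finset.mem_insert_self k s)).inf
      (ih fun k hk => h k (Finset.mem_insert_of_mem hk))

/-- A prime containing a product of ideals contains one of the factors, and here the factors are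
maximal. -/
theorem SupportedOn.eq_pointIdeal {B : Set (Fin n → ℂˣ)} {J P : Ideal (Laurent n)}
    (h : SupportedOn B J) (hP : P.IsPrime) (hJ : J ≤ P) : ∃ a ∈ B, P = pointIdeal a := by
  obtain ⟨s, hs, h⟩ := h
  obtain ⟨a, ha, h1⟩ := (hP.multiset_prod_map_le pointIdeal).mp (h.trans hJ)
  exact ⟨a, hs a ha, ((pointIdeal_isMaximal a).eq_of_le hP.ne_top h1).symm⟩

/-- A maximal ideal containing both `J` and `J'` would be the ideal of a point common to `B` and
`B'`. -/
theorem SupportedOn.isCoprime {B B' : Set (Fin n → ℂˣ)} (hB : Disjoint B B')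
    {J J' : Ideal (Laurent n)} (h : SupportedOn B J) (h' : SupportedOn B' J') :
    IsCoprime J J' := by
  rw [Ideal.isCoprime_iff_sup_eq]
  by_contra hne
  obtain ⟨P, hP, hle⟩ := Ideal.exists_le_maximal _ hne
  obtain ⟨a, ha, h1⟩ := h.eq_pointIdeal hP.isPrime (le_sup_left.trans hle)
  obtain ⟨b, hb, h2⟩ := h'.eq_pointIdeal hP.isPrime (le_sup_right.trans hle)
  rw [pointIdeal_injective (h1.symm.trans h2)] at ha
  exact Set.disjoint_left.mp hB ha hb

/-- Every prime of the quotient comes from a point ideal, hence is maximal. A finitely generated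
algebra over a field with this property is finite-dimensional. -/
theorem SupportedOn.finite_quotient {B : Set (Fin n → ℂˣ)} {J : Ideal (Laurent n)}
    (h : SupportedOn B J) : Module.Finite ℂ (Laurent n ⧸ J) := by
  rw [Module.finite_iff_krullDimLE_zero, Ring.krullDimLE_zero_iff]
  intro P hP
  have h1 : (P.comap (Ideal.Quotient.mk J)).IsPrime := hP.comap _
  obtain ⟨a, -, ha⟩ := h.eq_pointIdeal h1 (by
    intro x hx
    rw [Ideal.mem_comap, Ideal.Quotient.eq_zero_iff_mem.mpr hx]
    exact zero_mem _)
  have h2 : (P.comap (Ideal.Quotient.mk J)).IsMaximal := ha ▸ pointIdeal_isMaximal a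
  rw [← Ideal.map_comap_of_surjective _ Ideal.Quotient.mk_surjective P]
  exact (Ideal.map_eq_top_or_isMaximal_of_surjective _ Ideal.Quotient.mk_surjective h2).resolve_left
    (by rw [Ideal.map_comap_of_surjective _ Ideal.Quotient.mk_surjective P]; exact hP.ne_top)

/-- The largest ideal in the kernel of a functional. -/
def functionalKiller (φ : Laurent n →ₗ[ℂ] ℂ) : Ideal (Laurent n) where
  carrier := {x | ∀ y, φ (y * x) = 0}
  add_mem' := fun {x x'} h h' y => by rw [mul_add, map_add, h, h', add_zero]
  zero_mem' := fun y => by rw [mul_zero, map_zero]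
  smul_mem' := fun c x h y => by rw [smul_eq_mul, ← mul_assoc]; exact h _

theorem IsExpPolyOn.supportedOn {B : Set (Fin n → ℂˣ)} {f : (Fin n → ℤ) → ℂ}
    (h : IsExpPolyOn B f) : SupportedOn B (functionalKiller (functional f)) := by
  obtain ⟨p, hp, hf⟩ := h
  have h1 : ∀ a ∈ p.support, SupportedOn B (functionalKiller (functional
      (fun m => MvPolynomial.eval (fun i => (m i : ℂ)) (p a) * (expo a m : ℂ)))) := by
    intro a ha
    obtain ⟨N, hN⟩ := exists_functional_pow_eq_zero a (p a)
    refine ⟨Multiset.replicate N a, fun b hb => ?_, fun x hx y => hN _ ?_⟩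
    · rw [Multiset.eq_of_mem_replicate hb]
      exact hp ha
    · rw [Multiset.map_replicate, Multiset.prod_replicate] at hx
      exact Ideal.mul_mem_left _ _ hx
  refine (SupportedOn.finset_inf _ _ h1).mono fun x hx y => ?_
  have h2 := laurent_hom_ext (f := functional f) (f' := ∑ a ∈ p.support, functional
      (fun m => MvPolynomial.eval (fun i => (m i : ℂ)) (p a) * (expo a m : ℂ))) (fun m => by
        rw [functional_mono, hf, LinearMap.sum_apply, Finsupp.sum]
        exact Finset.sum_congr rfl fun a _ => (functional_mono
          (fun m => MvPolynomial.eval (fun i => (m i : ℂ)) (p a) * (expo a m : ℂ)) m).symm) (y * x)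
  rw [h2, LinearMap.sum_apply]
  refine Finset.sum_eq_zero fun a ha => ?_
  exact Finset.inf_le (f := fun a => functionalKiller (functional fun m : Fin n → ℤ =>
    MvPolynomial.eval (fun i => (m i : ℂ)) (p a) * (expo a m : ℂ))) ha hx y

theorem IsExpPolyOn.add {B : Set (Fin n → ℂˣ)} {f f' : (Fin n → ℤ) → ℂ}
    (h : IsExpPolyOn B f) (h' : IsExpPolyOn B f') : IsExpPolyOn B (fun m => f m + f' m) := by
  classical
  obtain ⟨p, hp, hf⟩ := h
  obtain ⟨p', hp', hf'⟩ := h'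
  refine ⟨p + p', ?_, fun m => ?_⟩
  · refine (Finset.coe_subset.mpr Finsupp.support_add).trans ?_
    rw [Finset.coe_union]
    exact Set.union_subset hp hp'
  · rw [Finsupp.sum_add_index' (by simp) (by intros; rw [map_add, add_mul]), ← hf, ← hf']

theorem IsExpPolyOn.mono {B B' : Set (Fin n → ℂˣ)} {f : (Fin n → ℤ) → ℂ}
    (h : IsExpPolyOn B f) (hB : B ⊆ B') : IsExpPolyOn B' f := by
  obtain ⟨p, hp, hf⟩ := h
  exact ⟨p, hp.trans hB, hf⟩

theorem expo_mul (a b : Fin n → ℂˣ) (m : Fin n → ℤ) : expo (a * b) m = expo a m * expo b m := by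
  simp [expo, mul_zpow, Finset.prod_mul_distrib]

theorem IsExpPolyOn.twist {B : Set (Fin n → ℂˣ)} {f : (Fin n → ℤ) → ℂ} (h : IsExpPolyOn B f)
    (a : Fin n → ℂˣ) : IsExpPolyOn ((a * ·) '' B) (fun m => (expo a m : ℂ) * f m) := by
  classical
  obtain ⟨p, hp, hf⟩ := h
  refine ⟨p.mapDomain (a * ·), ?_, fun m => ?_⟩
  · refine (Finset.coe_subset.mpr Finsupp.mapDomain_support).trans ?_
    rw [Finset.coe_image]
    exact Set.image_mono hp
  · rw [Finsupp.sum_mapDomain_index (by simp) (by intros; rw [map_add, add_mul])]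
    beta_reduce
    rw [hf, Finsupp.mul_sum]
    refine Finsupp.sum_congr fun b _ => ?_
    rw [expo_mul, Units.val_mul]
    ring

end

namespace KacMoody

variable {ι g : Type*} [Fintype ι] [DecidableEq ι] {C : Matrix ι ι ℤ} [LieRing g] [LieAlgebra ℂ g]
  (K : KacMoody C g) {n : ℕ} {Ψ : Module.Dual ℂ (K.loopCartan n)}

/-- As `𝔥'` is finite-dimensional, `killer Ψ` contains the intersection of the ideals attached to
the finitely many basis vectors. -/
theorem killer_supportedOn {B : Set (Fin n → ℂˣ)}
    (h : ∀ x : K.cartan', IsExpPolyOn B fun m => Ψ (K.cartanMono x m)) :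
    SupportedOn B (K.killer Ψ) := by
  have := K.finite_cartan
  have : FiniteDimensional ℂ K.cartan' :=
    Submodule.finiteDimensional_of_le (inf_le_left : K.cartan' ≤ K.cartan)
  let b := Module.finBasis ℂ K.cartan'
  refine (SupportedOn.finset_inf Finset.univ (fun j => functionalKiller (functional
    fun m => Ψ (K.cartanMono (b j) m))) fun j _ => (h (b j)).supportedOn).mono ?_
  intro p hp q x
  let T : Laurent n →ₗ[ℂ] K.cartan' →ₗ[ℂ] ℂ := LinearMap.mk₂ ℂ (fun p x => Ψ (K.cartanElt p x))
    (fun p q x => by rw [cartanElt_add, map_add])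
    (fun c p x => by
      rw [← map_smul]; exact congrArg Ψ (Subtype.ext (TensorProduct.smul_tmul' c p (x : g)).symm))
    (fun p x y => by
      rw [← map_add]; exact congrArg Ψ (Subtype.ext (TensorProduct.tmul_add p (x : g) y)))
    (fun c p x => by
      rw [← map_smul]; exact congrArg Ψ (Subtype.ext (TensorProduct.tmul_smul c p (x : g))))
  have hT : T (q * p) = 0 := by
    refine b.ext fun j => ?_
    have h1 := laurent_hom_ext (f := T.flip (b j))
      (f' := functional fun m => Ψ (K.cartanMono (b j) m)) (fun m => by
        rw [functional_mono]; rfl) (q * p)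
    rw [LinearMap.flip_apply] at h1
    rw [h1]
    exact Finset.inf_le (f := fun j => functionalKiller (functional
      fun m => Ψ (K.cartanMono (b j) m))) (Finset.mem_univ j) hp q
  exact LinearMap.congr_fun hT x

end KacMoody

/-! ### Characters -/

/-- The counting rule for multiplying generating functions; it is applied to the degrees of a tensor
product basis. -/
theorem natCard_add_fiber {J₁ J₂ D : Type*} [AddCommMonoid D] [Finset.HasAntidiagonal D]
    (d₁ : J₁ → D) (d₂ : J₂ → D) (h₁ : ∀ δ, {j | d₁ j = δ}.Finite) (h₂ : ∀ δ, {j | d₂ j = δ}.Finite)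
    (δ : D) : {p : J₁ × J₂ | d₁ p.1 + d₂ p.2 = δ}.Finite ∧
      Nat.card {p : J₁ × J₂ // d₁ p.1 + d₂ p.2 = δ} =
        ∑ x ∈ Finset.HasAntidiagonal.antidiagonal δ, Nat.card {j // d₁ j = x.1} * Nat.card {j // d₂ j = x.2} := by
  have := fun δ => (h₁ δ).to_subtype
  have := fun δ => (h₂ δ).to_subtype
  let e : {p : J₁ × J₂ // d₁ p.1 + d₂ p.2 = δ} ≃
      Σ x : Finset.HasAntidiagonal.antidiagonal δ, {j // d₁ j = x.1.1} × {j // d₂ j = x.1.2} :=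
    { toFun := fun p => ⟨⟨(d₁ p.1.1, d₂ p.1.2), Finset.HasAntidiagonal.mem_antidiagonal.mpr p.2⟩,
        ⟨p.1.1, rfl⟩, ⟨p.1.2, rfl⟩⟩
      invFun := fun x => ⟨(x.2.1.1, x.2.2.1), by
        rw [x.2.1.2, x.2.2.2]; exact Finset.HasAntidiagonal.mem_antidiagonal.mp x.1.2⟩
      left_inv := fun _ => rfl
      right_inv := by
        rintro ⟨⟨⟨a, b⟩, h⟩, ⟨j₁, h₁⟩, ⟨j₂, h₂⟩⟩
        dsimp only at h₁ h₂
        subst h₁ h₂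
        rfl }
  have : ∀ δ, Finite {j // d₁ j = δ} := fun δ => (h₁ δ).to_subtype
  have : ∀ δ, Finite {j // d₂ j = δ} := fun δ => (h₂ δ).to_subtype
  refine ⟨Set.finite_coe_iff.mp (Finite.of_equiv _ e.symm), ?_⟩
  rw [Nat.card_congr e, Nat.card_sigma]
  simp_rw [Nat.card_prod]
  exact Finset.sum_coe_sort (Finset.HasAntidiagonal.antidiagonal δ)
    (fun x => Nat.card {j // d₁ j = x.1} * Nat.card {j // d₂ j = x.2})

namespace KacMoody

universe u

variable {ι : Type u} {g : Type*} [Fintype ι] [DecidableEq ι] {C : Matrix ι ι ℤ} [LieRing g] [LieAlgebra ℂ g]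
  (K : KacMoody C g) {n : ℕ} (Ψ : Module.Dual ℂ (K.loopCartan n))

/-- The linear combination of simple roots with given coefficients. -/
def rootSum : (ι →₀ ℕ) →ₗ[ℕ] Module.Dual ℂ K.cartan := Finsupp.linearCombination ℕ K.root

theorem rootSum_injective : Function.Injective K.rootSum :=
  K.root_indep.restrict_scalars (R := ℕ) (fun a b h => by simpa using h)

/-- The restriction of `Ψ` to `𝔥`. -/
def topWeight : Module.Dual ℂ K.cartan where
  toFun x := Ψ (K.cartanConst n x)
  map_add' x y := by
    rw [← map_add]
    exact congrArg Ψ (Subtype.ext (TensorProduct.tmul_add _ (x : g) y))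
  map_smul' c x := by
    rw [← map_smul]
    exact congrArg Ψ (Subtype.ext (TensorProduct.tmul_smul c _ (x : g)))

theorem topWeight_add (Ψ₁ Ψ₂ : Module.Dual ℂ (K.loopCartan n)) :
    K.topWeight (Ψ₁ + Ψ₂) = K.topWeight Ψ₁ + K.topWeight Ψ₂ := rfl

/-- The number of simple root vectors of each type in a product of operators `p ⊗ f i`. -/
def content {P : Type*} (l : List (ι × P)) : ι →₀ ℕ := (l.map fun a => Finsupp.single a.1 1).sum

theorem degree_content {P : Type*} (l : List (ι × P)) : (content l).degree = l.length := by
  induction l with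
  | nil => simp [content]
  | cons a l ih =>
    rw [content] at ih ⊢
    rw [List.map_cons, List.sum_cons, map_add, ih, Finsupp.degree_single, List.length_cons, add_comm]

theorem rootSum_content {P : Type*} (l : List (ι × P)) (x : K.cartan) :
    K.rootSum (content l) x = (l.map fun a => K.root a.1 x).sum := by
  induction l with
  | nil => simp [content]
  | cons a l ih =>
    rw [content] at ih ⊢
    rw [List.map_cons, List.sum_cons, map_add, LinearMap.add_apply, ih, List.map_cons,
      List.sum_cons, rootSum, Finsupp.linearCombination_single, one_smul]

section

variable {V : Type*} [AddCommGroup V] [Module ℂ V]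
  [LieRingModule (loopAlg g n) V] [LieModule ℂ (loopAlg g n) V]

variable {K} {Ψ}

/-- The operator `p ⊗ f i` depends only on `p` modulo `killer Ψ`. When `G` is finite and spans the
quotient, only finitely many words of each length are needed. -/
theorem IsHighestWeight.span_finite_words {v : V} (hv : K.IsHighestWeight Ψ v) (h0 : v ≠ 0)
    (irr : ∀ N : LieSubmodule ℂ (loopAlg g n) V, N ≠ ⊤ → N = ⊥) {G : Finset (Laurent n)}
    (hG : ∀ p, ∃ q ∈ Submodule.span ℂ (G : Set (Laurent n)), p - q ∈ K.killer Ψ) :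
    Submodule.span ℂ (Set.range fun l : List (ι × G) =>
      K.word (l.map fun a => (a.1, (a.2 : Laurent n))) v) = ⊤ := by
  set W := Submodule.span ℂ (Set.range fun l : List (ι × G) =>
      K.word (l.map fun a => (a.1, (a.2 : Laurent n))) v)
  have hF : ∀ i p, ∀ w ∈ W, ⁅K.F (n := n) i p, w⁆ ∈ W := by
    intro i p w hw
    refine lie_mem_of_span ?_ hw
    rintro _ ⟨l, rfl⟩
    set u := K.word (l.map fun a => (a.1, (a.2 : Laurent n))) v
    obtain ⟨q, hq, hpq⟩ := hG p
    have h1 : ⁅K.F (n := n) i p, u⁆ = ⁅K.F (n := n) i q, u⁆ := by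
      have h2 := hv.lie_loopElt_eq_zero h0 irr hpq ⟨K.f i, K.f_mem_derived i⟩ u
      nth_rw 1 [← sub_add_cancel p q]
      rw [F_add, add_lie]
      rw [F, h2, zero_add]
    rw [h1]
    clear h1 hpq
    induction hq using Submodule.span_induction with
    | mem q hq => exact Submodule.subset_span ⟨(i, ⟨q, hq⟩) :: l, rfl⟩
    | zero =>
      rw [← zero_smul ℂ (0 : Laurent n), F_smul, zero_smul, zero_lie]
      exact zero_mem _
    | add q q' _ _ h h' => rw [F_add, add_lie]; exact add_mem h h'
    | smul c q _ h => rw [F_smul, smul_lie]; exact W.smul_mem c h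
  rw [eq_top_iff]
  intro w _
  refine hv.induction (fun l => ?_) w
  induction l with
  | nil => exact Submodule.subset_span ⟨[], rfl⟩
  | cons a l ih => exact hF _ _ _ ih

/-- A basis is extracted from the words with letters in a finite set. They are weight vectors, and
the subtracted sum of roots determines the length of the word, so each degree occurs finitely often.
-/
theorem IsHighestWeight.exists_weight_basis {v : V} (hv : K.IsHighestWeight Ψ v) (h0 : v ≠ 0)
    (irr : ∀ N : LieSubmodule ℂ (loopAlg g n) V, N ≠ ⊤ → N = ⊥)
    (hfin : Module.Finite ℂ (Laurent n ⧸ K.killer Ψ)) :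
    ∃ (J : Type u) (b : Module.Basis J ℂ V) (deg : J → (ι →₀ ℕ)), (∀ δ, {j | deg j = δ}.Finite) ∧
      ∀ j (x : K.cartan), ⁅const n (x : g), b j⁆ = (K.topWeight Ψ - K.rootSum (deg j)) x • b j := by
  obtain ⟨S, hS⟩ := hfin.fg_top
  obtain ⟨G, hG⟩ : ∃ G : Finset (Laurent n), ∀ p, ∃ q ∈ Submodule.span ℂ (G : Set (Laurent n)),
      p - q ∈ K.killer Ψ := by
    classical
    refine ⟨S.image (Function.surjInv (Ideal.Quotient.mk_surjective (I := K.killer Ψ))), fun p => ?_⟩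
    let π : Laurent n →ₗ[ℂ] Laurent n ⧸ K.killer Ψ := (Ideal.Quotient.mkₐ ℂ (K.killer Ψ)).toLinearMap
    have h1 : Ideal.Quotient.mk (K.killer Ψ) p ∈ (Submodule.span ℂ ((S.image (Function.surjInv
        (Ideal.Quotient.mk_surjective (I := K.killer Ψ))) : Finset _) : Set (Laurent n))).map π := by
      rw [Submodule.map_span, Finset.coe_image, Set.image_image]
      have : (fun x => π (Function.surjInv
          (Ideal.Quotient.mk_surjective (I := K.killer Ψ)) x)) = id :=
        funext fun x => Function.surjInv_eq (Ideal.Quotient.mk_surjective (I := K.killer Ψ)) x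
      rw [this, Set.image_id, hS]
      exact Submodule.mem_top
    obtain ⟨q, hq, h2⟩ := h1
    exact ⟨q, hq, Ideal.Quotient.eq.mp h2.symm⟩
  obtain ⟨J, a, ha, hspan, hli⟩ := exists_linearIndependent' ℂ (fun l : List (ι × G) =>
      K.word (l.map fun a => (a.1, (a.2 : Laurent n))) v)
  rw [hv.span_finite_words h0 irr hG] at hspan
  refine ⟨J, Module.Basis.mk hli hspan.ge, fun j => content (a j), fun δ => ?_, fun j x => ?_⟩
  · refine Set.Finite.of_finite_image ((List.finite_length_eq (ι × G) δ.degree).subset ?_) ha.injOn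
    rintro _ ⟨j, hj, rfl⟩
    have hj' : content (a j) = δ := hj
    change (a j).length = _
    rw [← hj', degree_content]
  · rw [Module.Basis.mk_apply]
    refine (hv.lie_const_word x _).trans ?_
    rw [LinearMap.sub_apply, rootSum_content, List.map_map]
    rfl

end

/-- `𝔥` acts diagonally in the basis, so a nonzero coordinate of a vector of weight `μ` can only
occur at an index with `wt j = μ`. -/
theorem weightSpace_eq_span {J : Type*} (b : Module.Basis J ℂ (K.simpleMod Ψ))
    (wt : J → Module.Dual ℂ K.cartan)
    (hb : ∀ j (x : K.cartan), K.act (const n (x : g)) (b j) = wt j x • b j)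
    (μ : Module.Dual ℂ K.cartan) :
    K.weightSpace Ψ μ = Submodule.span ℂ (Set.range fun j : {j // wt j = μ} => b j) := by
  classical
  apply le_antisymm
  · intro v hv
    have h1 : ∀ j, b.repr v j ≠ 0 → wt j = μ := by
      intro j hj
      ext x
      have h2 : b.coord j ∘ₗ LieModule.toEnd ℂ (loopAlg g n) (K.simpleMod Ψ) (const n (x : g)) =
          wt j x • b.coord j := by
        refine b.ext fun k => ?_
        rw [LinearMap.comp_apply, LieModule.toEnd_apply_apply, ← act_eq_lie, hb, map_smul,
          LinearMap.smul_apply, Module.Basis.coord_apply, Module.Basis.repr_self,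
          Finsupp.single_apply]
        split_ifs with h
        · rw [h]
        · rw [smul_zero, smul_zero]
      have h3 := LinearMap.congr_fun h2 v
      have h4 : ⁅const n (x : g), v⁆ = μ x • v := hv x
      rw [LinearMap.comp_apply, LieModule.toEnd_apply_apply, h4, map_smul, LinearMap.smul_apply,
        smul_eq_mul, smul_eq_mul, Module.Basis.coord_apply] at h3
      exact (mul_right_cancel₀ hj h3).symm
    have h2 : v ∈ Submodule.span ℂ (b '' {j | wt j = μ}) :=
      (Module.Basis.mem_span_image b).mpr fun j hj => h1 j (Finsupp.mem_support_iff.mp hj)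
    rwa [Set.image_eq_range] at h2
  · refine Submodule.span_le.mpr ?_
    rintro _ ⟨⟨j, rfl⟩, rfl⟩
    exact fun x => hb j x

theorem hasCharacter_of_basis {J : Type*} (b : Module.Basis J ℂ (K.simpleMod Ψ))
    (wt : J → Module.Dual ℂ K.cartan)
    (hb : ∀ j (x : K.cartan), K.act (const n (x : g)) (b j) = wt j x • b j)
    (hwt : ∀ μ, Finite {j // wt j = μ}) : K.HasCharacter Ψ := by
  refine ⟨?_, fun μ => ?_⟩
  · rw [eq_top_iff, ← b.span_eq]
    refine Submodule.span_le.mpr ?_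
    rintro _ ⟨j, rfl⟩
    exact Submodule.mem_iSup_of_mem (wt j) (fun x => hb j x)
  · rw [K.weightSpace_eq_span Ψ b wt hb]
    exact FiniteDimensional.span_of_finite ℂ (Set.finite_range _)

theorem char_of_basis {J : Type*} (b : Module.Basis J ℂ (K.simpleMod Ψ))
    (wt : J → Module.Dual ℂ K.cartan)
    (hb : ∀ j (x : K.cartan), K.act (const n (x : g)) (b j) = wt j x • b j)
    (hwt : ∀ μ, Finite {j // wt j = μ}) (μ : Module.Dual ℂ K.cartan) :
    K.char Ψ μ = Nat.card {j // wt j = μ} := by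
  have := Fintype.ofFinite {j // wt j = μ}
  rw [char, K.weightSpace_eq_span Ψ b wt hb, Nat.card_eq_fintype_card]
  exact finrank_span_eq_card (b.linearIndependent.comp _ Subtype.val_injective)

/-- The weight `Ψ|_𝔥 - ∑ δ_i α_i`. -/
def weightAt (δ : ι →₀ ℕ) : Module.Dual ℂ K.cartan := K.topWeight Ψ - K.rootSum δ

theorem weightAt_injective : Function.Injective (K.weightAt Ψ) := fun _ _ h =>
  K.rootSum_injective (sub_right_injective h)

/-- The character of `V(Ψ)` as a power series. -/
def charSeries : MvPowerSeries ι ℕ := fun δ => K.char Ψ (K.weightAt Ψ δ)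

variable {Ψ} {K}

theorem char_eq_card {J : Type*} (b : Module.Basis J ℂ (K.simpleMod Ψ)) (deg : J → (ι →₀ ℕ))
    (hfin : ∀ δ, {j | deg j = δ}.Finite)
    (hb : ∀ j (x : K.cartan), K.act (const n (x : g)) (b j) = K.weightAt Ψ (deg j) x • b j) :
    K.HasCharacter Ψ ∧ (∀ δ, MvPowerSeries.coeff δ (K.charSeries Ψ) = Nat.card {j // deg j = δ}) ∧
      ∀ μ, K.char Ψ μ ≠ 0 → ∃ δ, μ = K.weightAt Ψ δ := by
  have e : ∀ δ, (fun j => K.weightAt Ψ (deg j) = K.weightAt Ψ δ) = fun j => deg j = δ := fun δ =>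
    funext fun j => propext (K.weightAt_injective Ψ).eq_iff
  have hwt : ∀ μ, Finite {j // K.weightAt Ψ (deg j) = μ} := by
    intro μ
    by_cases h : ∃ δ, μ = K.weightAt Ψ δ
    · obtain ⟨δ, rfl⟩ := h
      rw [e]
      exact (hfin δ).to_subtype
    · have : IsEmpty {j // K.weightAt Ψ (deg j) = μ} := ⟨fun j => h ⟨_, j.2.symm⟩⟩
      infer_instance
  have hc := K.char_of_basis Ψ b (fun j => K.weightAt Ψ (deg j)) hb hwt
  refine ⟨K.hasCharacter_of_basis Ψ b _ hb hwt, fun δ => ?_, fun μ hμ => ?_⟩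
  · exact (hc _).trans (by rw [e])
  · rw [hc] at hμ
    obtain ⟨⟨j, hj⟩⟩ := (Nat.card_ne_zero.mp hμ).1
    exact ⟨_, hj.symm⟩

theorem IsHighestWeight.char_eq_card {V : Type*} [AddCommGroup V] [Module ℂ V]
    [LieRingModule (loopAlg g n) V] [LieModule ℂ (loopAlg g n) V] {v : V}
    (hv : K.IsHighestWeight Ψ v) (h0 : v ≠ 0)
    (irr : ∀ N : LieSubmodule ℂ (loopAlg g n) V, N ≠ ⊤ → N = ⊥)
    {J : Type*} (b : Module.Basis J ℂ V) (deg : J → (ι →₀ ℕ)) (hfin : ∀ δ, {j | deg j = δ}.Finite)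
    (hb : ∀ j (x : K.cartan), ⁅const n (x : g), b j⁆ = K.weightAt Ψ (deg j) x • b j) :
    K.HasCharacter Ψ ∧ (∀ δ, MvPowerSeries.coeff δ (K.charSeries Ψ) = Nat.card {j // deg j = δ}) ∧
      ∀ μ, K.char Ψ μ ≠ 0 → ∃ δ, μ = K.weightAt Ψ δ := by
  obtain ⟨E, hE⟩ := hv.exists_equiv h0 irr
  refine KacMoody.char_eq_card (b.map E.symm) deg hfin fun j x => ?_
  apply E.injective
  rw [hE, map_smul, Module.Basis.map_apply, E.apply_symm_apply, hb]

theorem lie_tensor_basis {V₁ V₂ : Type*} [AddCommGroup V₁] [Module ℂ V₁]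
    [LieRingModule (loopAlg g n) V₁] [LieModule ℂ (loopAlg g n) V₁] [AddCommGroup V₂] [Module ℂ V₂]
    [LieRingModule (loopAlg g n) V₂] [LieModule ℂ (loopAlg g n) V₂]
    {Ψ₁ Ψ₂ : Module.Dual ℂ (K.loopCartan n)} {J₁ J₂ : Type*} (b₁ : Module.Basis J₁ ℂ V₁)
    (b₂ : Module.Basis J₂ ℂ V₂) (d₁ : J₁ → (ι →₀ ℕ)) (d₂ : J₂ → (ι →₀ ℕ))
    (hb₁ : ∀ j (x : K.cartan), ⁅const n (x : g), b₁ j⁆ = K.weightAt Ψ₁ (d₁ j) x • b₁ j)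
    (hb₂ : ∀ j (x : K.cartan), ⁅const n (x : g), b₂ j⁆ = K.weightAt Ψ₂ (d₂ j) x • b₂ j)
    (j : J₁ × J₂) (x : K.cartan) :
    ⁅const n (x : g), b₁.tensorProduct b₂ j⁆ =
      K.weightAt (Ψ₁ + Ψ₂) (d₁ j.1 + d₂ j.2) x • b₁.tensorProduct b₂ j := by
  rw [Module.Basis.tensorProduct_apply', TensorProduct.LieModule.lie_tmul_right, hb₁, hb₂,
    ← TensorProduct.smul_tmul', TensorProduct.tmul_smul, ← add_smul]
  congr 1
  rw [weightAt, weightAt, weightAt, map_add, topWeight_add]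
  simp only [LinearMap.sub_apply, LinearMap.add_apply]
  ring

/-- The tensor product is irreducible of highest weight `Ψ₁ + Ψ₂`, so it computes the character of
`V(Ψ₁ + Ψ₂)`; degrees add in the tensor product of weight bases. -/
theorem IsHighestWeight.char_tmul {V₁ V₂ : Type*} [AddCommGroup V₁] [Module ℂ V₁]
    [LieRingModule (loopAlg g n) V₁] [LieModule ℂ (loopAlg g n) V₁] [AddCommGroup V₂] [Module ℂ V₂]
    [LieRingModule (loopAlg g n) V₂] [LieModule ℂ (loopAlg g n) V₂]
    {Ψ₁ Ψ₂ : Module.Dual ℂ (K.loopCartan n)} {v₁ : V₁} {v₂ : V₂}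
    (hv₁ : K.IsHighestWeight Ψ₁ v₁) (hv₂ : K.IsHighestWeight Ψ₂ v₂) (h1 : v₁ ≠ 0) (h2 : v₂ ≠ 0)
    (irr₁ : ∀ N : LieSubmodule ℂ (loopAlg g n) V₁, N ≠ ⊤ → N = ⊥)
    (irr₂ : ∀ N : LieSubmodule ℂ (loopAlg g n) V₂, N ≠ ⊤ → N = ⊥)
    (hf₁ : Module.Finite ℂ (Laurent n ⧸ K.killer Ψ₁))
    (hf₂ : Module.Finite ℂ (Laurent n ⧸ K.killer Ψ₂))
    (hI : IsCoprime (K.killer Ψ₁) (K.killer Ψ₂)) :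
    K.charSeries (Ψ₁ + Ψ₂) = K.charSeries Ψ₁ * K.charSeries Ψ₂ := by
  obtain ⟨J₁, b₁, d₁, hd₁, hb₁⟩ := hv₁.exists_weight_basis h1 irr₁ hf₁
  obtain ⟨J₂, b₂, d₂, hd₂, hb₂⟩ := hv₂.exists_weight_basis h2 irr₂ hf₂
  obtain ⟨hv, h0, irr⟩ := hv₁.tmul hv₂ h1 h2 irr₁ irr₂ hI
  have hfib := natCard_add_fiber d₁ d₂ hd₁ hd₂
  have h := (hv.char_eq_card h0 irr (b₁.tensorProduct b₂) (fun p => d₁ p.1 + d₂ p.2)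
    (fun δ => (hfib δ).1) (lie_tensor_basis b₁ b₂ d₁ d₂ hb₁ hb₂)).2.1
  ext δ
  rw [h, (hfib δ).2, MvPowerSeries.coeff_mul]
  refine Finset.sum_congr rfl fun x _ => ?_
  rw [(hv₁.char_eq_card h1 irr₁ b₁ d₁ hd₁ hb₁).2.1, (hv₂.char_eq_card h2 irr₂ b₂ d₂ hd₂ hb₂).2.1]

theorem hasCharacter_of_finite (hfin : Module.Finite ℂ (Laurent n ⧸ K.killer Ψ)) :
    K.HasCharacter Ψ ∧ ∀ μ, K.char Ψ μ ≠ 0 → ∃ δ, μ = K.weightAt Ψ δ := by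
  obtain ⟨J, b, deg, h1, h2⟩ := (K.simple_isHighestWeight Ψ).exists_weight_basis
    (K.simpleGen_ne_zero Ψ) (K.simple_irreducible Ψ) hfin
  exact ⟨(char_eq_card b deg h1 h2).1, (char_eq_card b deg h1 h2).2.2⟩

theorem charSeries_add {Ψ₁ Ψ₂ : Module.Dual ℂ (K.loopCartan n)}
    (h₁ : Module.Finite ℂ (Laurent n ⧸ K.killer Ψ₁))
    (h₂ : Module.Finite ℂ (Laurent n ⧸ K.killer Ψ₂))
    (hI : IsCoprime (K.killer Ψ₁) (K.killer Ψ₂)) :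
    K.charSeries (Ψ₁ + Ψ₂) = K.charSeries Ψ₁ * K.charSeries Ψ₂ :=
  (K.simple_isHighestWeight Ψ₁).char_tmul (K.simple_isHighestWeight Ψ₂)
    (K.simpleGen_ne_zero Ψ₁) (K.simpleGen_ne_zero Ψ₂) (K.simple_irreducible Ψ₁)
    (K.simple_irreducible Ψ₂) h₁ h₂ hI

/-- The twist is the identity on `𝔥 ⊗ 1`, so the twisting isomorphism preserves weight spaces. -/
theorem char_twistFun (a : Fin n → ℂˣ) : K.char (K.twistFun a Ψ) = K.char Ψ := by
  obtain ⟨E, hE⟩ := K.exists_twist_equiv Ψ a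
  funext μ
  refine (E.ofSubmodules _ _ ?_).finrank_eq
  ext w
  rw [Submodule.mem_map_equiv]
  change (∀ x : K.cartan, K.act (const n (x : g)) (E.symm w) = μ x • E.symm w) ↔
    ∀ x : K.cartan, K.act (const n (x : g)) w = μ x • w
  refine forall_congr' fun x => ?_
  rw [← E.injective.eq_iff, hE, map_smul, E.apply_symm_apply, twist_const]

theorem topWeight_twistFun (a : Fin n → ℂˣ) : K.topWeight (K.twistFun a Ψ) = K.topWeight Ψ := by
  ext x
  refine congrArg Ψ (Subtype.ext ?_)
  have h := congrArg Subtype.val (twist_const (n := n) a (x : g))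
  exact h

theorem charSeries_twistFun (a : Fin n → ℂˣ) :
    K.charSeries (K.twistFun a Ψ) = K.charSeries Ψ := by
  funext δ
  rw [charSeries, charSeries, char_twistFun, weightAt, weightAt, topWeight_twistFun]

theorem twistFun_cartanMono (a : Fin n → ℂˣ) (x : K.cartan') (m : Fin n → ℤ) :
    K.twistFun a Ψ (K.cartanMono x m) = (expo a m : ℂ) * Ψ (K.cartanMono x m) := by
  rw [← smul_eq_mul, ← map_smul]
  refine congrArg Ψ (Subtype.ext ?_)
  change scale a (mono m) ⊗ₜ[ℂ] (x : g) = (expo a m : ℂ) • (mono m ⊗ₜ[ℂ] (x : g))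
  rw [scale_mono, TensorProduct.smul_tmul']

end KacMoody

/-! ### Powers of formal characters -/

/-- The formal sum is `e^{μ₀}` times the power series `P` in the exponentials `e^{-θ δ}`, and `θ` is
injective. Finiteness holds because `δ` has finitely many decompositions into `R` summands. -/
theorem formalPow_eq_coeff {W ι : Type*} [AddCommGroup W] (χ : W → ℕ) (θ : (ι →₀ ℕ) →+ W)
    (hθ : Function.Injective θ) (μ₀ : W) (hχ : ∀ μ, χ μ ≠ 0 → ∃ δ, μ = μ₀ - θ δ)
    (P : MvPowerSeries ι ℕ) (hP : ∀ δ, MvPowerSeries.coeff δ P = χ (μ₀ - θ δ)) (R : ℕ) :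
    (∀ μ, (powTerms χ R μ).Finite) ∧
      (∀ δ, formalPow χ R (R • μ₀ - θ δ) = MvPowerSeries.coeff δ (P ^ R)) ∧
        ∀ μ, formalPow χ R μ ≠ 0 → ∃ δ, μ = R • μ₀ - θ δ := by
  classical
  let F : (Fin R →₀ (ι →₀ ℕ)) → Fin R → W := fun s i => μ₀ - θ (s i)
  have hF : Function.Injective F := fun s s' h =>
    Finsupp.ext fun i => hθ (sub_right_injective (congrFun h i))
  have hsum : ∀ s, ∑ i, F s i = R • μ₀ - θ (∑ i, s i) := fun s => by
    rw [map_sum, Finset.sum_sub_distrib, Finset.sum_const, Finset.card_univ, Fintype.card_fin]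
  have hex : ∀ ν : Fin R → W, ∏ i, χ (ν i) ≠ 0 → ∃ s, ν = F s := by
    intro ν hν
    choose d hd using fun i => hχ (ν i) (Finset.prod_ne_zero_iff.mp hν i (Finset.mem_univ i))
    exact ⟨Finsupp.equivFunOnFinite.symm d, funext hd⟩
  have hsub : ∀ δ, powTerms χ R (R • μ₀ - θ δ) ⊆
      ((Finset.univ.finsuppAntidiag δ).image F : Finset (Fin R → W)) := by
    rintro δ ν ⟨h1, h2⟩
    obtain ⟨s, rfl⟩ := hex ν h2
    rw [hsum] at h1
    exact Finset.mem_coe.mpr (Finset.mem_image_of_mem F (Finset.mem_finsuppAntidiag.mpr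
      ⟨hθ (sub_right_injective h1), Finset.subset_univ _⟩))
  have hne : ∀ μ, (powTerms χ R μ).Nonempty → ∃ δ, μ = R • μ₀ - θ δ := by
    rintro μ ⟨ν, h1, h2⟩
    obtain ⟨s, rfl⟩ := hex ν h2
    exact ⟨_, h1.symm.trans (hsum s)⟩
  refine ⟨fun μ => ?_, fun δ => ?_, fun μ hμ => ?_⟩
  · rcases (powTerms χ R μ).eq_empty_or_nonempty with h | h
    · rw [h]; exact Set.finite_empty
    · obtain ⟨δ, rfl⟩ := hne μ h
      exact (Finset.finite_toSet _).subset (hsub δ)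
  -- `powTerms` contains only tuples with nonzero product, while the finite set of decompositions of
  -- `δ` also has those with zero product; the two agree on the support of the product.
  · have h : powTerms χ R (R • μ₀ - θ δ) ∩ Function.support (fun ν : Fin R → W => ∏ i, χ (ν i)) =
        (((Finset.univ.finsuppAntidiag δ).image F : Finset (Fin R → W)) : Set (Fin R → W)) ∩
          Function.support (fun ν : Fin R → W => ∏ i, χ (ν i)) := by
      refine Set.Subset.antisymm (Set.inter_subset_inter_left _ (hsub δ)) ?_
      rintro ν ⟨h1, h2⟩
      refine ⟨⟨?_, h2⟩, h2⟩
      obtain ⟨s, hs, rfl⟩ := Finset.mem_image.mp (Finset.mem_coe.mp h1)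
      rw [hsum, (Finset.mem_finsuppAntidiag.mp hs).1]
    rw [formalPow, finsum_mem_eq_sum_of_inter_support_eq _ h, Finset.sum_image hF.injOn]
    have h2 : P ^ R = ∏ _i : Fin R, P := by
      rw [Finset.prod_const, Finset.card_univ, Fintype.card_fin]
    rw [h2, MvPowerSeries.coeff_prod]
    exact Finset.sum_congr rfl fun s _ => Finset.prod_congr rfl fun i _ => (hP _).symm
  · refine hne μ ?_
    by_contra h
    rw [Set.not_nonempty_iff_eq_empty] at h
    rw [formalPow, h, finsum_mem_empty] at hμ
    exact hμ rfl

/-- A common point has a unique representative in `B`, so the two tuples of roots of unity coincide;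
primitivity then gives `k = k'`. -/
theorem disjoint_image_rootTuple {n : ℕ} {r : Fin n → ℕ} {ξ : Fin n → ℂˣ}
    (hξ : ∀ i, IsPrimitiveRoot (ξ i) (r i)) {B : Set (Fin n → ℂˣ)} (hB : IsTransversal r ξ B)
    {k k' : (i : Fin n) → Fin (r i)} (h : k ≠ k') :
    Disjoint ((rootTuple ξ k * ·) '' B) ((rootTuple ξ k' * ·) '' B) := by
  rw [Set.disjoint_left]
  rintro a ⟨b, hb, hab⟩ ⟨b', hb', hab'⟩
  have hbb : b = b' := (hB a).unique ⟨hb, k, hab.symm⟩ ⟨hb', k', hab'.symm⟩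
  subst hbb
  refine h (funext fun i => Fin.ext ?_)
  have h1 : rootTuple ξ k = rootTuple ξ k' := mul_right_cancel (hab.trans hab'.symm)
  exact (hξ i).pow_inj (k i).2 (k' i).2 (congrFun h1 i)

/-! ### The character of an orbit sum -/

namespace KacMoody

variable {ι : Type*} {g : Type*} [Fintype ι] [DecidableEq ι] {C : Matrix ι ι ℤ} [LieRing g]
  [LieAlgebra ℂ g] (K : KacMoody C g) {n : ℕ}

/-- The exponents of the partial sums are carried through the induction, since comaximality with the
next summand rests on them. The induction starts at one summand, which avoids determining `V(0)`. -/
theorem charSeries_sum {κ : Type*} {T : Finset κ} (hT : T.Nonempty)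
    (Ψ : κ → Module.Dual ℂ (K.loopCartan n)) (B : κ → Set (Fin n → ℂˣ))
    (hB : ∀ k k', k ≠ k' → Disjoint (B k) (B k'))
    (h : ∀ k, ∀ x : K.cartan', IsExpPolyOn (B k) fun m => Ψ k (K.cartanMono x m)) :
    (∀ x : K.cartan', IsExpPolyOn (⋃ k ∈ T, B k) fun m => (∑ k ∈ T, Ψ k) (K.cartanMono x m)) ∧
      K.charSeries (∑ k ∈ T, Ψ k) = ∏ k ∈ T, K.charSeries (Ψ k) := by
  induction hT using Finset.Nonempty.cons_induction with
  | singleton k =>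
    rw [Finset.sum_singleton, Finset.prod_singleton]
    exact ⟨fun x => (h k x).mono (by simp), rfl⟩
  | cons k T hk hT ih =>
    rw [Finset.sum_cons, Finset.prod_cons]
    refine ⟨fun x => ?_, ?_⟩
    · refine ((h k x).mono ?_).add ((ih.1 x).mono ?_)
      · exact Set.subset_biUnion_of_mem (u := B) (Finset.mem_cons_self k T)
      · exact Set.biUnion_subset_biUnion_left fun k' hk' => Finset.mem_cons_of_mem hk'
    · have h1 := K.killer_supportedOn (h k)
      have h2 := K.killer_supportedOn ih.1
      rw [charSeries_add h1.finite_quotient h2.finite_quotient (h1.isCoprime ?_ h2), ih.2]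
      refine Set.disjoint_iUnion₂_right.mpr fun k' hk' => hB k k' ?_
      rintro rfl
      exact hk hk'

/-- The character formula for `∑_k ξ^k Φ`. -/
theorem char_eq_formalPow {r : Fin n → ℕ} (hr : ∀ i, 0 < r i) {ξ : Fin n → ℂˣ}
    (hξ : ∀ i, IsPrimitiveRoot (ξ i) (r i)) {B : Set (Fin n → ℂˣ)} (hB : IsTransversal r ξ B)
    {ψ Φ : Module.Dual ℂ (K.loopCartan n)} (h : IsDecomposition K r ξ B ψ Φ) :
    (K.HasCharacter ψ ∧ K.HasCharacter Φ) ∧ (∀ μ, (powTerms (K.char Φ) (∏ i, r i) μ).Finite) ∧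
      K.char ψ = formalPow (K.char Φ) (∏ i, r i) := by
  obtain ⟨hΦ, rfl⟩ := h
  have : ∀ i, Nonempty (Fin (r i)) := fun i => ⟨⟨0, hr i⟩⟩
  have hcard : (Finset.univ : Finset ((i : Fin n) → Fin (r i))).card = ∏ i, r i := by
    rw [Finset.card_univ, Fintype.card_pi]
    exact Finset.prod_congr rfl fun i _ => Fintype.card_fin _
  obtain ⟨h1, h2⟩ := K.charSeries_sum Finset.univ_nonempty
    (fun k : (i : Fin n) → Fin (r i) => K.twistFun (rootTuple ξ k) Φ)
    (fun k => (rootTuple ξ k * ·) '' B) (fun k k' => disjoint_image_rootTuple hξ hB) (fun k x => by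
      simp_rw [twistFun_cartanMono]
      exact (hΦ x).twist _)
  set ψ := ∑ k : (i : Fin n) → Fin (r i), K.twistFun (rootTuple ξ k) Φ
  simp_rw [charSeries_twistFun] at h2
  rw [Finset.prod_const, hcard] at h2
  obtain ⟨hcψ, hψ⟩ := hasCharacter_of_finite (K.killer_supportedOn h1).finite_quotient
  obtain ⟨hcΦ, hΦ'⟩ := hasCharacter_of_finite (K.killer_supportedOn hΦ).finite_quotient
  have htop : K.topWeight ψ = (∏ i, r i) • K.topWeight Φ := by
    rw [← hcard, ← Finset.sum_const, ← Finset.sum_congr rfl fun k _ =>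
      topWeight_twistFun (Ψ := Φ) (rootTuple ξ k)]
    ext x
    rw [LinearMap.sum_apply]
    exact LinearMap.sum_apply _ _ _
  obtain ⟨h3, h4, h5⟩ := formalPow_eq_coeff (K.char Φ) K.rootSum.toAddMonoidHom
    K.rootSum_injective (K.topWeight Φ) hΦ' (K.charSeries Φ) (fun _ => rfl) (∏ i, r i)
  rw [← htop] at h4 h5
  refine ⟨⟨hcψ, hcΦ⟩, h3, funext fun μ => ?_⟩
  -- On the cone below the highest weight both sides are coefficients of the same power series; off
  -- the cone both vanish.
  by_cases hμ : ∃ δ, μ = K.weightAt ψ δ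
  · obtain ⟨δ, rfl⟩ := hμ
    refine Eq.trans ?_ (h4 δ).symm
    rw [← h2]
    rfl
  · rw [not_not.mp fun h => hμ (hψ μ h)]
    exact (not_not.mp fun h => hμ (h5 μ h)).symm

end KacMoody

/-! ### Existence of the decomposition -/

section

variable {n : ℕ}

/-- The exp-polynomial function with given coefficients. -/
def expPoly : ((Fin n → ℂˣ) →₀ MvPolynomial (Fin n) ℂ) →ₗ[ℂ] (Fin n → ℤ) → ℂ :=
  Finsupp.lsum ℂ fun a => LinearMap.pi fun m =>
    (expo a m : ℂ) • (MvPolynomial.aeval fun i => (m i : ℂ)).toLinearMap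

theorem expPoly_apply (p : (Fin n → ℂˣ) →₀ MvPolynomial (Fin n) ℂ) (m : Fin n → ℤ) :
    expPoly p m = p.sum fun a q => MvPolynomial.eval (fun i => (m i : ℂ)) q * (expo a m : ℂ) := by
  rw [expPoly, Finsupp.lsum_apply, Finsupp.sum, Finset.sum_apply]
  refine Finset.sum_congr rfl fun a _ => ?_
  rw [LinearMap.pi_apply, LinearMap.smul_apply, smul_eq_mul, mul_comm]
  rfl

theorem expo_rootTuple {r : Fin n → ℕ} (ξ : Fin n → ℂˣ) (k : (i : Fin n) → Fin (r i))
    (m : Fin n → ℤ) : expo (rootTuple ξ k) m = ∏ i, (ξ i ^ m i) ^ (k i : ℕ) :=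
  Finset.prod_congr rfl fun i _ => by
    rw [rootTuple, ← zpow_natCast, ← zpow_natCast, ← zpow_mul, ← zpow_mul, mul_comm]

/-- For fixed `m` a character of a finite group is summed over the group. If it is trivial, the
extra factor is `1`; otherwise one of the geometric sums into which the sum factors vanishes. -/
theorem sum_expo_rootTuple_mul {r : Fin n → ℕ} {ξ : Fin n → ℂˣ}
    (hξ : ∀ i, IsPrimitiveRoot (ξ i) (r i)) (m : Fin n → ℤ) (k' : (i : Fin n) → Fin (r i)) :
    (∑ k : (i : Fin n) → Fin (r i), (expo (rootTuple ξ k) m : ℂ)) * (expo (rootTuple ξ k') m : ℂ) =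
      ∑ k : (i : Fin n) → Fin (r i), (expo (rootTuple ξ k) m : ℂ) := by
  by_cases h : ∀ i, ξ i ^ m i = 1
  · have : expo (rootTuple ξ k') m = 1 := by
      rw [expo_rootTuple]
      exact Finset.prod_eq_one fun i _ => by rw [h, one_pow]
    rw [this, Units.val_one, mul_one]
  · obtain ⟨i, hi⟩ := not_forall.mp h
    have h0 : ∑ k : (i : Fin n) → Fin (r i), (expo (rootTuple ξ k) m : ℂ) = 0 := by
      have h1 := Finset.prod_univ_sum (fun i => (Finset.univ : Finset (Fin (r i))))
        (fun i j => (((ξ i ^ m i : ℂˣ) : ℂ)) ^ (j : ℕ))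
      rw [Fintype.piFinset_univ] at h1
      simp_rw [expo_rootTuple, Units.coe_prod, Units.val_pow_eq_pow_val]
      rw [← h1]
      refine Finset.prod_eq_zero (Finset.mem_univ i) ?_
      rw [Fin.sum_univ_eq_sum_range (fun j => ((ξ i ^ m i : ℂˣ) : ℂ) ^ j)]
      have h2 : ((ξ i ^ m i : ℂˣ) : ℂ) - 1 ≠ 0 := fun h =>
        hi (Units.ext (sub_eq_zero.mp h))
      refine (mul_eq_zero.mp (?_ : _ * (((ξ i ^ m i : ℂˣ) : ℂ) - 1) = 0)).resolve_right h2
      rw [geom_sum_mul, ← Units.val_pow_eq_pow_val, ← zpow_natCast, ← zpow_mul, mul_comm, zpow_mul,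
        zpow_natCast, (hξ i).pow_eq_one, one_zpow, Units.val_one, sub_self]
    rw [h0, zero_mul]

theorem scale_eq_of_mem_subLaurent {r : Fin n → ℕ} {ξ : Fin n → ℂˣ}
    (hξ : ∀ i, IsPrimitiveRoot (ξ i) (r i)) (k : (i : Fin n) → Fin (r i)) {p : Laurent n}
    (hp : p ∈ subLaurent r) : scale (rootTuple ξ k) p = p := by
  have : subLaurent r ≤ AlgHom.equalizer (scale (rootTuple ξ k)) (AlgHom.id ℂ (Laurent n)) := by
    refine Algebra.adjoin_le ?_
    rintro _ ⟨m, hm, rfl⟩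
    change scale (rootTuple ξ k) (mono m) = mono m
    rw [scale_mono, expo_rootTuple, Finset.prod_eq_one, Units.val_one, one_smul]
    intro i _
    obtain ⟨c, hc⟩ := hm i
    rw [hc, zpow_mul, zpow_natCast, (hξ i).pow_eq_one, one_zpow, one_pow]
  exact this hp

theorem mono_ne_zero (m : Fin n → ℤ) : (mono m : Laurent n) ≠ 0 := fun h => by
  have h1 := evalPoint_mono 1 m
  rw [h, map_zero] at h1
  exact (expo (1 : Fin n → ℂˣ) m).ne_zero h1.symm

/-- The representative in a transversal. -/
def IsTransversal.rep {r : Fin n → ℕ} {ξ : Fin n → ℂˣ} {B : Set (Fin n → ℂˣ)}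
    (hB : IsTransversal r ξ B) (a : Fin n → ℂˣ) : Fin n → ℂˣ := (hB a).choose

/-- Moving the exponents into a transversal does not change the orbit sum. -/
theorem sum_expo_mul_expPoly_rep {r : Fin n → ℕ} {ξ : Fin n → ℂˣ}
    (hξ : ∀ i, IsPrimitiveRoot (ξ i) (r i)) {B : Set (Fin n → ℂˣ)} (hB : IsTransversal r ξ B)
    (p : (Fin n → ℂˣ) →₀ MvPolynomial (Fin n) ℂ) (m : Fin n → ℤ) :
    (∑ k : (i : Fin n) → Fin (r i), (expo (rootTuple ξ k) m : ℂ)) *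
        expPoly (p.mapDomain hB.rep) m =
      (∑ k : (i : Fin n) → Fin (r i), (expo (rootTuple ξ k) m : ℂ)) * expPoly p m := by
  rw [expPoly_apply, expPoly_apply,
    Finsupp.sum_mapDomain_index (by simp) (by intros; rw [map_add, add_mul]), Finsupp.mul_sum,
    Finsupp.mul_sum]
  -- Each exponent differs from its representative by some `ξ^k`, and the orbit sum absorbs the
  -- factor `expo (rootTuple ξ k) m`.
  refine Finsupp.sum_congr fun a _ => ?_
  obtain ⟨-, k, hk⟩ := (hB a).choose_spec.1
  have h : expo a m = expo (rootTuple ξ k) m * expo (hB.rep a) m := by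
    rw [← expo_mul]; exact congrArg (expo · m) hk
  rw [h, Units.val_mul, mul_left_comm, mul_left_comm _ (MvPolynomial.eval _ _),
    ← mul_assoc _ (expo (rootTuple ξ k) m : ℂ), sum_expo_rootTuple_mul hξ]

end

namespace KacMoody

variable {ι : Type*} {g : Type*} [Fintype ι] [DecidableEq ι] {C : Matrix ι ι ℤ} [LieRing g]
  [LieAlgebra ℂ g] (K : KacMoody C g) {n : ℕ}

theorem cartanMono_add (x y : K.cartan') (m : Fin n → ℤ) :
    K.cartanMono (x + y) m = K.cartanMono x m + K.cartanMono y m :=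
  Subtype.ext (TensorProduct.tmul_add (mono m) (x : g) y)

theorem cartanMono_smul (c : ℂ) (x : K.cartan') (m : Fin n → ℤ) :
    K.cartanMono (c • x) m = c • K.cartanMono x m :=
  Subtype.ext (TensorProduct.tmul_smul c (mono m) (x : g))

/-- An exp-polynomial functional has a linear family of coefficients. -/
theorem exists_linear_coeff {ψ : Module.Dual ℂ (K.loopCartan n)}
    (hψ : ∀ x : K.cartan', IsExpPolyOn Set.univ fun m => ψ (K.cartanMono x m)) :
    ∃ Λ : K.cartan' →ₗ[ℂ] (Fin n → ℂˣ) →₀ MvPolynomial (Fin n) ℂ,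
      ∀ x m, expPoly (Λ x) m = ψ (K.cartanMono x m) := by
  -- Coefficients are chosen on a basis and extended linearly, so uniqueness of exp-polynomial
  -- expressions is not needed.
  let b := Module.Basis.ofVectorSpace ℂ K.cartan'
  choose p _ hp using hψ
  refine ⟨b.constr ℂ fun j => p (b j), fun x m => ?_⟩
  let T : K.cartan' →ₗ[ℂ] ℂ :=
    { toFun := fun x => ψ (K.cartanMono x m)
      map_add' := fun x y => by rw [cartanMono_add, map_add]
      map_smul' := fun c x => by rw [cartanMono_smul, map_smul]; rfl }
  have : LinearMap.proj m ∘ₗ expPoly ∘ₗ b.constr ℂ (fun j => p (b j)) = T := by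
    refine b.ext fun j => ?_
    change expPoly (b.constr ℂ (fun j => p (b j)) (b j)) m = ψ (K.cartanMono (b j) m)
    rw [Module.Basis.constr_basis, expPoly_apply]
    exact (hp _ m).symm
  exact LinearMap.congr_fun this x

/-- Functionals on `𝔥_A` with prescribed values on `𝔥' ⊗ A` and on a complement of `𝔥'`. -/
theorem exists_dual (φ : (Fin n → ℤ) → Module.Dual ℂ K.cartan') (π : g →ₗ[ℂ] K.cartan')
    (hπ : ∀ x : K.cartan', π x = x) (ω : Module.Dual ℂ K.cartan) :
    ∃ Φ : Module.Dual ℂ (K.loopCartan n), (∀ x m, Φ (K.cartanMono x m) = φ m x) ∧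
      ∀ x : K.cartan, π x = 0 → Φ (K.cartanConst n x) = ω x := by
  obtain ⟨τ, hτ⟩ := LinearMap.exists_extend ω
  let T : Laurent n →ₗ[ℂ] Module.Dual ℂ K.cartan' :=
    Finsupp.linearCombination ℂ φ ∘ₗ (AddMonoidAlgebra.coeffLinearEquiv ℂ).toLinearMap
  have hT : ∀ m, T (mono m) = φ m := fun m => by simp [T, mono]
  -- The first term prescribes the values on `𝔥' ⊗ A`. The second vanishes there and gives `ω` on
  -- `ker π` inside `𝔥`; the evaluation at `(1, …, 1)` serves only as a functional on `A` with `1 ↦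
  -- 1`.
  let S : Laurent n →ₗ[ℂ] Module.Dual ℂ g :=
    LinearMap.lcomp ℂ ℂ π ∘ₗ T +
      (evalPoint 1).toLinearMap.smulRight (τ - τ ∘ₗ K.cartan'.subtype ∘ₗ π)
  have hS : ∀ p x, S p x = T p (π x) + evalPoint 1 p * (τ x - τ (π x)) := fun p x => rfl
  refine ⟨TensorProduct.lift S ∘ₗ (K.loopCartan n).subtype, fun x m => ?_, fun x hx => ?_⟩
  · refine (TensorProduct.lift.tmul (f' := S) _ _).trans ?_
    rw [hS, hπ, hT, sub_self, mul_zero, add_zero]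
  · refine (TensorProduct.lift.tmul (f' := S) _ _).trans ?_
    rw [hS, hx, map_zero, map_one, one_mul, ZeroMemClass.coe_zero, map_zero, sub_zero, zero_add]
    exact LinearMap.congr_fun hτ x

theorem dual_ext (π : g →ₗ[ℂ] K.cartan') (hπ : ∀ x : K.cartan', π x = x)
    {Φ Φ' : Module.Dual ℂ (K.loopCartan n)}
    (h : ∀ x m, Φ (K.cartanMono x m) = Φ' (K.cartanMono x m))
    (h' : ∀ x : K.cartan, π x = 0 → Φ (K.cartanConst n x) = Φ' (K.cartanConst n x)) : Φ = Φ' := by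
  refine LinearMap.ext fun z => ?_
  induction z using K.loopCartan_induction with
  | elt p x =>
    let c : Laurent n →ₗ[ℂ] K.loopCartan n :=
      { toFun := fun p => K.cartanElt p x
        map_add' := fun p q => Subtype.ext (TensorProduct.add_tmul p q (x : g))
        map_smul' := fun c p => Subtype.ext (TensorProduct.smul_tmul' c p (x : g)).symm }
    exact laurent_hom_ext (f := Φ ∘ₗ c) (f' := Φ' ∘ₗ c) (fun m => h x m) p
  | const x =>
    let y : K.cartan := ⟨(x : g) - π x, sub_mem x.2 (π x).2.1⟩
    have hy : π y = 0 := by rw [map_sub, hπ, sub_self]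
    have hx : K.cartanConst n x = K.cartanMono (π x) 0 + K.cartanConst n y := by
      apply Subtype.ext
      change (1 : Laurent n) ⊗ₜ[ℂ] (x : g) = 1 ⊗ₜ (π x : g) + 1 ⊗ₜ ((x : g) - π x)
      rw [← TensorProduct.tmul_add, add_sub_cancel]
    rw [hx, map_add, map_add, h, h' y hy]
  | add x y hx hy => rw [map_add, map_add, hx, hy]

theorem exists_decomposition {r : Fin n → ℕ} (hr : ∀ i, 0 < r i) {ξ : Fin n → ℂˣ}
    (hξ : ∀ i, IsPrimitiveRoot (ξ i) (r i)) {B : Set (Fin n → ℂˣ)} (hB : IsTransversal r ξ B)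
    {ψ : Module.Dual ℂ (K.loopCartan n)}
    (hψ : ∀ x : K.cartan', IsExpPolyOn Set.univ fun m => ψ (K.cartanMono x m))
    (hA : K.imageAlg ψ ≤ subLaurent r) : ∃ Φ, IsDecomposition K r ξ B ψ Φ := by
  classical
  obtain ⟨Λ, hΛ⟩ := K.exists_linear_coeff hψ
  obtain ⟨π, hπ⟩ := LinearMap.exists_leftInverse_of_injective K.cartan'.subtype
    (LinearMap.ker_eq_bot.mpr K.cartan'.subtype_injective)
  have hπ' : ∀ x : K.cartan', π x = x := LinearMap.congr_fun hπ
  have : ∀ i, Nonempty (Fin (r i)) := fun i => ⟨⟨0, hr i⟩⟩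
  have hR : (Fintype.card ((i : Fin n) → Fin (r i)) : ℂ) ≠ 0 :=
    Nat.cast_ne_zero.mpr Fintype.card_ne_zero
  set R : ℂ := (Fintype.card ((i : Fin n) → Fin (r i)) : ℂ)
  -- The coefficients of `ψ` with all exponents moved into `B`, divided by the number of group
  -- elements. On the complement of `𝔥'`, where the twists are trivial, `Φ` is likewise `ψ / R`.
  let P : K.cartan' →ₗ[ℂ] (Fin n → ℂˣ) →₀ MvPolynomial (Fin n) ℂ :=
    R⁻¹ • Finsupp.lmapDomain _ ℂ hB.rep ∘ₗ Λ
  obtain ⟨Φ, h1, h2⟩ := K.exists_dual (fun m => LinearMap.proj m ∘ₗ expPoly ∘ₗ P) π hπ'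
    (R⁻¹ • K.topWeight ψ)
  have h1' : ∀ x m, Φ (K.cartanMono x m) = expPoly (P x) m := h1
  -- Elements of `ℂ[t^{±r}]` are fixed by the scalings `ξ^k`; for `ψ(x ⊗ t^m) t^m` this means that
  -- `ψ(x ⊗ t^m)` absorbs the factor `expo (rootTuple ξ k) m`.
  have hinv : ∀ (k : (i : Fin n) → Fin (r i)) x m,
      (expo (rootTuple ξ k) m : ℂ) * ψ (K.cartanMono x m) = ψ (K.cartanMono x m) := by
    intro k x m
    have h3 := scale_eq_of_mem_subLaurent hξ k (hA (Algebra.subset_adjoin ⟨x, m, rfl⟩))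
    rw [map_smul, scale_mono, smul_smul] at h3
    rw [mul_comm]
    exact smul_left_injective ℂ (mono_ne_zero m) h3
  refine ⟨Φ, fun x => ⟨P x, ?_, fun m => (h1' x m).trans (expPoly_apply _ m)⟩, ?_⟩
  · intro a ha
    have h3 := Finset.mem_coe.mp ha
    have h4 := Finsupp.mapDomain_support (Finsupp.support_smul h3)
    obtain ⟨c, -, rfl⟩ := Finset.mem_image.mp h4
    exact (hB c).choose_spec.1.1
  · refine K.dual_ext π hπ' (fun x m => ?_) (fun x hx => ?_)
    · rw [LinearMap.sum_apply]
      simp_rw [twistFun_cartanMono]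
      rw [← Finset.sum_mul, h1']
      change _ = _ * expPoly (R⁻¹ • (Λ x).mapDomain hB.rep) m
      rw [map_smul, Pi.smul_apply, smul_eq_mul, mul_left_comm, sum_expo_mul_expPoly_rep hξ hB, hΛ,
        Finset.sum_mul, Finset.sum_congr rfl fun k _ => hinv k x m, Finset.sum_const,
        Finset.card_univ, nsmul_eq_mul, inv_mul_cancel_left₀ hR]
    · rw [LinearMap.sum_apply]
      have h3 : ∀ k : (i : Fin n) → Fin (r i),
          K.twistFun (rootTuple ξ k) Φ (K.cartanConst n x) = R⁻¹ * ψ (K.cartanConst n x) :=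
        fun k => (LinearMap.congr_fun (topWeight_twistFun (Ψ := Φ) (rootTuple ξ k)) x).trans (h2 x hx)
      rw [Finset.sum_congr rfl fun k _ => h3 k, Finset.sum_const, Finset.card_univ, nsmul_eq_mul,
        mul_inv_cancel_left₀ hR]

end KacMoody

end LoopKM

end

theorem proposition5p1 {ι g : Type*} [Fintype ι] [DecidableEq ι] {C : Matrix ι ι ℤ}
    (hC : LoopKM.IsGCM C) [LieRing g] [LieAlgebra ℂ g] (K : LoopKM.KacMoody C g)
    {n : ℕ} (r : Fin n → ℕ) (hr : ∀ i, 0 < r i)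
    (ξ : Fin n → ℂˣ) (hξ : ∀ i, IsPrimitiveRoot (ξ i) (r i))
    (B : Set (Fin n → ℂˣ)) (hB : LoopKM.IsTransversal r ξ B)
    (ψ : Module.Dual ℂ (K.loopCartan n))
    (hψ : ∀ x : K.cartan', LoopKM.IsExpPolyOn Set.univ fun m => ψ (K.cartanMono x m))
    (hA : K.imageAlg ψ = LoopKM.subLaurent r) :
    (∃ Φ, LoopKM.IsDecomposition K r ξ B ψ Φ) ∧
    ∀ Φ, LoopKM.IsDecomposition K r ξ B ψ Φ →
      (K.HasCharacter ψ ∧ K.HasCharacter Φ ∧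
        (∀ μ, (LoopKM.powTerms (K.char Φ) (∏ i, r i) μ).Finite) ∧
        K.char ψ = LoopKM.formalPow (K.char Φ) (∏ i, r i)) ∧
      ∀ k : (i : Fin n) → Fin (r i),
        (∀ x : g, LoopKM.twist (LoopKM.rootTuple ξ k) (LoopKM.const n x) = LoopKM.const n x) ∧
        ∃ E : K.simpleMod (K.twistFun (LoopKM.rootTuple ξ k) Φ) ≃ₗ[ℂ] K.simpleMod Φ,
          ∀ (x : LoopKM.loopAlg g n) (v : K.simpleMod (K.twistFun (LoopKM.rootTuple ξ k) Φ)),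
            E (K.act x v) = K.act (LoopKM.twist (LoopKM.rootTuple ξ k) x) (E v) := by
  refine ⟨K.exists_decomposition hr hξ hB hψ hA.le, fun Φ hΦ => ⟨?_, fun k => ?_⟩⟩
  · obtain ⟨⟨h1, h2⟩, h3⟩ := K.char_eq_formalPow hr hξ hB hΦ
    exact ⟨h1, h2, h3⟩
  · exact ⟨LoopKM.KacMoody.twist_const _, K.exists_twist_equiv Φ _⟩
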